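/- Let $G=(V,E,w)$ be a simple, connected, undirected graph with $n$ vertices, $m$ edges and nonnegative integer edge lengths, and let $s,t\in V$. A path is always simple; its length is the total length of its edges; $d(u,v)$ is the minimum length of a $uv$-path, $d_s(v)=d(s,v)$ and $d_t(v)=d(v,t)$. Let $D$ be the union of all shortest $st$-paths, and call an $st$-path a \emph{detour path} if it uses at least one edge not in $E(D)$. (1) There is an algorithm which, given $n$, $m$, $s$, $t$, the list of the edges of $G$ with their lengths, and the values $d_s(v)$ and $d_t(v)$ for all $v\in V$, finds a detour path of minimum length, or reports that there is no detour path, in $O(m+n)$ time. Precisely: there are one program for a unit-cost random access machine (whose arithmetic consists of addition, truncated subtraction and comparison) and one constant $C$ such that, for every such input, the program halts with a correct output after at most $C(m+n)$ steps; moreover, if all the input numbers are at most $B$, then it never writes a number greater than $C\cdot B$ to memory, or to an array position beyond $C\cdot B$. (2) Let $T$ be any shortest-path tree of $G$ rooted at $s$, let $F=T-E(D)$ be the forest on $V$ obtained from $T$ by deleting the edges of $D$, and let $\widetilde E$ be the set of the edges $xy\in E\setminus(E(T)\cup E(D))$ whose ends lie in different subtrees (connected components) of $F$. Put $f(x,y)=d_s(x)+w(x,y)+d_t(y)$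 if $xy\in\widetilde E$ and $f(x,y)=\infty$ otherwise. Then the minimum length of a detour path equals $\min_{x,y\in V}f(x,y)$ (both being $\infty$ if there is no detour path). -/

import Mathlib

/-! ### Paths, distances and detours in an undirected graph with edge lengths -/

namespace Detour

section Graph

variable {V : Type*}

/-- The length `w(P)` of a walk: the total length of its edges. -/
def walkLength {G : SimpleGraph V} (w : Sym2 V → ℕ) {u v : V} (p : G.Walk u v) : ℕ :=
  (p.edges.map w).sum

/-- The distance `d(u, v)`: the least length of a simple `uv`-path. -/
noncomputable def wdist (G : SimpleGraph V) (w : Sym2 V → ℕ) (u v : V) : ℕ :=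
  ⨅ p : G.Path u v, walkLength w (p : G.Walk u v)

/-- A shortest `uv`-path: a simple path of least length among all simple `uv`-paths. -/
def IsShortestPath {G : SimpleGraph V} (w : Sym2 V → ℕ) {u v : V} (p : G.Walk u v) : Prop :=
  p.IsPath ∧ ∀ q : G.Walk u v, q.IsPath → walkLength w p ≤ walkLength w q

/-- The edge set `E(D)` of the union `D` of all shortest `st`-paths. -/
def shortestEdges (G : SimpleGraph V) (w : Sym2 V → ℕ) (s t : V) : Set (Sym2 V) :=
  {e | ∃ p : G.Walk s t, IsShortestPath w p ∧ e ∈ p.edges}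

/-- A detour path: a simple `st`-path using at least one edge outside `D`. -/
def IsDetour {G : SimpleGraph V} (w : Sym2 V → ℕ) {s t : V} (p : G.Walk s t) : Prop :=
  p.IsPath ∧ ∃ e ∈ p.edges, e ∉ shortestEdges G w s t

/-- A shortest detour path: a detour path of least length among all detour paths. -/
def IsShortestDetour {G : SimpleGraph V} (w : Sym2 V → ℕ) {s t : V} (p : G.Walk s t) : Prop :=
  IsDetour w p ∧ ∀ q : G.Walk s t, IsDetour w q → walkLength w p ≤ walkLength w q

/-- `T` is a shortest-path tree of `G` rooted at `s`: a spanning tree of `G` in which the path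
from `s` to any vertex `v` has length `d(s, v)`. -/
def IsShortestPathTree (G : SimpleGraph V) (w : Sym2 V → ℕ) (s : V) (T : SimpleGraph V) : Prop :=
  T ≤ G ∧ T.IsTree ∧ ∀ (v : V) (p : T.Walk s v), p.IsPath → walkLength w p = wdist G w s v

/-- The forest `F = T - E(D)`, on all the vertices. -/
def forest (G : SimpleGraph V) (w : Sym2 V → ℕ) (s t : V) (T : SimpleGraph V) : SimpleGraph V :=
  T.deleteEdges (shortestEdges G w s t)

/-- The edge `xy` belongs to `Ẽ`: it is an edge of `G`, neither in `T` nor in `D`, and joins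
two different subtrees (connected components) of the forest `F`. -/
def IsCrossing (G : SimpleGraph V) (w : Sym2 V → ℕ) (s t : V) (T : SimpleGraph V) (x y : V) :
    Prop :=
  G.Adj x y ∧ ¬ T.Adj x y ∧ s(x, y) ∉ shortestEdges G w s t ∧
    ¬ (forest G w s t T).Reachable x y

open Classical in
/-- `f(x, y) = d_s(x) + w(x, y) + d_t(y)` if `xy ∈ Ẽ`, and `∞` otherwise. -/
noncomputable def crossCost (G : SimpleGraph V) (w : Sym2 V → ℕ) (s t : V) (T : SimpleGraph V)
    (x y : V) : ℕ∞ :=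
  if IsCrossing G w s t T x y then
    ((wdist G w s x + w s(x, y) + wdist G w y t : ℕ) : ℕ∞)
  else ⊤

end Graph

/-! ### A random access machine with unit costs

The machine has registers and arrays (indexed by numerals that occur in the program, hence
finitely many in each program), all of whose cells hold natural numbers. Programs are
structured; the only arithmetic is addition and truncated subtraction. -/

/-- A memory content: the values of the registers and of the cells of the arrays. -/
structure State where
  /-- The value of register `x`. -/
  reg : ℕ → ℕ
  /-- The value of cell `i` of array `a`. -/
  arr : ℕ → ℕ → ℕ

/-- Arithmetic expressions. -/
inductive Expr where
  | lit (k : ℕ)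
  | reg (x : ℕ)
  | arr (a : ℕ) (i : Expr)
  | add (e₁ e₂ : Expr)
  | sub (e₁ e₂ : Expr)

/-- The value of an expression. -/
def Expr.eval (σ : State) : Expr → ℕ
  | .lit k => k
  | .reg x => σ.reg x
  | .arr a i => σ.arr a (i.eval σ)
  | .add e₁ e₂ => e₁.eval σ + e₂.eval σ
  | .sub e₁ e₂ => e₁.eval σ - e₂.eval σ

/-- Tests. -/
inductive Test where
  | lt (e₁ e₂ : Expr)
  | eq (e₁ e₂ : Expr)
  | not (b : Test)
  | and (b₁ b₂ : Test)

/-- The truth of a test. -/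
def Test.Holds (σ : State) : Test → Prop
  | .lt e₁ e₂ => e₁.eval σ < e₂.eval σ
  | .eq e₁ e₂ => e₁.eval σ = e₂.eval σ
  | .not b => ¬ b.Holds σ
  | .and b₁ b₂ => b₁.Holds σ ∧ b₂.Holds σ

/-- Programs. -/
inductive Prog where
  | skip
  /-- `x := e` -/
  | set (x : ℕ) (e : Expr)
  /-- `a[i] := e` -/
  | put (a : ℕ) (i e : Expr)
  | seq (c₁ c₂ : Prog)
  | ite (b : Test) (c₁ c₂ : Prog)
  | loop (b : Test) (c : Prog)

/-- The memory after `x := k`. -/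
def State.set (σ : State) (x k : ℕ) : State :=
  { σ with reg := Function.update σ.reg x k }

/-- The memory after `a[i] := k`. -/
def State.put (σ : State) (a i k : ℕ) : State :=
  { σ with arr := Function.update σ.arr a (Function.update (σ.arr a) i k) }

/-- `Exec B c σ k σ'`: started in memory `σ`, the program `c` halts in memory `σ'` after `k`
steps, and no number greater than `B` is ever written to memory or used as an address of a
write (the run gets stuck otherwise, so that `B` plays the role of the largest machine word).
Every assignment, every write and every evaluation of a test takes one step: the expressions in
a program do not depend on its input, so evaluating them takes a constant number of elementary
operations, and their intermediate values exceed the stored numbers by a constant factor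
only. -/
inductive Exec (B : ℕ) : Prog → State → ℕ → State → Prop where
  | skip (σ : State) : Exec B .skip σ 1 σ
  | set (σ : State) (x : ℕ) (e : Expr) (he : e.eval σ ≤ B) :
      Exec B (.set x e) σ 1 (σ.set x (e.eval σ))
  | put (σ : State) (a : ℕ) (i e : Expr) (hi : i.eval σ ≤ B) (he : e.eval σ ≤ B) :
      Exec B (.put a i e) σ 1 (σ.put a (i.eval σ) (e.eval σ))
  | seq {c₁ c₂ : Prog} {σ₁ σ₂ σ₃ : State} {k₁ k₂ : ℕ} :
      Exec B c₁ σ₁ k₁ σ₂ → Exec B c₂ σ₂ k₂ σ₃ → Exec B (.seq c₁ c₂) σ₁ (k₁ + k₂) σ₃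
  | ite_true {b : Test} {c₁ c₂ : Prog} {σ σ' : State} {k : ℕ} :
      b.Holds σ → Exec B c₁ σ k σ' → Exec B (.ite b c₁ c₂) σ (k + 1) σ'
  | ite_false {b : Test} {c₁ c₂ : Prog} {σ σ' : State} {k : ℕ} :
      ¬ b.Holds σ → Exec B c₂ σ k σ' → Exec B (.ite b c₁ c₂) σ (k + 1) σ'
  | loop_true {b : Test} {c : Prog} {σ₁ σ₂ σ₃ : State} {k₁ k₂ : ℕ} :
      b.Holds σ₁ → Exec B c σ₁ k₁ σ₂ → Exec B (.loop b c) σ₂ k₂ σ₃ →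
      Exec B (.loop b c) σ₁ (k₁ + k₂ + 1) σ₃
  | loop_false {b : Test} {c : Prog} {σ : State} :
      ¬ b.Holds σ → Exec B (.loop b c) σ 1 σ

/-! ### Input and output -/

/-- The array holding `g 0, …, g (k - 1)`, and `0` in all the other cells. -/
def cells {k : ℕ} (g : Fin k → ℕ) (i : ℕ) : ℕ :=
  if h : i < k then g ⟨i, h⟩ else 0

/-- `src, dst` list the edges of `G`, each of them exactly once, in any order and with any
order of the two ends. -/
def IsEdgeList {n m : ℕ} (G : SimpleGraph (Fin n)) (src dst : Fin m → Fin n) : Prop :=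
  Function.Injective (fun i => s(src i, dst i)) ∧ Set.range (fun i => s(src i, dst i)) = G.edgeSet

/-- The initial memory. Registers `0, 1, 2, 3` hold `n, m, s, t`; arrays `0, 1, 2` hold the ends
and the lengths of the edges; arrays `3, 4` hold the distances `d_s(v)` and `d_t(v)`; all
other cells hold `0`. -/
noncomputable def inputState {n m : ℕ} (G : SimpleGraph (Fin n)) (w : Sym2 (Fin n) → ℕ)
    (s t : Fin n) (src dst : Fin m → Fin n) : State where
  reg := fun
    | 0 => n
    | 1 => m
    | 2 => s
    | 3 => t
    | _ => 0
  arr := fun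
    | 0 => cells fun i => (src i : ℕ)
    | 1 => cells fun i => (dst i : ℕ)
    | 2 => cells fun i => w s(src i, dst i)
    | 3 => cells fun v => wdist G w s v
    | 4 => cells fun v => wdist G w v t
    | _ => fun _ => 0

/-- All the numbers that are given to the machine are at most `B`. -/
def InputBound {n m : ℕ} (G : SimpleGraph (Fin n)) (w : Sym2 (Fin n) → ℕ)
    (s t : Fin n) (src dst : Fin m → Fin n) (B : ℕ) : Prop :=
  n ≤ B ∧ m ≤ B ∧ (∀ i, w s(src i, dst i) ≤ B) ∧ ∀ v, wdist G w s v ≤ B ∧ wdist G w v t ≤ B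

/-- The output list: the first `k` cells of array `5`, where `k` is the value of register `4`. -/
def State.output (σ : State) : List ℕ :=
  (List.range (σ.reg 4)).map (σ.arr 5)

/-- The list `l` solves the shortest detour path problem: it is the vertex sequence of a shortest
detour path, or it is empty and there is no detour path. -/
def SolvesDetour {n : ℕ} (G : SimpleGraph (Fin n)) (w : Sym2 (Fin n) → ℕ) (s t : Fin n)
    (l : List ℕ) : Prop :=
  (∃ p : G.Walk s t, IsShortestDetour w p ∧ l = p.support.map Fin.val) ∨
    (l = [] ∧ ¬ ∃ p : G.Walk s t, IsDetour w p)

end Detour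

namespace Detour

/-! ### Reasoning about runs -/

/-! Candidates. Hang every vertex v outside D from D twice: by edges tight for d_s, with root `r v`
in D, and by edges tight for d_t, with root `r' v`. Call an edge xy outside D a candidate if `r x ≠
r' y`, with cost d_s(x) + w(x,y) + d_t(y). The minimum length of a detour equals the minimum cost of
a candidate. Lower bound (`TreeData.exists_cand_le`): suppose that no candidate costs at most the
length ℓ of a detour p. Then r and r' agree on every vertex with d_s + d_t ≤ ℓ, and r takes equal
values at both ends of every edge of p outside D. So r is a retraction onto D under which p stands
still whenever it leaves D; a simple path cannot come back to the vertex at which it left, so p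
never leaves D (`edges_subset_of_retraction`). Upper bound (`runs_answer`): compare r x and r' y in
an order of D that increases along shortest paths. If r x comes first, go from s through r x, x, y,
r' y to t; otherwise traverse the edge from y to x, which is not longer. The two tree branches may
meet; pointers that are set from t backwards and never overwritten cut out the resulting loops and
still leave D somewhere, because the part of D before the first root and the part after the second
one are disjoint (`Linked.update`).

Finding D. Only edges of length 0 cause trouble: a vertex with d_s + d_t = d(s,t) need not lie on a
simple shortest path. Inside a component of tight zero-length edges the relevant vertices are those
on simple paths from an entry (s, or the head of a tight positive edge) to an exit (t, or the tail
of one). With a virtual vertex 0 joined to the entries, a virtual vertex 1 joined to the exits, and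
the edge 01, these are the vertices of the block that contains 01. Depth-first search from the exits
and lowpoints find that block, and an st-numbering of it gives every vertex a smaller and a larger
neighbour (`PosInv.step`, `stOrder`). Ordered by d_s first and by this number second, every vertex
of D has a predecessor and a successor, so it does lie on a simple shortest path; a vertex outside
the block is cut off by one vertex, so it does not (`cert_of_stOrder`).

The second claim. For a shortest-path tree T the same retraction argument is used twice. A crossing
edge cheaper than every candidate is impossible, because r would be reachable in F from both its
ends, with the same value. Conversely a tree path from D to the root stays in D, so each component
of F meets D in exactly one vertex; mapping a vertex to it is a retraction, and a detour must use a
crossing edge (`exists_crossing_le`).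

The run. `Runs` is a total-correctness predicate that also counts steps and checks the word bound.
Depth-first search is charged to unscanned half-edges and unfinished vertices, all other loops have
fixed length or follow a simple path, so the total is linear. -/

/-- The arrays that a program writes to. -/
def Prog.arrs : Prog → List ℕ
  | .skip => []
  | .set _ _ => []
  | .put a _ _ => [a]
  | .seq c₁ c₂ => c₁.arrs ++ c₂.arrs
  | .ite _ c₁ c₂ => c₁.arrs ++ c₂.arrs
  | .loop _ c => c.arrs

/-- The registers that a program writes to. -/
def Prog.regs : Prog → List ℕ
  | .skip => []
  | .set x _ => [x]
  | .put _ _ _ => []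
  | .seq c₁ c₂ => c₁.regs ++ c₂.regs
  | .ite _ c₁ c₂ => c₁.regs ++ c₂.regs
  | .loop _ c => c.regs

@[simp] theorem State.set_reg (σ : State) (x k y : ℕ) :
    (σ.set x k).reg y = if y = x then k else σ.reg y := by
  simp [State.set, Function.update_apply]

@[simp] theorem State.set_arr (σ : State) (x k : ℕ) : (σ.set x k).arr = σ.arr := rfl

@[simp] theorem State.put_reg (σ : State) (a i k : ℕ) : (σ.put a i k).reg = σ.reg := rfl

theorem State.put_arr_same (σ : State) (a i k : ℕ) :
    (σ.put a i k).arr a = Function.update (σ.arr a) i k := by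
  simp [State.put]

theorem State.put_arr_ne (σ : State) {a b : ℕ} (i k : ℕ) (h : b ≠ a) :
    (σ.put a i k).arr b = σ.arr b := by
  simp [State.put, h]

/-- The memories `σ` and `σ'` agree on everything that `c` does not write to. -/
def Agree (c : Prog) (σ σ' : State) : Prop :=
  (∀ a ∉ c.arrs, σ'.arr a = σ.arr a) ∧ ∀ x ∉ c.regs, σ'.reg x = σ.reg x

theorem Agree.refl (c : Prog) (σ : State) : Agree c σ σ :=
  ⟨fun _ _ => rfl, fun _ _ => rfl⟩

theorem Agree.trans {c : Prog} {σ₁ σ₂ σ₃ : State} (h₁ : Agree c σ₁ σ₂) (h₂ : Agree c σ₂ σ₃) :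
    Agree c σ₁ σ₃ :=
  ⟨fun a ha => (h₂.1 a ha).trans (h₁.1 a ha), fun x hx => (h₂.2 x hx).trans (h₁.2 x hx)⟩

theorem Agree.of_subset {c d : Prog} {σ σ' : State} (h : Agree c σ σ') (ha : c.arrs ⊆ d.arrs)
    (hr : c.regs ⊆ d.regs) : Agree d σ σ' :=
  ⟨fun a h' => h.1 a fun h'' => h' (ha h''), fun a h' => h.2 a fun h'' => h' (hr h'')⟩

theorem Exec.agree {B : ℕ} {c : Prog} {σ σ' : State} {k : ℕ} (h : Exec B c σ k σ') :
    Agree c σ σ' := by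
  induction h with
  | skip σ => exact Agree.refl _ _
  | set σ x e he =>
    refine ⟨fun _ _ => rfl, fun y hy => ?_⟩
    have : y ≠ x := by simpa [Prog.regs] using hy
    simp [this]
  | put σ a i e hi he =>
    refine ⟨fun y hy => ?_, fun _ _ => rfl⟩
    have : y ≠ a := by simpa [Prog.arrs] using hy
    exact σ.put_arr_ne _ _ this
  | seq _ _ ih₁ ih₂ =>
    exact (ih₁.of_subset (by simp [Prog.arrs]) (by simp [Prog.regs])).trans
      (ih₂.of_subset (by simp [Prog.arrs]) (by simp [Prog.regs]))
  | ite_true _ _ ih => exact ih.of_subset (by simp [Prog.arrs]) (by simp [Prog.regs])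
  | ite_false _ _ ih => exact ih.of_subset (by simp [Prog.arrs]) (by simp [Prog.regs])
  | loop_true _ _ _ ih₁ ih₂ =>
    exact (ih₁.of_subset (by simp [Prog.arrs]) (by simp [Prog.regs])).trans ih₂
  | loop_false _ => exact Agree.refl _ _

/-- Started in `σ`, the program `c` halts, and the final memory and the number of steps
satisfy `Q`. -/
def Runs (B : ℕ) (c : Prog) (σ : State) (Q : State → ℕ → Prop) : Prop :=
  ∃ k σ', Exec B c σ k σ' ∧ Q σ' k

section Runs

variable {B : ℕ} {c c₁ c₂ : Prog} {σ : State} {Q Q' : State → ℕ → Prop}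

/-- The consequence rule comes with a frame rule: what `c` does not write is unchanged, so no
invariant has to mention it. -/
theorem Runs.mono (h : Runs B c σ Q) (hQ : ∀ σ' k, Agree c σ σ' → Q σ' k → Q' σ' k) :
    Runs B c σ Q' :=
  let ⟨k, σ', he, hq⟩ := h
  ⟨k, σ', he, hQ σ' k he.agree hq⟩

theorem runs_skip : Runs B .skip σ Q ↔ Q σ 1 := by
  constructor
  · rintro ⟨k, σ', he, hq⟩
    cases he
    exact hq
  · exact fun h => ⟨_, _, .skip σ, h⟩

theorem runs_set {x : ℕ} {e : Expr} :
    Runs B (.set x e) σ Q ↔ e.eval σ ≤ B ∧ Q (σ.set x (e.eval σ)) 1 := by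
  constructor
  · rintro ⟨k, σ', he, hq⟩
    cases he
    exact ⟨by assumption, hq⟩
  · exact fun h => ⟨_, _, .set σ x e h.1, h.2⟩

theorem runs_put {a : ℕ} {i e : Expr} :
    Runs B (.put a i e) σ Q ↔
      i.eval σ ≤ B ∧ e.eval σ ≤ B ∧ Q (σ.put a (i.eval σ) (e.eval σ)) 1 := by
  constructor
  · rintro ⟨k, σ', he, hq⟩
    cases he
    exact ⟨by assumption, by assumption, hq⟩
  · exact fun h => ⟨_, _, .put σ a i e h.1 h.2.1, h.2.2⟩

theorem runs_seq :
    Runs B (.seq c₁ c₂) σ Q ↔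
      Runs B c₁ σ fun σ₁ k₁ => Runs B c₂ σ₁ fun σ₂ k₂ => Q σ₂ (k₁ + k₂) := by
  constructor
  · rintro ⟨k, σ', he, hq⟩
    cases he with
    | seq h₁ h₂ => exact ⟨_, _, h₁, _, _, h₂, hq⟩
  · rintro ⟨_, _, h₁, _, _, h₂, hq⟩
    exact ⟨_, _, .seq h₁ h₂, hq⟩

theorem runs_ite {b : Test} :
    Runs B (.ite b c₁ c₂) σ Q ↔
      (b.Holds σ → Runs B c₁ σ fun σ' k => Q σ' (k + 1)) ∧
        (¬ b.Holds σ → Runs B c₂ σ fun σ' k => Q σ' (k + 1)) := by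
  constructor
  · rintro ⟨k, σ', he, hq⟩
    cases he with
    | ite_true hb h => exact ⟨fun _ => ⟨_, _, h, hq⟩, fun h' => absurd hb h'⟩
    | ite_false hb h => exact ⟨fun h' => absurd h' hb, fun _ => ⟨_, _, h, hq⟩⟩
  · rintro ⟨h₁, h₂⟩
    by_cases hb : b.Holds σ
    · obtain ⟨_, _, h, hq⟩ := h₁ hb
      exact ⟨_, _, .ite_true hb h, hq⟩
    · obtain ⟨_, _, h, hq⟩ := h₂ hb
      exact ⟨_, _, .ite_false hb h, hq⟩

/-- A loop whose body preserves the invariant `I`, and pays for its steps from the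
potential `Φ`. -/
theorem Runs.loop {b : Test} (I : State → Prop) (Φ : State → ℕ) (h₀ : I σ)
    (h : ∀ σ₁, Agree c σ σ₁ → I σ₁ → b.Holds σ₁ →
      Runs B c σ₁ fun σ₂ k => I σ₂ ∧ k + 1 + Φ σ₂ ≤ Φ σ₁) :
    Runs B (.loop b c) σ fun σ' k => I σ' ∧ ¬ b.Holds σ' ∧ k + Φ σ' ≤ Φ σ + 1 := by
  -- Every round lowers the potential, so induction on a bound N of it proves termination. Agreement
  -- with the initial memory is carried along for use in the body.
  suffices H : ∀ N σ₁, Φ σ₁ ≤ N → Agree c σ σ₁ → I σ₁ →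
      Runs B (.loop b c) σ₁ fun σ' k => I σ' ∧ ¬ b.Holds σ' ∧ k + Φ σ' ≤ Φ σ₁ + 1 from
    H _ σ le_rfl (Agree.refl _ _) h₀
  intro N
  induction N with
  | zero =>
    intro σ₁ hN hA hI
    by_cases hb : b.Holds σ₁
    · obtain ⟨k, σ₂, _, _, hk⟩ := h σ₁ hA hI hb
      omega
    · exact ⟨_, _, .loop_false hb, hI, hb, by omega⟩
  | succ N ih =>
    intro σ₁ hN hA hI
    by_cases hb : b.Holds σ₁
    · obtain ⟨k, σ₂, he, hI₂, hk⟩ := h σ₁ hA hI hb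
      obtain ⟨k', σ₃, he', hI₃, hb₃, hk'⟩ := ih σ₂ (by omega) (hA.trans he.agree) hI₂
      exact ⟨_, _, .loop_true hb he he', hI₃, hb₃, by omega⟩
    · exact ⟨_, _, .loop_false hb, hI, hb, by omega⟩

/-- `for x := 0, …, e - 1 do c` -/
def Prog.range (x : ℕ) (e : Expr) (c : Prog) : Prog :=
  .seq (.set x (.lit 0))
    (.loop (.lt (.reg x) e) (.seq c (.set x (.add (.reg x) (.lit 1)))))

theorem Prog.arrs_range (x : ℕ) (e : Expr) (c : Prog) : (Prog.range x e c).arrs = c.arrs := by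
  simp [Prog.range, Prog.arrs]

theorem Prog.regs_range (x : ℕ) (e : Expr) (c : Prog) :
    (Prog.range x e c).regs = x :: (c.regs ++ [x]) := by
  simp [Prog.range, Prog.regs]

/-- A counting loop whose body takes at most `K` steps, apart from those that it pays for from
the potential `Φ`. -/
theorem Runs.range {x N K : ℕ} {e : Expr} (I : ℕ → State → Prop) (Φ : State → ℕ) (hN : N ≤ B)
    (hx : x ∉ c.regs)
    (he : ∀ σ', Agree (Prog.range x e c) σ σ' → e.eval σ' = N)
    (h₀ : I 0 (σ.set x 0)) (hΦ₀ : Φ (σ.set x 0) = Φ σ)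
    (hset : ∀ i σ' k, I i σ' → I i (σ'.set x k) ∧ Φ (σ'.set x k) = Φ σ')
    (h : ∀ i < N, ∀ σ₁, Agree (Prog.range x e c) σ σ₁ → σ₁.reg x = i → I i σ₁ →
      Runs B c σ₁ fun σ₂ k => I (i + 1) σ₂ ∧ k + Φ σ₂ ≤ K + Φ σ₁) :
    Runs B (.range x e c) σ fun σ' k => I N σ' ∧ k ≤ (K + 2) * N + Φ σ + 2 := by
  have hag : ∀ σ', Agree (.seq c (.set x (.add (.reg x) (.lit 1)))) (σ.set x 0) σ' →
      Agree (Prog.range x e c) σ σ' := by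
    intro σ' h'
    refine ⟨fun a ha => h'.1 a ?_, fun y hy => ?_⟩
    · simpa [Prog.arrs_range, Prog.arrs] using ha
    · rw [Prog.regs_range] at hy
      simp only [List.mem_cons, List.mem_append, List.not_mem_nil, or_false, not_or] at hy
      rw [h'.2 y (by simpa [Prog.regs] using ⟨hy.2.1, hy.1⟩)]
      simp [hy.1]
  rw [Prog.range, runs_seq, runs_set]
  refine ⟨Nat.zero_le _, ?_⟩
  refine (Runs.loop (fun σ' => ∃ i ≤ N, σ'.reg x = i ∧ I i σ')
    -- Each remaining round is prepaid with K steps for the body, one for the increment and one for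
    -- the test.
    (fun σ' => (K + 2) * (N - σ'.reg x) + Φ σ')
    ⟨0, Nat.zero_le _, by simp, h₀⟩ ?_).mono ?_
  · rintro σ₁ hA ⟨i, hi, hxi, hI⟩ hb
    have hA' := hag _ hA
    have hlt : i < N := by
      have := he _ hA'
      simp only [Test.Holds, Expr.eval, this, hxi] at hb
      exact hb
    rw [runs_seq]
    refine (h i hlt σ₁ hA' hxi hI).mono ?_
    rintro σ₂ k hA₂ ⟨hI₂, hk⟩
    have hx₂ : σ₂.reg x = i := (hA₂.2 x hx).trans hxi
    rw [runs_set]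
    simp only [Expr.eval, hx₂]
    have h3 := hset _ _ (i + 1) hI₂
    refine ⟨by omega, ⟨i + 1, hlt, by simp, h3.1⟩, ?_⟩
    rw [h3.2]
    simp only [State.set_reg, if_true, hxi]
    have : N - i = (N - (i + 1)) + 1 := by omega
    rw [this, Nat.mul_add]
    omega
  · rintro σ' k hA ⟨⟨i, hi, hxi, hI⟩, hb, hk⟩
    have := he _ (hag _ hA)
    simp only [Test.Holds, Expr.eval, this, hxi] at hb
    obtain rfl : i = N := by omega
    refine ⟨hI, ?_⟩
    simp only [State.set_reg, if_true, hΦ₀] at hk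
    simp only [Nat.sub_zero] at hk
    omega

/-- A counting loop whose body takes at most `K` steps. -/
theorem Runs.range_const {x N K : ℕ} {e : Expr} (I : ℕ → State → Prop) (hN : N ≤ B)
    (hx : x ∉ c.regs)
    (he : ∀ σ', Agree (Prog.range x e c) σ σ' → e.eval σ' = N)
    (h₀ : I 0 (σ.set x 0))
    (hset : ∀ i σ' k, I i σ' → I i (σ'.set x k))
    (h : ∀ i < N, ∀ σ₁, Agree (Prog.range x e c) σ σ₁ → σ₁.reg x = i → I i σ₁ →
      Runs B c σ₁ fun σ₂ k => I (i + 1) σ₂ ∧ k ≤ K) :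
    Runs B (.range x e c) σ fun σ' k => I N σ' ∧ k ≤ (K + 2) * N + 2 :=
  Runs.range I (fun _ => 0) hN hx he h₀ rfl (fun i σ' k h => ⟨hset i σ' k h, rfl⟩)
    fun i hi σ₁ hA hr hI => h i hi σ₁ hA hr hI

end Runs

end Detour


namespace Detour

/-! ### Depth-first search: the abstract algorithm

The vertices are `1, …, n`, and `0` stands for no vertex. The half-edges `h < M` have source `S h`
and target `D h`. The preorder numbers of the visited vertices start from `2`; the preorder number
of the absent parent `0` is `1`. -/

/-- `a` is an ancestor of `x`, or equal to `x`, in the forest with parent pointers `par`. -/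
inductive Anc (par : ℕ → ℕ) (a : ℕ) : ℕ → Prop where
  | refl : Anc par a a
  | step {x : ℕ} : x ≠ 0 → Anc par a (par x) → Anc par a x

/-- `nxt` links the half-edges with the same source in decreasing order; a pointer to the
half-edge `h` is `h + 1`, and `0` is the empty pointer. -/
structure AdjList (n M : ℕ) (S D nxt : ℕ → ℕ) : Prop where
  src : ∀ h < M, 1 ≤ S h ∧ S h ≤ n
  dst : ∀ h < M, 1 ≤ D h ∧ D h ≤ n
  le : ∀ h < M, nxt h ≤ h
  same : ∀ h < M, nxt h ≠ 0 → S (nxt h - 1) = S h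
  next : ∀ h < M, ∀ h' < h, S h' = S h → h' + 1 ≤ nxt h

/-- The invariant of depth-first search along the half-edges in `P` from the roots in `R`, when the
current vertex is `U`. -/
structure DfsInv (n M : ℕ) (S D : ℕ → ℕ) (P R : ℕ → Prop) (pre par ord root ptr dn : ℕ → ℕ)
    (cnt U : ℕ) : Prop where
  pre_zero : pre 0 = 1
  par_zero : par 0 = 0
  pre_lt : ∀ v, v ≠ 0 → pre v ≠ 0 → 2 ≤ pre v ∧ pre v < cnt ∧ v ≤ n ∧ ord (pre v) = v
  ord_pre : ∀ i, 2 ≤ i → i < cnt → 1 ≤ ord i ∧ pre (ord i) = i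
  two_le : 2 ≤ cnt
  tree : ∀ v, 2 ≤ pre v → (par v = 0 ∧ root v = v ∧ R v) ∨
    (2 ≤ pre (par v) ∧ pre (par v) < pre v ∧ (∃ h < M, S h = par v ∧ D h = v ∧ P h) ∧
      root v = root (par v))
  unvisited : ∀ v, pre v = 0 → par v = 0 ∧ dn v = 0
  ptr_le : ∀ v, ptr v ≤ M
  ptr_src : ∀ v, ptr v ≠ 0 → S (ptr v - 1) = v
  scan : ∀ h < M, ptr (S h) < h + 1 → P h → 2 ≤ pre (D h)
  finished : ∀ v, dn v ≠ 0 → ptr v = 0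
  gray : ∀ v, 2 ≤ pre v → (dn v = 0 ↔ U ≠ 0 ∧ Anc par v U)
  current : U ≠ 0 → 2 ≤ pre U
  cross : ∀ h < M, P h → 2 ≤ pre (S h) → pre (S h) < pre (D h) → Anc par (S h) (D h)

/-- The result of depth-first search. -/
structure DfsOut (n M : ℕ) (S D : ℕ → ℕ) (P R : ℕ → Prop) (pre par ord root : ℕ → ℕ)
    (cnt : ℕ) : Prop where
  pre_zero : pre 0 = 1
  par_zero : par 0 = 0
  pre_lt : ∀ v, v ≠ 0 → pre v ≠ 0 → 2 ≤ pre v ∧ pre v < cnt ∧ v ≤ n ∧ ord (pre v) = v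
  ord_pre : ∀ i, 2 ≤ i → i < cnt → 1 ≤ ord i ∧ pre (ord i) = i
  two_le : 2 ≤ cnt
  cnt_le : cnt ≤ n + 2
  tree : ∀ v, 2 ≤ pre v → (par v = 0 ∧ root v = v ∧ R v) ∨
    (2 ≤ pre (par v) ∧ pre (par v) < pre v ∧ (∃ h < M, S h = par v ∧ D h = v ∧ P h) ∧
      root v = root (par v))
  closed : ∀ h < M, P h → 2 ≤ pre (S h) → 2 ≤ pre (D h)
  roots : ∀ v, 1 ≤ v → v ≤ n → R v → 2 ≤ pre v
  cross : ∀ h < M, P h → 2 ≤ pre (S h) → pre (S h) < pre (D h) → Anc par (S h) (D h)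

/-- The number of half-edges that have not been scanned yet. -/
def scanPot (M : ℕ) (S ptr : ℕ → ℕ) : ℕ :=
  ((Finset.range M).filter fun h => h + 1 ≤ ptr (S h)).card

/-- The number of vertices whose cell in `dn` is `0`. -/
def openPot (n : ℕ) (dn : ℕ → ℕ) : ℕ :=
  ((Finset.Icc 1 n).filter fun v => dn v = 0).card

theorem scanPot_le (M : ℕ) (S ptr : ℕ → ℕ) : scanPot M S ptr ≤ M :=
  (Finset.card_filter_le _ _).trans (Finset.card_range M).le

theorem openPot_le (n : ℕ) (dn : ℕ → ℕ) : openPot n dn ≤ n :=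
  (Finset.card_filter_le _ _).trans (by simp)

/-- Links strictly descend, since `nxt h ≤ h` while the pointer to h is h + 1. So h itself drops out
of the count and nothing enters. -/
theorem scanPot_update {n M : ℕ} {S D nxt ptr : ℕ → ℕ} (A : AdjList n M S D nxt) {h : ℕ}
    (hM : h < M) (hp : ptr (S h) = h + 1) :
    scanPot M S (Function.update ptr (S h) (nxt h)) + 1 ≤ scanPot M S ptr := by
  apply Finset.card_lt_card
  rw [Finset.ssubset_iff]
  refine ⟨h, ?_, ?_⟩
  · have := A.le h hM
    simp [hM]
    omega
  · intro k hk
    simp only [Finset.mem_insert, Finset.mem_filter, Finset.mem_range] at hk ⊢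
    rcases hk with rfl | ⟨hk, hk'⟩
    · exact ⟨hM, hp.ge⟩
    · refine ⟨hk, ?_⟩
      by_cases hS : S k = S h
      · rw [hS, Function.update_self] at hk'
        rw [hS, hp]
        have := A.le h hM
        omega
      · rwa [Function.update_of_ne hS] at hk'

theorem openPot_update {n : ℕ} {dn : ℕ → ℕ} {v : ℕ} (hv : 1 ≤ v) (hn : v ≤ n) (h : dn v = 0) {k : ℕ}
    (hk : k ≠ 0) : openPot n (Function.update dn v k) + 1 ≤ openPot n dn := by
  apply Finset.card_lt_card
  rw [Finset.ssubset_iff]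
  refine ⟨v, by simp [hk], ?_⟩
  intro x hx
  simp only [Finset.mem_insert, Finset.mem_filter, Finset.mem_Icc] at hx ⊢
  rcases hx with rfl | ⟨hx, hx'⟩
  · exact ⟨⟨hv, hn⟩, h⟩
  · refine ⟨hx, ?_⟩
    by_cases hS : x = v
    · exact hS ▸ h
    · rwa [Function.update_of_ne hS] at hx'

/-- `ord` injects the used preorder numbers into the vertices 1, …, n. This keeps the counter within
the word bound. -/
theorem count_le {n cnt : ℕ} {pre ord : ℕ → ℕ}
    (h₁ : ∀ v, v ≠ 0 → pre v ≠ 0 → 2 ≤ pre v ∧ pre v < cnt ∧ v ≤ n ∧ ord (pre v) = v)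
    (h₂ : ∀ i, 2 ≤ i → i < cnt → 1 ≤ ord i ∧ pre (ord i) = i) : cnt ≤ n + 2 := by
  have := Finset.card_le_card_of_injOn (s := Finset.Ico 2 cnt) (t := Finset.Icc 1 n) ord
    (by
      intro i hi
      simp only [Finset.coe_Ico, Set.mem_Ico] at hi
      have h4 := h₂ i hi.1 hi.2
      have h5 := h₁ (ord i) (by omega) (by omega)
      simp only [Finset.coe_Icc, Set.mem_Icc]
      omega)
    (by
      intro i hi j hj hij
      simp only [Finset.coe_Ico, Set.mem_Ico] at hi hj
      rw [← (h₂ i hi.1 hi.2).2, ← (h₂ j hj.1 hj.2).2, hij])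
  simp at this
  omega

theorem count_lt {n cnt : ℕ} {pre ord : ℕ → ℕ}
    (h₁ : ∀ v, v ≠ 0 → pre v ≠ 0 → 2 ≤ pre v ∧ pre v < cnt ∧ v ≤ n ∧ ord (pre v) = v)
    (h₂ : ∀ i, 2 ≤ i → i < cnt → 1 ≤ ord i ∧ pre (ord i) = i) {x : ℕ} (hx : 1 ≤ x)
    (hn : x ≤ n) (h : pre x = 0) : cnt ≤ n + 1 := by
  have := Finset.card_le_card_of_injOn (s := Finset.Ico 2 cnt) (t := (Finset.Icc 1 n).erase x) ord
    (by
      intro i hi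
      simp only [Finset.coe_Ico, Set.mem_Ico] at hi
      have h4 := h₂ i hi.1 hi.2
      have h5 := h₁ (ord i) (by omega) (by omega)
      simp only [Finset.coe_erase, Finset.coe_Icc, Set.mem_sdiff, Set.mem_Icc, Set.mem_singleton_iff]
      refine ⟨by omega, fun h6 => ?_⟩
      rw [h6] at h4
      omega)
    (by
      intro i hi j hj hij
      simp only [Finset.coe_Ico, Set.mem_Ico] at hi hj
      rw [← (h₂ i hi.1 hi.2).2, ← (h₂ j hj.1 hj.2).2, hij])
  rw [Finset.card_erase_of_mem (by simp; omega)] at this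
  simp at this
  omega

namespace DfsInv

variable {n M : ℕ} {S D : ℕ → ℕ} {P R : ℕ → Prop} {pre par ord root ptr dn nxt : ℕ → ℕ}
  {cnt U : ℕ}

theorem anc_le (I : DfsInv n M S D P R pre par ord root ptr dn cnt U) {a x : ℕ} (h : Anc par a x)
    (ha : a ≠ 0) (hx : 2 ≤ pre x) : pre a ≤ pre x := by
  induction h with
  | refl => exact le_rfl
  | @step x hx0 h' ih =>
    rcases I.tree x hx with h1 | h1
    · rw [h1.1] at h'
      cases h' with
      | refl => exact absurd rfl ha
      | step h0 => exact absurd rfl h0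
    · exact (ih h1.1).trans h1.2.1.le

/-- The parent of a visited vertex is visited or 0, so the chain of ancestors of a visited vertex
never reads the cell of the unvisited y. -/
theorem anc_update (I : DfsInv n M S D P R pre par ord root ptr dn cnt U) {y q a x : ℕ}
    (hy : pre y = 0) (ha : a ≠ 0) (hx : 2 ≤ pre x) :
    Anc (Function.update par y q) a x ↔ Anc par a x := by
  have key : ∀ x, 2 ≤ pre x → Function.update par y q x = par x := by
    intro x hx
    rw [Function.update_of_ne]
    rintro rfl
    omega
  constructor
  · intro h
    induction h with
    | refl => exact .refl
    | @step x hx0 h' ih =>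
      rw [key x hx] at h' ih
      rcases I.tree x hx with h1 | h1
      · rw [h1.1] at h'
        cases h' with
        | refl => exact absurd rfl ha
        | step h0 => exact absurd rfl h0
      · exact .step hx0 (ih h1.1)
  · intro h
    induction h with
    | refl => exact .refl
    | @step x hx0 h' ih =>
      rcases I.tree x hx with h1 | h1
      · rw [h1.1] at h'
        cases h' with
        | refl => exact absurd rfl ha
        | step h0 => exact absurd rfl h0
      · exact .step hx0 (by rw [key x hx]; exact ih h1.1)

/-- The two alternatives of the hypothesis are a new root and a tree edge from the current vertex.
All fields but `cross` and `gray` are bookkeeping; the ancestors of x are x and the vertices that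
were open before. -/
theorem visit (I : DfsInv n M S D P R pre par ord root ptr dn cnt U) {x rt : ℕ} (hx : 1 ≤ x)
    (hn : x ≤ n) (hp : pre x = 0)
    (h : (U = 0 ∧ R x ∧ rt = x) ∨ (U ≠ 0 ∧ (∃ h < M, S h = U ∧ D h = x ∧ P h) ∧ rt = root U)) :
    DfsInv n M S D P R (Function.update pre x cnt) (Function.update par x U)
      (Function.update ord cnt x) (Function.update root x rt) ptr dn (cnt + 1) x := by
  have hc := I.two_le
  have hpre : ∀ v, v ≠ x → Function.update pre x cnt v = pre v := fun v hv =>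
    Function.update_of_ne hv _ _
  have hpx : Function.update pre x cnt x = cnt := Function.update_self ..
  have hvis : ∀ v, 2 ≤ pre v → v ≠ x := by
    rintro v hv rfl
    omega
  have hmono : ∀ v, 2 ≤ pre v → 2 ≤ Function.update pre x cnt v := by
    intro v hv
    rwa [hpre v (hvis v hv)]
  have hU : U ≠ x := by
    rintro rfl
    have := I.current (by omega)
    omega
  have hlt : ∀ v, 2 ≤ pre v → pre v < cnt := by
    intro v hv
    have h0 : v ≠ 0 := by
      rintro rfl
      have := I.pre_zero
      omega
    exact (I.pre_lt v h0 (by omega)).2.1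
  have hne0 : ∀ v, 2 ≤ pre v → v ≠ 0 := by
    rintro v hv rfl
    have := I.pre_zero
    omega
  have ancx : ∀ v, v ≠ 0 → 2 ≤ pre v →
      (Anc (Function.update par x U) v x ↔ U ≠ 0 ∧ Anc par v U) := by
    intro v hv hv2
    constructor
    · intro h'
      cases h' with
      | refl => exact absurd rfl (hvis _ hv2)
      | step h0 h1 =>
        rw [Function.update_self] at h1
        have hU0 : U ≠ 0 := by
          rintro rfl
          cases h1 with
          | refl => exact hv rfl
          | step h0 => exact h0 rfl
        exact ⟨hU0, (I.anc_update hp hv (I.current hU0)).1 h1⟩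
    · rintro ⟨hU0, h1⟩
      refine .step (by omega) ?_
      rw [Function.update_self]
      exact (I.anc_update hp hv (I.current hU0)).2 h1
  refine
    { pre_zero := by rw [hpre 0 (by omega)]; exact I.pre_zero
      par_zero := by rw [Function.update_of_ne (by omega)]; exact I.par_zero
      pre_lt := ?_
      ord_pre := ?_
      two_le := by omega
      tree := ?_
      unvisited := ?_
      ptr_le := I.ptr_le
      ptr_src := I.ptr_src
      scan := fun h hM h1 h2 => hmono _ (I.scan h hM h1 h2)
      finished := I.finished
      gray := ?_
      current := fun _ => by rw [hpx]; exact hc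
      cross := ?_ }
  · intro v hv hv'
    by_cases hvx : v = x
    · subst hvx
      simp only [Function.update_self]
      exact ⟨hc, by omega, hn, trivial⟩
    · rw [hpre v hvx] at hv' ⊢
      have := I.pre_lt v hv hv'
      rw [Function.update_of_ne (by omega)]
      exact ⟨this.1, by omega, this.2.2⟩
  · intro i hi hi'
    by_cases hic : i = cnt
    · subst hic
      simp only [Function.update_self]
      exact ⟨hx, trivial⟩
    · rw [Function.update_of_ne hic]
      have := I.ord_pre i hi (by omega)
      rw [hpre _ (hvis _ (by omega))]
      exact this
  · intro v hv
    by_cases hvx : v = x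
    · subst hvx
      simp only [Function.update_self]
      rcases h with ⟨h1, h2, h3⟩ | ⟨h1, h2, h3⟩
      · exact .inl ⟨h1, h3, h2⟩
      · have hU2 := I.current h1
        rw [hpre U hU, Function.update_of_ne hU]
        exact .inr ⟨hU2, hlt U hU2, h2, h3⟩
    · rw [hpre v hvx] at hv ⊢
      rw [Function.update_of_ne hvx, Function.update_of_ne hvx]
      rcases I.tree v hv with h1 | ⟨h1, h2, h3, h4⟩
      · exact .inl h1
      · rw [hpre _ (hvis _ h1), Function.update_of_ne (hvis _ h1)]
        exact .inr ⟨h1, h2, h3, h4⟩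
  · intro v hv
    have hvx : v ≠ x := by
      rintro rfl
      omega
    rw [hpre v hvx] at hv
    rw [Function.update_of_ne hvx]
    exact I.unvisited v hv
  · intro v hv
    by_cases hvx : v = x
    · subst hvx
      exact ⟨fun _ => ⟨by omega, .refl⟩, fun _ => (I.unvisited v hp).2⟩
    · rw [hpre v hvx] at hv
      rw [I.gray v hv, ancx v (hne0 v hv) hv]
      exact ⟨fun h' => ⟨by omega, h'⟩, fun h' => h'.2⟩
  · intro e he hP hS hlt'
    by_cases hSx : S e = x
    · rw [hSx, hpx] at hlt'
      by_cases hDx : D e = x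
      · rw [hDx, hpx] at hlt'
        omega
      · rw [hpre _ hDx] at hlt'
        have := hlt (D e) (by omega)
        omega
    · rw [hpre _ hSx] at hS hlt'
      by_cases hDx : D e = x
      · rw [hDx]
        -- A finished source would have an empty pointer, and by `scan` its target x would have been
        -- visited already. So the source is still open, hence an ancestor of U and of x.
        refine (ancx _ (hne0 _ hS) hS).2 ((I.gray _ hS).1 ?_)
        by_contra hdn
        have := I.scan e he (by rw [I.finished _ hdn]; omega) hP
        rw [hDx] at this
        omega
      · rw [hpre _ hDx] at hlt'
        exact (I.anc_update hp (hne0 _ hS) (by omega)).2 (I.cross e he hP hS hlt')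

/-- Moving the pointer of u declares one half-edge scanned, and no other since its link points to
the largest earlier half-edge of the same source. So it suffices that this one leads to a visited
vertex. -/
theorem advance (I : DfsInv n M S D P R pre par ord root ptr dn cnt U) (A : AdjList n M S D nxt)
    {u : ℕ} (hp : ptr u ≠ 0) (h : P (ptr u - 1) → 2 ≤ pre (D (ptr u - 1))) :
    DfsInv n M S D P R pre par ord root (Function.update ptr u (nxt (ptr u - 1))) dn cnt U := by
  have hle := I.ptr_le u
  have hlt : ptr u - 1 < M := by omega
  have hsrc := I.ptr_src u hp
  refine { I with ptr_le := ?_, ptr_src := ?_, scan := ?_, finished := ?_ }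
  · intro v
    by_cases hv : v = u
    · rw [hv, Function.update_self]
      have := A.le _ hlt
      omega
    · rw [Function.update_of_ne hv]
      exact I.ptr_le v
  · intro v
    by_cases hv : v = u
    · rw [hv, Function.update_self]
      intro h'
      rw [A.same _ hlt h', hsrc]
    · rw [Function.update_of_ne hv]
      exact I.ptr_src v
  · intro e he hlt' hP
    by_cases hv : S e = u
    · rw [hv, Function.update_self] at hlt'
      rcases lt_trichotomy e (ptr u - 1) with h1 | h1 | h1
      · have := A.next _ hlt e h1 (by rw [hv, hsrc])
        omega
      · rw [h1]
        exact h (h1 ▸ hP)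
      · exact I.scan e he (by rw [hv]; omega) hP
    · rw [Function.update_of_ne hv] at hlt'
      exact I.scan e he hlt' hP
  · intro v hv
    have : v ≠ u := by
      rintro rfl
      exact hp (I.finished _ hv)
    rw [Function.update_of_ne this]
    exact I.finished v hv

theorem pop (I : DfsInv n M S D P R pre par ord root ptr dn cnt U) (hU : U ≠ 0) (hp : ptr U = 0) :
    DfsInv n M S D P R pre par ord root ptr (Function.update dn U 1) cnt (par U) := by
  have hU2 := I.current hU
  refine { I with unvisited := ?_, finished := ?_, gray := ?_, current := ?_ }
  · intro v hv
    rw [Function.update_of_ne (by rintro rfl; omega)]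
    exact I.unvisited v hv
  · intro v hv
    by_cases hvU : v = U
    · rw [hvU, hp]
    · rw [Function.update_of_ne hvU] at hv
      exact I.finished v hv
  · intro v hv
    have hv0 : v ≠ 0 := by
      rintro rfl
      have := I.pre_zero
      omega
    by_cases hvU : v = U
    · subst hvU
      simp only [Function.update_self, one_ne_zero, false_iff, not_and]
      intro h0 h1
      rcases I.tree v hv with h2 | h2
      · exact h0 h2.1
      · have := I.anc_le h1 hv0 h2.1
        omega
    · rw [Function.update_of_ne hvU, I.gray v hv]
      constructor
      · rintro ⟨_, h1⟩
        cases h1 with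
        | refl => exact absurd rfl hvU
        | step h0 h1 =>
          refine ⟨?_, h1⟩
          intro h2
          rw [h2] at h1
          cases h1 with
          | refl => exact hv0 rfl
          | step h0 => exact h0 rfl
      · rintro ⟨_, h1⟩
        exact ⟨hU, .step hU h1⟩
  · intro h0
    rcases I.tree U hU2 with h2 | h2
    · exact absurd h2.1 h0
    · exact h2.1

/-- With no current vertex nothing is open; every visited vertex is finished, its pointer is empty,
and all its half-edges count as scanned. -/
theorem out (I : DfsInv n M S D P R pre par ord root ptr dn cnt 0)
    (hR : ∀ v, 1 ≤ v → v ≤ n → R v → 2 ≤ pre v) :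
    DfsOut n M S D P R pre par ord root cnt where
  pre_zero := I.pre_zero
  par_zero := I.par_zero
  pre_lt := I.pre_lt
  ord_pre := I.ord_pre
  two_le := I.two_le
  cnt_le := count_le I.pre_lt I.ord_pre
  tree := I.tree
  closed := fun h hM hP hS => by
    refine I.scan h hM ?_ hP
    rw [I.finished (S h) fun h0 => ((I.gray _ hS).1 h0).1 rfl]
    omega
  roots := hR
  cross := I.cross

end DfsInv

end Detour


namespace Detour

/-! ### Depth-first search: the program -/

/-- Build the adjacency lists: arrays `b`, `b + 1` hold the links and the heads. -/
def buildLists (b : ℕ) : Prog :=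
  .range 10 (.reg 7)
    (.seq (.put b (.reg 10) (.arr (b + 1) (.arr 6 (.reg 10))))
      (.put (b + 1) (.arr 6 (.reg 10)) (.add (.reg 10) (.lit 1))))

/-- One step of depth-first search: scan the next half-edge from the current vertex, or backtrack. -/
def dfsStep (b : ℕ) (et : Test) : Prog :=
  .seq (.set 12 (.arr (b + 1) (.reg 11)))
    (.ite (.eq (.reg 12) (.lit 0))
      (.seq (.put (b + 6) (.reg 11) (.lit 1)) (.set 11 (.arr (b + 3) (.reg 11))))
      (.seq (.set 12 (.sub (.reg 12) (.lit 1)))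
        (.seq (.put (b + 1) (.reg 11) (.arr b (.reg 12)))
          (.seq (.set 13 (.arr 7 (.reg 12)))
            (.ite (.and et (.eq (.arr (b + 2) (.reg 13)) (.lit 0)))
              (.seq (.put (b + 2) (.reg 13) (.reg 14))
                (.seq (.put (b + 3) (.reg 13) (.reg 11))
                  (.seq (.put (b + 4) (.reg 14) (.reg 13))
                    (.seq (.put (b + 5) (.reg 13) (.arr (b + 5) (.reg 11)))
                      (.seq (.set 14 (.add (.reg 14) (.lit 1))) (.set 11 (.reg 13)))))))
              .skip)))))

/-- Search from the vertex in register `11`, if it is an unvisited root. -/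
def dfsRoot (b : ℕ) (rt et : Test) : Prog :=
  .seq (.set 11 (.add (.reg 10) (.lit 1)))
    (.ite (.and rt (.eq (.arr (b + 2) (.reg 11)) (.lit 0)))
      (.seq (.put (b + 2) (.reg 11) (.reg 14))
        (.seq (.put (b + 4) (.reg 14) (.reg 11))
          (.seq (.put (b + 5) (.reg 11) (.reg 11))
            (.seq (.set 14 (.add (.reg 14) (.lit 1)))
              (.loop (.not (.eq (.reg 11) (.lit 0))) (dfsStep b et))))))
      .skip)

/-- Depth-first search from the vertices that satisfy `rt` along the half-edges that satisfy `et`.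
Arrays `b + 2, …, b + 5` receive the preorder numbers, the parents, the preorder and the roots. -/
def dfs (b : ℕ) (rt et : Test) : Prog :=
  .seq (buildLists b)
    (.seq (.set 14 (.lit 2))
      (.seq (.put (b + 2) (.lit 0) (.lit 1)) (.range 10 (.reg 0) (dfsRoot b rt et))))

theorem arrs_buildLists (b : ℕ) : (buildLists b).arrs = [b, b + 1] := rfl

theorem regs_buildLists (b : ℕ) : (buildLists b).regs = [10, 10] := rfl

theorem arrs_dfsStep (b : ℕ) (et : Test) :
    (dfsStep b et).arrs = [b + 6, b + 1, b + 2, b + 3, b + 4, b + 5] := rfl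

theorem regs_dfsStep (b : ℕ) (et : Test) :
    (dfsStep b et).regs = [12, 11, 12, 13, 14, 11] := rfl

theorem arrs_dfsRoot (b : ℕ) (rt et : Test) :
    (dfsRoot b rt et).arrs =
      [b + 2, b + 4, b + 5, b + 6, b + 1, b + 2, b + 3, b + 4, b + 5] := rfl

theorem regs_dfsRoot (b : ℕ) (rt et : Test) :
    (dfsRoot b rt et).regs = [11, 14, 12, 11, 12, 13, 14, 11] := rfl

theorem arrs_dfs (b : ℕ) (rt et : Test) :
    (dfs b rt et).arrs = [b, b + 1, b + 2, b + 2, b + 4, b + 5, b + 6, b + 1, b + 2, b + 3, b + 4,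
      b + 5] := rfl

theorem regs_dfs (b : ℕ) (rt et : Test) :
    (dfs b rt et).regs = [10, 10, 14, 10, 11, 14, 12, 11, 12, 13, 14, 11, 10] := rfl

section

variable {B b n M : ℕ} {S D : ℕ → ℕ} {P R : ℕ → Prop} {rt et : Test} {σ : State}

/-- Half-edges are prepended in increasing order, so the old head becomes the link and is the
largest earlier half-edge with that source. Pointers are shifted by one to free 0 as the end of a
list. -/
theorem runs_buildLists (hb : 20 ≤ b) (hM : M + 1 ≤ B) (hn : n ≤ B)
    (hM7 : σ.reg 7 = M) (hS : σ.arr 6 = S)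
    (src : ∀ h < M, 1 ≤ S h ∧ S h ≤ n) (dst : ∀ h < M, 1 ≤ D h ∧ D h ≤ n)
    (h0 : ∀ i, σ.arr (b + 1) i = 0) :
    Runs B (buildLists b) σ fun σ' k => AdjList n M S D (σ'.arr b) ∧
      (∀ v, σ'.arr (b + 1) v ≤ M) ∧
      (∀ v, σ'.arr (b + 1) v ≠ 0 → S (σ'.arr (b + 1) v - 1) = v) ∧
      (∀ h < M, h + 1 ≤ σ'.arr (b + 1) (S h)) ∧ k ≤ 4 * M + 2 := by
  refine (Runs.range_const (N := M) (K := 2)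
    (fun i σ' => (∀ v, σ'.arr (b + 1) v ≤ i) ∧
      (∀ v, σ'.arr (b + 1) v ≠ 0 → S (σ'.arr (b + 1) v - 1) = v) ∧
      (∀ h < i, h + 1 ≤ σ'.arr (b + 1) (S h)) ∧
      (∀ h < i, σ'.arr b h ≤ h) ∧
      (∀ h < i, σ'.arr b h ≠ 0 → S (σ'.arr b h - 1) = S h) ∧
      (∀ h < i, ∀ h' < h, S h' = S h → h' + 1 ≤ σ'.arr b h)) (by omega) (by simp [Prog.regs])
      ?_ ?_ ?_ ?_).mono ?_
  · intro σ' hA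
    have := hA.2 7 (by simp [Prog.regs_range, Prog.regs])
    simp [Expr.eval, this, hM7]
  · simp [h0]
  · intro i σ' k h
    exact h
  · rintro i hi σ₁ hA hr ⟨h1, h2, h3, h4, h5, h6⟩
    have hS1 : σ₁.arr 6 = S := by
      rw [hA.1 6 (by simp [Prog.arrs_range, Prog.arrs]; omega), hS]
    have hsrc := src i hi
    have := h1 (S i)
    simp only [runs_seq, runs_put, Expr.eval, hr, hS1, State.put_reg, State.put_arr_same,
      State.put_arr_ne _ _ _ (show 6 ≠ b by omega), State.put_arr_ne _ _ _ (show b + 1 ≠ b by omega),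
      State.put_arr_ne _ _ _ (show b ≠ b + 1 by omega)]
    refine ⟨by omega, by omega, by omega, by omega, ⟨?_, ?_, ?_, ?_, ?_, ?_⟩, le_rfl⟩
    · intro v
      rw [Function.update_apply]
      split_ifs
      · exact le_rfl
      · have := h1 v
        omega
    · intro v
      rw [Function.update_apply]
      split_ifs with hv
      · intro _
        rw [hv]
        rfl
      · exact h2 v
    · intro h hh
      rw [Function.update_apply]
      split_ifs with hv
      · omega
      · rcases Nat.lt_succ_iff_lt_or_eq.1 hh with h' | h'
        · exact h3 h h'
        · exact absurd (by rw [h']) hv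
    · intro h hh
      rw [Function.update_apply]
      split_ifs with hv
      · omega
      · exact h4 h (by omega)
    · intro h hh
      rw [Function.update_apply]
      split_ifs with hv
      · rw [hv]
        exact h2 (S i)
      · exact h5 h (by omega)
    · intro h hh h' hh' hSS
      rw [Function.update_apply]
      split_ifs with hv
      · rw [← hv, ← hSS]
        exact h3 h' (by omega)
      · exact h6 h (by omega) h' hh' hSS
  · rintro σ' k hA ⟨⟨h1, h2, h3, h4, h5, h6⟩, hk⟩
    exact ⟨⟨src, dst, h4, h5, h6⟩, h1, h2, h3, by omega⟩

/-- The memory of depth-first search satisfies the invariant. -/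
def DfsState (n M : ℕ) (S D : ℕ → ℕ) (P R : ℕ → Prop) (b : ℕ) (σ : State) (U : ℕ) : Prop :=
  DfsInv n M S D P R (σ.arr (b + 2)) (σ.arr (b + 3)) (σ.arr (b + 4)) (σ.arr (b + 5))
    (σ.arr (b + 1)) (σ.arr (b + 6)) (σ.reg 14) U

/-- The potential that pays for the steps of depth-first search. -/
def dfsPot (n M : ℕ) (S : ℕ → ℕ) (b : ℕ) (σ : State) : ℕ :=
  14 * scanPot M S (σ.arr (b + 1)) + 6 * openPot n (σ.arr (b + 6))

/-- Including the loop test, backtracking takes at most 6 steps and closes a vertex, scanning takes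
at most 14 and consumes a half-edge; these are the weights in `dfsPot`. The test `et` may depend on
everything the search leaves alone and on registers 11, 12, 13, which hold the source, the half-edge
and its target. -/
theorem runs_dfsStep (hb : 20 ≤ b) (hM : M + 1 ≤ B) (hn : n + 2 ≤ B) (hD : σ.arr 7 = D)
    (A : AdjList n M S D (σ.arr b)) (I : DfsState n M S D P R b σ (σ.reg 11)) (hU : σ.reg 11 ≠ 0)
    (het : ∀ σ' : State, (∀ a < b, σ'.arr a = σ.arr a) → (∀ x < 10, σ'.reg x = σ.reg x) →
      σ'.reg 12 < M → σ'.reg 11 = S (σ'.reg 12) → σ'.reg 13 = D (σ'.reg 12) →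
      (et.Holds σ' ↔ P (σ'.reg 12))) :
    Runs B (dfsStep b et) σ fun σ' k => DfsState n M S D P R b σ' (σ'.reg 11) ∧
      (∀ v, 2 ≤ σ.arr (b + 2) v → 2 ≤ σ'.arr (b + 2) v) ∧ k + 1 + dfsPot n M S b σ' ≤ dfsPot n M S b σ := by
  unfold DfsState at I
  have hU2 := I.current hU
  have hUn := I.pre_lt _ hU (by omega)
  have hcnt := count_le I.pre_lt I.ord_pre
  have hptr := I.ptr_le (σ.reg 11)
  rw [dfsStep, runs_seq, runs_set]
  refine ⟨by simp only [Expr.eval]; omega, ?_⟩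
  rw [runs_ite]
  constructor
  · intro hz
    simp only [Test.Holds, Expr.eval, State.set_reg, if_true] at hz
    have hpar : σ.arr (b + 3) (σ.reg 11) ≤ n := by
      rcases I.tree _ hU2 with h | h
      · omega
      · by_cases h0 : σ.arr (b + 3) (σ.reg 11) = 0
        · omega
        · exact (I.pre_lt _ h0 (by omega)).2.2.1
    have hdn := (I.gray _ hU2).2 ⟨hU, .refl⟩
    have hpot := openPot_update (by omega) hUn.2.2.1 hdn one_ne_zero
    simp only [runs_seq, runs_set, runs_put, Expr.eval, State.set_reg, State.set_arr,
      State.put_reg, State.put_arr_ne _ _ _ (show b + 3 ≠ b + 6 by omega),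
      if_true, if_false, Nat.reduceEqDiff]
    refine ⟨by omega, by omega, by omega, ?_, ?_, ?_⟩
    · have := I.pop hU hz
      simpa [DfsState, State.put_arr_same, State.put_arr_ne] using this
    · simp [State.put_arr_ne]
    · simp only [dfsPot, State.set_arr, State.put_arr_same,
        State.put_arr_ne _ _ _ (show b + 1 ≠ b + 6 by omega)]
      omega
  · intro hz
    simp only [Test.Holds, Expr.eval, State.set_reg, if_true] at hz
    have hlt : σ.arr (b + 1) (σ.reg 11) - 1 < M := by omega
    have hsrc := I.ptr_src _ hz
    have hle := A.le _ hlt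
    have hdst := A.dst _ hlt
    have hpot := scanPot_update (ptr := σ.arr (b + 1)) A hlt (by rw [hsrc]; omega)
    rw [hsrc] at hpot
    rw [runs_seq, runs_set]
    refine ⟨by simp only [Expr.eval, State.set_reg, if_true]; omega, ?_⟩
    rw [runs_seq, runs_put]
    simp only [Expr.eval, State.set_reg, State.set_arr, if_true, Nat.reduceEqDiff, if_false]
    refine ⟨by omega, by omega, ?_⟩
    rw [runs_seq, runs_set]
    simp only [Expr.eval, State.set_reg, State.set_arr, State.put_reg, if_true,
      State.put_arr_ne _ _ _ (show 7 ≠ b + 1 by omega), hD]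
    refine ⟨by omega, ?_⟩
    have het' := het ((((σ.set 12 (σ.arr (b + 1) (σ.reg 11))).set 12
      (σ.arr (b + 1) (σ.reg 11) - 1)).put (b + 1) (σ.reg 11)
      (σ.arr b (σ.arr (b + 1) (σ.reg 11) - 1))).set 13 (D (σ.arr (b + 1) (σ.reg 11) - 1)))
      (fun a ha => by
        simp [State.put_arr_ne _ _ _ (show a ≠ b + 1 by omega)])
      (fun x hx => by
        simp [show x ≠ 12 by omega, show x ≠ 13 by omega])
      (by simpa using hlt) (by simpa using hsrc.symm) (by simp)
    simp only [State.set_reg, State.put_reg, if_true, Nat.reduceEqDiff, if_false] at het'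
    rw [runs_ite]
    simp only [Test.Holds, het', Expr.eval, State.set_reg, State.set_arr, State.put_reg, if_true,
      State.put_arr_ne _ _ _ (show b + 2 ≠ b + 1 by omega)]
    constructor
    · rintro ⟨hP, hpre⟩
      have hroot : σ.arr (b + 5) (σ.reg 11) ≤ n := by
        -- The root label is about to be copied and must fit into a word. Labels are inherited from
        -- parents, and induction on the preorder number leads to a root labelled by itself.
        have : ∀ N v, σ.arr (b + 2) v ≤ N → 2 ≤ σ.arr (b + 2) v → σ.arr (b + 5) v ≤ n := by
          intro N
          induction N with
          | zero => omega
          | succ N ih =>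
            intro v hv hv2
            rcases I.tree _ hv2 with h | h
            · rw [h.2.1]
              by_cases h0 : v = 0
              · omega
              · exact (I.pre_lt _ h0 (by omega)).2.2.1
            · rw [h.2.2.2]
              exact ih _ (by omega) h.1
        exact this _ _ le_rfl hU2
      have hcnt' := count_lt I.pre_lt I.ord_pre hdst.1 hdst.2 hpre
      simp only [runs_seq, runs_set, runs_put, Expr.eval, State.set_reg, State.set_arr,
        State.put_reg, if_true, if_false, Nat.reduceEqDiff,
        State.put_arr_ne _ _ _ (show b + 5 ≠ b + 4 by omega),
        State.put_arr_ne _ _ _ (show b + 5 ≠ b + 3 by omega),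
        State.put_arr_ne _ _ _ (show b + 5 ≠ b + 2 by omega),
        State.put_arr_ne _ _ _ (show b + 5 ≠ b + 1 by omega)]
      refine ⟨by omega, by omega, by omega, by omega, by omega, by omega, by omega, by omega,
        by omega, by omega, ?_, ?_, ?_⟩
      · have h1 := I.visit hdst.1 hdst.2 hpre
          (.inr ⟨hU, ⟨_, hlt, hsrc, rfl, hP⟩, rfl⟩)
        have h2 := h1.advance (nxt := σ.arr b) A hz
          (fun _ => by rw [Function.update_self]; exact I.two_le)
        simpa [DfsState, State.put_arr_same, State.put_arr_ne] using h2
      · intro v hv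
        simp only [State.set_arr, State.put_arr_same, ne_eq, Nat.add_left_cancel_iff,
          Nat.reduceEqDiff, not_false_eq_true, State.put_arr_ne]
        rw [Function.update_apply]
        split_ifs
        · exact I.two_le
        · exact hv
      · simp only [dfsPot, State.set_arr, State.put_arr_same,
          State.put_arr_ne _ _ _ (show b + 1 ≠ b + 5 by omega),
          State.put_arr_ne _ _ _ (show b + 1 ≠ b + 4 by omega),
          State.put_arr_ne _ _ _ (show b + 1 ≠ b + 3 by omega),
          State.put_arr_ne _ _ _ (show b + 1 ≠ b + 2 by omega),
          State.put_arr_ne _ _ _ (show b + 6 ≠ b + 5 by omega),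
          State.put_arr_ne _ _ _ (show b + 6 ≠ b + 4 by omega),
          State.put_arr_ne _ _ _ (show b + 6 ≠ b + 3 by omega),
          State.put_arr_ne _ _ _ (show b + 6 ≠ b + 2 by omega),
          State.put_arr_ne _ _ _ (show b + 6 ≠ b + 1 by omega)]
        omega
    · intro hnot
      rw [runs_skip]
      refine ⟨?_, ?_, ?_⟩
      · have h1 := I.advance A hz (fun hP => by
          by_contra h2
          refine hnot ⟨hP, ?_⟩
          by_contra h0
          exact h2 (I.pre_lt _ (by omega) h0).1)
        simpa [DfsState, State.put_arr_same, State.put_arr_ne] using h1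
      · simp [State.put_arr_ne]
      · simp only [dfsPot, State.set_arr, State.put_arr_same,
          State.put_arr_ne _ _ _ (show b + 6 ≠ b + 1 by omega)]
        omega

theorem runs_dfsRoot (hb : 20 ≤ b) (hM : M + 1 ≤ B) (hn : n + 2 ≤ B) (hD : σ.arr 7 = D)
    (A : AdjList n M S D (σ.arr b)) (I : DfsState n M S D P R b σ 0) (hi : σ.reg 10 < n)
    (hrt : ∀ σ' : State, (∀ a < b, σ'.arr a = σ.arr a) → (∀ x < 10, σ'.reg x = σ.reg x) →
      (rt.Holds σ' ↔ R (σ'.reg 11)))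
    (het : ∀ σ' : State, (∀ a < b, σ'.arr a = σ.arr a) → (∀ x < 10, σ'.reg x = σ.reg x) →
      σ'.reg 12 < M → σ'.reg 11 = S (σ'.reg 12) → σ'.reg 13 = D (σ'.reg 12) →
      (et.Holds σ' ↔ P (σ'.reg 12))) :
    Runs B (dfsRoot b rt et) σ fun σ' k => AdjList n M S D (σ'.arr b) ∧
      DfsState n M S D P R b σ' 0 ∧
      (∀ v, 2 ≤ σ.arr (b + 2) v → 2 ≤ σ'.arr (b + 2) v) ∧
      (R (σ.reg 10 + 1) → 2 ≤ σ'.arr (b + 2) (σ.reg 10 + 1)) ∧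
      k + dfsPot n M S b σ' ≤ 8 + dfsPot n M S b σ := by
  have I' := I
  unfold DfsState at I
  have hcnt := count_le I.pre_lt I.ord_pre
  rw [dfsRoot, runs_seq, runs_set]
  simp only [Expr.eval]
  refine ⟨by omega, ?_⟩
  have hrt' := hrt (σ.set 11 (σ.reg 10 + 1)) (fun a _ => by simp)
    (fun x hx => by simp [show x ≠ 11 by omega])
  simp only [State.set_reg, if_true] at hrt'
  rw [runs_ite]
  simp only [Test.Holds, hrt', Expr.eval, State.set_reg, State.set_arr, if_true]
  constructor
  · rintro ⟨hR, hp⟩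
    have hcnt' := count_lt I.pre_lt I.ord_pre (by omega) (show σ.reg 10 + 1 ≤ n by omega) hp
    simp only [runs_seq, runs_set, runs_put, Expr.eval, State.set_reg,
      State.put_reg, if_true, if_false, Nat.reduceEqDiff]
    refine ⟨by omega, by omega, by omega, by omega, by omega, by omega, by omega, ?_⟩
    -- The program does not write the parent of a root: the cell of an unvisited vertex still holds
    -- 0.
    have hpar0 : Function.update (σ.arr (b + 3)) (σ.reg 10 + 1) 0 = σ.arr (b + 3) := by
      rw [Function.update_eq_self_iff]
      exact ((I.unvisited _ hp).1).symm
    have h1 := I.visit (x := σ.reg 10 + 1) (by omega) (by omega) hp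
          (.inl ⟨rfl, hR, rfl⟩)
    rw [hpar0] at h1
    refine (Runs.loop (fun σ' => DfsState n M S D P R b σ' (σ'.reg 11) ∧
      ∀ v, 2 ≤ Function.update (σ.arr (b + 2)) (σ.reg 10 + 1) (σ.reg 14) v →
        2 ≤ σ'.arr (b + 2) v) (dfsPot n M S b) ?_ ?_).mono ?_
    · constructor
      · simpa [DfsState, State.put_arr_same, State.put_arr_ne] using h1
      · simp [State.put_arr_same, State.put_arr_ne]
    · rintro σ₁ hA ⟨hI₁, hm₁⟩ hb₁
      have hU₁ : σ₁.reg 11 ≠ 0 := by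
        simpa [Test.Holds, Expr.eval] using hb₁
      have harr : ∀ a < b, σ₁.arr a = σ.arr a := by
        intro a ha
        rw [hA.1 a (by simp [arrs_dfsStep]; omega)]
        simp [State.put_arr_ne _ _ _ (show a ≠ b + 5 by omega),
          State.put_arr_ne _ _ _ (show a ≠ b + 4 by omega),
          State.put_arr_ne _ _ _ (show a ≠ b + 2 by omega)]
      have hreg : ∀ x < 10, σ₁.reg x = σ.reg x := by
        intro x hx
        rw [hA.2 x (by simp [regs_dfsStep]; omega)]
        simp [show x ≠ 11 by omega, show x ≠ 14 by omega]
      have hA₁ : σ₁.arr b = σ.arr b := by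
        rw [hA.1 b (by simp [arrs_dfsStep])]
        simp [State.put_arr_ne]
      refine (runs_dfsStep (D := D) hb hM hn (by rw [harr 7 (by omega), hD]) (by rwa [hA₁]) hI₁ hU₁
        fun σ' h1 h2 => het σ' (fun a ha => (h1 a ha).trans (harr a ha))
          fun x hx => (h2 x hx).trans (hreg x hx)).mono ?_
      rintro σ₂ k hA₂ ⟨hI₂, hv₂, hk⟩
      exact ⟨⟨hI₂, fun v hv => hv₂ v (hm₁ v hv)⟩, hk⟩
    · rintro σ' k hA ⟨⟨hI, hm⟩, hb, hk⟩
      have hz : σ'.reg 11 = 0 := by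
        simpa [Test.Holds, Expr.eval] using hb
      rw [hz] at hI
      have hmono : ∀ v, 2 ≤ σ.arr (b + 2) v → 2 ≤ σ'.arr (b + 2) v := by
        intro v hv
        apply hm
        rw [Function.update_of_ne]
        · exact hv
        · rintro rfl
          omega
      refine ⟨?_, hI, hmono, fun _ => hm _ ?_, ?_⟩
      · rw [hA.1 b (by simp [arrs_dfsStep, Prog.arrs])]
        simpa [State.put_arr_ne] using A
      · rw [Function.update_self]
        exact I.two_le
      · have : dfsPot n M S b ((((((σ.set 11 (σ.reg 10 + 1)).put (b + 2) (σ.reg 10 + 1)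
            (σ.reg 14)).put (b + 4) (σ.reg 14) (σ.reg 10 + 1)).put (b + 5) (σ.reg 10 + 1)
            (σ.reg 10 + 1)).set 14 (σ.reg 14 + 1))) = dfsPot n M S b σ := by
          simp [dfsPot, State.put_arr_ne]
        rw [this] at hk
        omega
  · intro hnot
    rw [runs_skip]
    refine ⟨A, ?_, fun _ h => h, fun hR => ?_, ?_⟩
    · simpa [DfsState] using I'
    · by_contra h2
      refine hnot ⟨hR, ?_⟩
      by_contra h0
      exact h2 (I.pre_lt _ (by omega) h0).1
    · simp only [dfsPot, State.set_arr]
      omega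

theorem runs_dfs (hb : 20 ≤ b) (hM : M + 1 ≤ B) (hn : n + 2 ≤ B) (hn0 : σ.reg 0 = n)
    (hM7 : σ.reg 7 = M) (hS : σ.arr 6 = S) (hD : σ.arr 7 = D)
    (src : ∀ h < M, 1 ≤ S h ∧ S h ≤ n) (dst : ∀ h < M, 1 ≤ D h ∧ D h ≤ n)
    (h0 : ∀ j < 7, ∀ i, σ.arr (b + j) i = 0)
    (hrt : ∀ σ' : State, (∀ a < b, σ'.arr a = σ.arr a) → (∀ x < 10, σ'.reg x = σ.reg x) →
      (rt.Holds σ' ↔ R (σ'.reg 11)))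
    (het : ∀ σ' : State, (∀ a < b, σ'.arr a = σ.arr a) → (∀ x < 10, σ'.reg x = σ.reg x) →
      σ'.reg 12 < M → σ'.reg 11 = S (σ'.reg 12) → σ'.reg 13 = D (σ'.reg 12) →
      (et.Holds σ' ↔ P (σ'.reg 12))) :
    Runs B (dfs b rt et) σ fun σ' k => DfsOut n M S D P R (σ'.arr (b + 2)) (σ'.arr (b + 3))
      (σ'.arr (b + 4)) (σ'.arr (b + 5)) (σ'.reg 14) ∧ k ≤ 18 * (M + n) + 6 := by
  rw [dfs, runs_seq]
  refine (runs_buildLists hb hM (by omega) hM7 hS src dst (h0 1 (by omega))).mono ?_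
  rintro σ₁ k₁ hA₁ ⟨A, hptr, hsrc, hscan, hk₁⟩
  have hz : ∀ j < 7, 2 ≤ j → ∀ i, σ₁.arr (b + j) i = 0 := by
    intro j hj hj2 i
    rw [hA₁.1 _ (by simp [arrs_buildLists]; omega), h0 j hj]
  simp only [runs_seq, runs_set, runs_put, Expr.eval]
  refine ⟨by omega, by omega, by omega, ?_⟩
  have harr : ∀ a < b, σ₁.arr a = σ.arr a := fun a ha =>
    hA₁.1 a (by simp [arrs_buildLists]; omega)
  have hreg : ∀ x < 10, σ₁.reg x = σ.reg x := fun x hx =>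
    hA₁.2 x (by simp [regs_buildLists]; omega)
  refine (Runs.range (N := n) (K := 8)
    (fun i σ' => AdjList n M S D (σ'.arr b) ∧ DfsState n M S D P R b σ' 0 ∧
      ∀ v, 1 ≤ v → v ≤ i → R v → 2 ≤ σ'.arr (b + 2) v) (dfsPot n M S b) (by omega)
      (by simp [regs_dfsRoot]) ?_ ⟨?_, ?_, ?_⟩ ?_ ?_ ?_).mono ?_
  · intro σ' hA
    have := hA.2 0 (by simp [Prog.regs_range, regs_dfsRoot])
    simp [Expr.eval, this, hreg, hn0]
  · simpa [State.put_arr_ne] using A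
  · have hupd : ∀ v, v ≠ 0 → Function.update (σ₁.arr (b + 2)) 0 1 v = 0 := by
      intro v hv
      rw [Function.update_of_ne hv, hz 2 (by omega) le_rfl]
    have hvis : ∀ v, ¬ 2 ≤ Function.update (σ₁.arr (b + 2)) 0 1 v := by
      intro v hv
      by_cases h : v = 0
      · subst h
        rw [Function.update_self] at hv
        omega
      · rw [hupd v h] at hv
        omega
    simp only [DfsState, State.set_arr, State.put_arr_same, ne_eq, Nat.add_left_cancel_iff,
      Nat.reduceEqDiff, not_false_eq_true, State.put_arr_ne, State.set_reg, State.put_reg,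
      if_false, if_true]
    exact
      { pre_zero := Function.update_self ..
        par_zero := hz 3 (by omega) (by omega) 0
        pre_lt := fun v hv h => absurd (hupd v hv) h
        ord_pre := fun i h1 h2 => by omega
        two_le := le_rfl
        tree := fun v hv => absurd hv (hvis v)
        unvisited := fun v _ => ⟨hz 3 (by omega) (by omega) v, hz 6 (by omega) (by omega) v⟩
        ptr_le := hptr
        ptr_src := hsrc
        scan := fun h hM h1 => by
          have := hscan h hM
          omega
        finished := fun v hv => absurd (hz 6 (by omega) (by omega) v) hv
        gray := fun v hv => absurd hv (hvis v)
        current := fun h => absurd rfl h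
        cross := fun h _ _ hv => absurd hv (hvis _) }
  · intro v hv hv'
    omega
  · simp [dfsPot]
  · rintro i σ' k ⟨h1, h2, h3⟩
    exact ⟨⟨h1, by simpa [DfsState] using h2, h3⟩, by simp [dfsPot]⟩
  · rintro i hi σ₂ hA₂ hr ⟨hA, hI, hroot⟩
    have harr₂ : ∀ a < b, σ₂.arr a = σ.arr a := by
      intro a ha
      rw [hA₂.1 a (by simp [Prog.arrs_range, arrs_dfsRoot]; omega)]
      rw [State.put_arr_ne _ _ _ (by omega)]
      exact harr a ha
    have hreg₂ : ∀ x < 10, σ₂.reg x = σ.reg x := by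
      intro x hx
      rw [hA₂.2 x (by simp [Prog.regs_range, regs_dfsRoot]; omega)]
      simp [show x ≠ 14 by omega, hreg x hx]
    refine (runs_dfsRoot (D := D) (R := R) hb hM hn (by rw [harr₂ 7 (by omega), hD]) hA hI
      (by omega)
      (fun σ' h1 h2 => hrt σ' (fun a ha => (h1 a ha).trans (harr₂ a ha))
        fun x hx => (h2 x hx).trans (hreg₂ x hx))
      fun σ' h1 h2 => het σ' (fun a ha => (h1 a ha).trans (harr₂ a ha))
        fun x hx => (h2 x hx).trans (hreg₂ x hx)).mono ?_
    rintro σ₃ k hA₃ ⟨hA', hI', hmono, hroot', hk⟩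
    rw [hr] at hroot'
    refine ⟨⟨hA', hI', fun v hv hv' hR => ?_⟩, hk⟩
    rcases Nat.lt_succ_iff_lt_or_eq.1 (Nat.lt_succ_of_le hv') with h | h
    · exact hmono v (hroot v hv (by omega) hR)
    · rw [h] at hR ⊢
      exact hroot' hR
  · rintro σ₂ k hA₂ ⟨⟨_, hI, hroot⟩, hk⟩
    refine ⟨hI.out hroot, ?_⟩
    have h1 := scanPot_le M S (σ₁.arr (b + 1))
    have h2 := openPot_le n (σ₁.arr (b + 6))
    simp only [dfsPot, State.set_arr, ne_eq, Nat.add_left_cancel_iff, Nat.reduceEqDiff,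
      not_false_eq_true, State.put_arr_ne] at hk
    omega

end

end Detour


namespace Detour

/-! ### Lowpoints and the layout of the depth-first forest

Vertices are represented by their preorder numbers `2 ≤ i < cnt`, and `pp i < i` is the number of
the parent of `i`. The numbers `0` and `1` stand for two virtual vertices: `0` is adjacent to the
vertices in `A`, and `1`, the parent of the roots, to those in `Z`. -/

/-- `low` is the array of lowpoints, as far as the vertices from `i` on have been treated. The
relation `E` is the adjacency of vertices. -/
structure LowInv (cnt top : ℕ) (E : ℕ → ℕ → Prop) (A Z : ℕ → Prop) (pp : ℕ → ℕ) (i : ℕ)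
    (low : ℕ → ℕ) : Prop where
  le_adj : ∀ c x, E c x → low c ≤ x
  zero : ∀ c, i ≤ c → c < cnt → A c → low c = 0
  one : ∀ c, i ≤ c → c < cnt → Z c → low c ≤ 1
  le_child : ∀ c, i ≤ c → c < cnt → low (pp c) ≤ low c
  attained : ∀ c, 2 ≤ c → c < cnt → low c = top ∨ E c (low c) ∨ (A c ∧ low c = 0) ∨
    (Z c ∧ low c = 1) ∨ ∃ c', i ≤ c' ∧ c' < cnt ∧ pp c' = c ∧ low c' = low c
  le_top : ∀ c < cnt, low c ≤ top

/-- Preorder is processed downwards and children have larger numbers, so `low i` already accounts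
for the subtree below i. Here x adds the virtual neighbours 0 and 1 and is then folded into the
parent. Only the cells i and `pp i` change: either the parent keeps its old witness or i becomes the
witness. -/
theorem LowInv.step {cnt top : ℕ} {E : ℕ → ℕ → Prop} {A Z : ℕ → Prop} {pp low : ℕ → ℕ} {i x y : ℕ}
    (I : LowInv cnt top E A Z pp (i + 1) low) (hi : 2 ≤ i) (hic : i < cnt) (hpp : pp i < i)
    (hx : x ≤ low i) (hA : A i → x = 0) (hZ : Z i → x ≤ 1)
    (hx' : x = low i ∨ (A i ∧ x = 0) ∨ (Z i ∧ x = 1)) (hy : y = min (low (pp i)) x) :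
    LowInv cnt top E A Z pp i (Function.update (Function.update low i x) (pp i) y) := by
  set low' := Function.update (Function.update low i x) (pp i) y with hlow'
  have h1 : low' i = x := by
    rw [hlow', Function.update_of_ne (by omega), Function.update_self]
  have h2 : low' (pp i) = y := by
    rw [hlow', Function.update_self]
  have h3 : ∀ c, c ≠ i → c ≠ pp i → low' c = low c := by
    intro c hc hc'
    rw [hlow', Function.update_of_ne hc', Function.update_of_ne hc]
  have hle : ∀ c, low' c ≤ low c := by
    intro c
    by_cases hc : c = i
    · rw [hc, h1]
      exact hx
    · by_cases hc' : c = pp i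
      · rw [hc', h2, hy]
        exact min_le_left _ _
      · rw [h3 c hc hc']
  have hge : ∀ c, i + 1 ≤ c → low' c = low c := fun c hc => h3 c (by omega) (by omega)
  refine ⟨fun c z h => (hle c).trans (I.le_adj c z h), ?_, ?_, ?_, ?_,
    fun c hc => (hle c).trans (I.le_top c hc)⟩
  · intro c hc hcc h
    by_cases hci : c = i
    · subst hci
      rw [h1]
      exact hA h
    · exact Nat.le_zero.1 ((hle c).trans (I.zero c (by omega) hcc h).le)
  · intro c hc hcc h
    by_cases hci : c = i
    · subst hci
      rw [h1]
      exact hZ h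
    · exact (hle c).trans (I.one c (by omega) hcc h)
  · intro c hc hcc
    by_cases hci : c = i
    · subst hci
      rw [h1, h2, hy]
      exact min_le_right _ _
    · rw [hge c (by omega)]
      exact (hle _).trans (I.le_child c (by omega) hcc)
  · intro c hc hcc
    by_cases hci : c = i
    · subst hci
      rcases hx' with h | h | h
      · rcases I.attained c hc hcc with h' | h' | h' | h' | ⟨c', h4, h5, h6, h7⟩
        · exact .inl (by rw [h1, h, h'])
        · exact .inr (.inl (by rwa [h1, h]))
        · exact .inr (.inr (.inl (by rwa [h1, h])))
        · exact .inr (.inr (.inr (.inl (by rwa [h1, h]))))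
        · exact .inr (.inr (.inr (.inr ⟨c', by omega, h5, h6, by rw [hge c' h4, h7, h1, h]⟩)))
      · exact .inr (.inr (.inl (by rwa [h1])))
      · exact .inr (.inr (.inr (.inl (by rwa [h1]))))
    · by_cases hcp : c = pp i ∧ x ≤ low (pp i)
      · refine .inr (.inr (.inr (.inr ⟨i, le_rfl, hic, hcp.1.symm, ?_⟩)))
        rw [hcp.1, h1, h2, hy, min_eq_right hcp.2]
      · have hcc' : low' c = low c := by
          by_cases h : c = pp i
          · rw [h, h2, hy, min_eq_left]
            have : ¬ x ≤ low (pp i) := fun h' => hcp ⟨h, h'⟩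
            omega
          · exact h3 c hci h
        rw [hcc']
        rcases I.attained c hc hcc with h' | h' | h' | h' | ⟨c', h4, h5, h6, h7⟩
        · exact .inl h'
        · exact .inr (.inl h')
        · exact .inr (.inr (.inl h'))
        · exact .inr (.inr (.inr (.inl h')))
        · exact .inr (.inr (.inr (.inr ⟨c', by omega, h5, h6, by rw [hge c' h4, h7]⟩)))

/-- `sz j` is `1` plus the sizes of the children of `j` from `i` on. -/
structure SizeInv (cnt : ℕ) (pp : ℕ → ℕ) (i : ℕ) (sz : ℕ → ℕ) : Prop where
  eq : ∀ j < cnt, sz j = 1 + ∑ c ∈ (Finset.Ico i cnt).filter (fun c => pp c = j), sz c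
  total : ∑ j ∈ Finset.range i, sz j = cnt

theorem SizeInv.le {cnt : ℕ} {pp sz : ℕ → ℕ} {i : ℕ} (I : SizeInv cnt pp i sz) {j : ℕ}
    (hj : j < i) : sz j ≤ cnt := by
  rw [← I.total]
  exact Finset.single_le_sum (f := sz) (fun _ _ => Nat.zero_le _) (Finset.mem_range.2 hj)

theorem sum_children {cnt : ℕ} {pp : ℕ → ℕ} (f : ℕ → ℕ) {i : ℕ} (hic : i < cnt) (j : ℕ) :
    ∑ c ∈ (Finset.Ico i cnt).filter (fun c => pp c = j), f c =
      (if pp i = j then f i else 0) +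
        ∑ c ∈ (Finset.Ico (i + 1) cnt).filter (fun c => pp c = j), f c := by
  rw [Finset.sum_filter, Finset.sum_filter, Finset.sum_eq_sum_Ico_succ_bot hic]

/-- The size of i moves into its parent just as i leaves the range of summation. So the total is
conserved, and it bounds every stored size. -/
theorem SizeInv.step {cnt : ℕ} {pp sz : ℕ → ℕ} {i : ℕ} (I : SizeInv cnt pp (i + 1) sz)
    (hic : i < cnt) (hpp : pp i < i) :
    sz (pp i) + sz i ≤ cnt ∧
      SizeInv cnt pp i (Function.update sz (pp i) (sz (pp i) + sz i)) := by
  have hsum : ∑ j ∈ Finset.range i, Function.update sz (pp i) (sz (pp i) + sz i) j = cnt := by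
    rw [Finset.sum_update_of_mem (Finset.mem_range.2 hpp), ← I.total, Finset.sum_range_succ,
      ← Finset.add_sum_erase _ sz (Finset.mem_range.2 hpp), Finset.sdiff_singleton_eq_erase]
    omega
  refine ⟨?_, ?_, hsum⟩
  · rw [← hsum]
    have := Finset.single_le_sum (f := Function.update sz (pp i) (sz (pp i) + sz i))
      (fun _ _ => Nat.zero_le _) (Finset.mem_range.2 hpp)
    rwa [Function.update_self] at this
  · intro j hj
    have hge : ∀ c ∈ (Finset.Ico (i + 1) cnt).filter (fun c => pp c = j),
        Function.update sz (pp i) (sz (pp i) + sz i) c = sz c := by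
      intro c hc
      simp only [Finset.mem_filter, Finset.mem_Ico] at hc
      exact Function.update_of_ne (by omega) _ _
    have hge' : ∑ c ∈ (Finset.Ico (i + 1) cnt).filter (fun c => pp c = j),
        Function.update sz (pp i) (sz (pp i) + sz i) c =
        ∑ c ∈ (Finset.Ico (i + 1) cnt).filter (fun c => pp c = j), sz c :=
      Finset.sum_congr rfl hge
    rw [sum_children _ hic, hge', Function.update_of_ne (by omega : i ≠ pp i)]
    have := I.eq j hj
    by_cases h : j = pp i
    · subst h
      rw [Function.update_self, if_pos rfl]
      omega
    · rw [Function.update_of_ne h, if_neg (Ne.symm h)]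
      omega

/-- The interval of `a` lies to the left of the interval of `b`. -/
def Before (lo sz : ℕ → ℕ) (a b : ℕ) : Prop :=
  lo a + sz a ≤ lo b

/-- The layout of the forest as far as the vertices below `i` have been placed: vertex `j` holds
the interval from `lo j` to `lo j + sz j`, which has room for its remaining children. -/
structure PosInv (cnt : ℕ) (pp low T : ℕ → ℕ) (i : ℕ) (lo sz blk : ℕ → ℕ) : Prop where
  size : ∀ j < cnt, sz j = 1 + ∑ c ∈ (Finset.Ico i cnt).filter (fun c => pp c = j), T c
  disj : ∀ j < i, ∀ k < i, j ≠ k → Before lo sz j k ∨ Before lo sz k j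
  bound : ∀ j < i, lo j + sz j ≤ cnt + 1
  zero : lo 0 = 0
  one : ∀ j < i, j ≠ 1 → Before lo sz j 1
  between : ∀ v, 2 ≤ v → v < i → low v < pp v →
    (Before lo sz (low v) v ∧ Before lo sz v (pp v)) ∨
      (Before lo sz (pp v) v ∧ Before lo sz v (low v))
  blk_zero : ∀ v, v = 0 ∨ i ≤ v → blk v = 0
  blk_one : blk 1 = 1
  blk_iff : ∀ v, 2 ≤ v → v < i → (blk v = 1 ↔ blk (pp v) = 1 ∧ low v < pp v)

/-- The st-numbering step. Vertex i receives `T i` cells, enough for its whole subtree, cut from the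
end of its parent's interval that faces `low i`: the left end if `low i` lies to the left, the right
end otherwise. When `low i < pp i`, this puts i between the two. Later cuts only shrink intervals,
so relations `Before` persist. -/
theorem PosInv.step {cnt : ℕ} {pp low T : ℕ → ℕ} {i : ℕ} {lo sz blk lo' blk' : ℕ → ℕ}
    (I : PosInv cnt pp low T i lo sz blk) (hi : 2 ≤ i) (hic : i < cnt)
    (hpp' : ∀ c, 2 ≤ c → c < cnt → 1 ≤ pp c ∧ pp c < c)
    (hT : ∀ j, i ≤ j → j < cnt →
      T j = 1 + ∑ c ∈ (Finset.Ico i cnt).filter (fun c => pp c = j), T c)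
    (hroot : pp i = 1 → low i = 0)
    (hlo : (lo (low i) < lo (pp i) ∧
        lo' = Function.update (Function.update lo i (lo (pp i))) (pp i) (lo (pp i) + sz i)) ∨
      (¬ lo (low i) < lo (pp i) ∧ lo' = Function.update lo i (lo (pp i) + sz (pp i) - sz i)))
    (hblk : ((blk (pp i) = 1 ∧ low i < pp i) ∧ blk' = Function.update blk i 1) ∨
      (¬ (blk (pp i) = 1 ∧ low i < pp i) ∧ blk' = blk)) :
    PosInv cnt pp low T (i + 1) lo' (Function.update sz (pp i) (sz (pp i) - sz i)) blk' := by
  obtain ⟨hpp0, hpp⟩ := hpp' i hi hic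
  set p := pp i with hp
  set sz' := Function.update sz p (sz p - sz i) with hsz'
  have hszi : sz i = T i := by rw [I.size i hic, hT i le_rfl hic]
  have hTi : 1 ≤ T i := by rw [hT i le_rfl hic]; omega
  have hszp : sz p = 1 + T i +
      ∑ c ∈ (Finset.Ico (i + 1) cnt).filter (fun c => pp c = p), T c := by
    rw [I.size p (by omega), sum_children _ hic, if_pos hp.symm]
    omega
  have hsz1 : sz' p = sz p - T i := by rw [hsz', Function.update_self, hszi]
  have hsz2 : ∀ j, j ≠ p → sz' j = sz j := fun j hj => Function.update_of_ne hj _ _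
  have hpos : ∀ j < cnt, 1 ≤ sz j := fun j hj => by rw [I.size j hj]; omega
  have hlo1 : ∀ j, j ≠ i → j ≠ p → lo' j = lo j := by
    intro j hj hj'
    rcases hlo with ⟨_, h⟩ | ⟨_, h⟩
    · rw [h, Function.update_of_ne hj', Function.update_of_ne hj]
    · rw [h, Function.update_of_ne hj]
  have hchild : (lo (low i) < lo p ∧ lo' i = lo p ∧ lo' p = lo p + T i) ∨
      (¬ lo (low i) < lo p ∧ lo' i = lo p + sz p - T i ∧ lo' p = lo p) := by
    rcases hlo with ⟨h0, h⟩ | ⟨h0, h⟩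
    · left
      rw [h]
      refine ⟨h0, ?_, ?_⟩
      · rw [Function.update_of_ne (by omega), Function.update_self]
      · rw [Function.update_self, hszi]
    · right
      rw [h]
      refine ⟨h0, ?_, ?_⟩
      · rw [Function.update_self, hszi]
      · rw [Function.update_of_ne (by omega)]
  have hszi' : sz' i = T i := by rw [hsz2 i (by omega), hszi]
  -- the intervals of `i` and `p` are disjoint parts of the old interval of `p`
  have hbef : ∀ a, a < i → ∀ b, b < i → Before lo sz a b → Before lo' sz' a b := by
    intro a ha b hb h
    unfold Before at *
    have ha' : lo' a + sz' a ≤ lo a + sz a := by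
      by_cases hap : a = p
      · rw [hap, hsz1]
        omega
      · rw [hlo1 a (by omega) hap, hsz2 a hap]
    have hb' : lo b ≤ lo' b := by
      by_cases hbp : b = p
      · rw [hbp]
        omega
      · rw [hlo1 b (by omega) hbp]
    omega
  have hbefi : ∀ a, a < i → a ≠ p → Before lo sz a p → Before lo' sz' a i := by
    intro a ha hap h
    unfold Before at *
    rw [hlo1 a (by omega) hap, hsz2 a hap]
    omega
  have hbefi' : ∀ a, a < i → a ≠ p → Before lo sz p a → Before lo' sz' i a := by
    intro a ha hap h
    unfold Before at *
    rw [hlo1 a (by omega) hap, hszi']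
    omega
  have hpi : Before lo' sz' i p ∨ Before lo' sz' p i := by
    unfold Before
    rw [hszi', hsz1]
    omega
  refine
    { size := ?_
      disj := ?_
      bound := ?_
      zero := ?_
      one := ?_
      between := ?_
      blk_zero := ?_
      blk_one := ?_
      blk_iff := ?_ }
  · intro j hj
    have := I.size j hj
    rw [sum_children _ hic] at this
    by_cases h : j = p
    · subst h
      rw [hsz1]
      rw [if_pos rfl] at this
      omega
    · rw [if_neg (fun h' => h (by rw [← h']))] at this
      rw [hsz2 j h]
      omega
  · have main : ∀ j < i, Before lo' sz' j i ∨ Before lo' sz' i j := by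
      intro j hj
      by_cases hjp : j = p
      · rw [hjp]
        exact hpi.symm
      · rcases I.disj j hj p hpp hjp with h | h
        · exact .inl (hbefi j hj hjp h)
        · exact .inr (hbefi' j hj hjp h)
    intro j hj k hk hjk
    rcases Nat.lt_succ_iff_lt_or_eq.1 hj with hj' | hj'
    · rcases Nat.lt_succ_iff_lt_or_eq.1 hk with hk' | hk'
      · exact (I.disj j hj' k hk' hjk).imp (hbef j hj' k hk') (hbef k hk' j hj')
      · rw [hk']
        exact main j hj'
    · rcases Nat.lt_succ_iff_lt_or_eq.1 hk with hk' | hk'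
      · rw [hj']
        exact (main k hk').symm
      · omega
  · intro j hj
    have hbp := I.bound p hpp
    by_cases hji : j = i
    · rw [hji, hszi']
      omega
    · by_cases hjp : j = p
      · rw [hjp, hsz1]
        omega
      · rw [hlo1 j hji hjp, hsz2 j hjp]
        exact I.bound j (by omega)
  · rw [hlo1 0 (by omega) (by omega), I.zero]
  · intro j hj hj1
    by_cases hji : j = i
    · subst hji
      -- A child of the virtual vertex 1 has lowpoint 0, which lies to the left of 1. So it is cut
      -- from the left end, and 1 remains last.
      by_cases hp1 : p = 1
      · have h0 : low j = 0 := hroot hp1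
        have := I.one 0 (by omega) (by omega)
        have h00 := hpos 0 (by omega)
        unfold Before at *
        rw [hp1, h0] at hchild
        rw [hszi']
        omega
      · exact hbefi' 1 (by omega) (Ne.symm hp1) (I.one p hpp hp1)
    · exact hbef j (by omega) 1 (by omega) (I.one j (by omega) hj1)
  · intro v hv hvi hlow
    by_cases hvi' : v = i
    · subst hvi'
      rw [← hp] at hlow ⊢
      have hu := hpos (low v) (by omega)
      have hp' := hpos p (by omega)
      rcases I.disj (low v) (by omega) p hpp (by omega) with h | h
      · left
        refine ⟨hbefi _ (by omega) (by omega) h, ?_⟩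
        unfold Before at *
        rw [hszi']
        omega
      · right
        refine ⟨?_, hbefi' _ (by omega) (by omega) h⟩
        unfold Before at *
        rw [hsz1]
        omega
    · have hvlt : v < i := by omega
      have hpv : pp v < i := by
        have := hpp' v hv (by omega)
        omega
      exact (I.between v hv hvlt hlow).imp
        (fun h => ⟨hbef _ (by omega) _ hvlt h.1, hbef _ hvlt _ hpv h.2⟩)
        (fun h => ⟨hbef _ hpv _ hvlt h.1, hbef _ hvlt _ (by omega) h.2⟩)
  · intro v hv
    have : blk' v = blk v := by
      rcases hblk with ⟨_, h⟩ | ⟨_, h⟩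
      · rw [h, Function.update_of_ne (by omega)]
      · rw [h]
    rw [this]
    exact I.blk_zero v (by omega)
  · rcases hblk with ⟨_, h⟩ | ⟨_, h⟩
    · rw [h, Function.update_of_ne (by omega), I.blk_one]
    · rw [h, I.blk_one]
  · have hblk' : ∀ v, v ≠ i → blk' v = blk v := by
      intro v hv
      rcases hblk with ⟨_, h⟩ | ⟨_, h⟩
      · rw [h, Function.update_of_ne hv]
      · rw [h]
    intro v hv hvi
    have hpv := hpp' v hv (by omega)
    rw [hblk' (pp v) (by omega)]
    by_cases hvi' : v = i
    · subst hvi'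
      rw [← hp]
      rcases hblk with ⟨h0, h⟩ | ⟨h0, h⟩
      · rw [h, Function.update_self]
        exact ⟨fun _ => h0, fun _ => rfl⟩
      · rw [h, I.blk_zero v (.inr le_rfl)]
        exact ⟨fun h => absurd h (by omega), fun h => absurd h h0⟩
    · rw [hblk' v hvi']
      exact I.blk_iff v hv (by omega)

end Detour


namespace Detour

/-! ### The order of the vertices on the shortest paths -/

section

variable {n M cnt : ℕ} {S D : ℕ → ℕ} {P R A : ℕ → Prop} {pre par ord root low : ℕ → ℕ}

theorem Anc.trans {par : ℕ → ℕ} {a b c : ℕ} (h₁ : Anc par a b) (h₂ : Anc par b c) :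
    Anc par a c := by
  induction h₂ with
  | refl => exact h₁
  | step h _ ih => exact .step h ih

theorem Anc.comparable {par : ℕ → ℕ} {a b x : ℕ} (h₁ : Anc par a x) (h₂ : Anc par b x) :
    Anc par a b ∨ Anc par b a := by
  induction h₁ with
  | refl => exact .inr h₂
  | @step x hx h ih =>
    cases h₂ with
    | refl => exact .inl (.step hx h)
    | step _ h' => exact ih h'

namespace DfsOut

theorem ne_zero (O : DfsOut n M S D P R pre par ord root cnt) {v : ℕ} (hv : 2 ≤ pre v) : v ≠ 0 := by
  rintro rfl
  have := O.pre_zero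
  omega

theorem ord_eq (O : DfsOut n M S D P R pre par ord root cnt) {v : ℕ} (hv : 2 ≤ pre v) :
    ord (pre v) = v :=
  (O.pre_lt v (O.ne_zero hv) (by omega)).2.2.2

theorem lt_cnt (O : DfsOut n M S D P R pre par ord root cnt) {v : ℕ} (hv : 2 ≤ pre v) :
    pre v < cnt :=
  (O.pre_lt v (O.ne_zero hv) (by omega)).2.1

theorem pre_inj (O : DfsOut n M S D P R pre par ord root cnt) {u v : ℕ} (hu : 2 ≤ pre u)
    (h : pre u = pre v) : u = v := by
  rw [← O.ord_eq hu, h, O.ord_eq (h ▸ hu)]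

theorem par_lt (O : DfsOut n M S D P R pre par ord root cnt) {v : ℕ} (hv : 2 ≤ pre v) :
    1 ≤ pre (par v) ∧ pre (par v) < pre v := by
  have := O.pre_zero
  rcases O.tree v hv with h | h
  · rw [h.1]
    omega
  · omega

theorem pp_lt (O : DfsOut n M S D P R pre par ord root cnt) {i : ℕ} (hi : 2 ≤ i) (hic : i < cnt) :
    1 ≤ pre (par (ord i)) ∧ pre (par (ord i)) < i := by
  have := O.ord_pre i hi hic
  have := O.par_lt (v := ord i) (by omega)
  omega

theorem anc_le (O : DfsOut n M S D P R pre par ord root cnt) {a x : ℕ} (h : Anc par a x)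
    (ha : a ≠ 0) (hx : 2 ≤ pre x) : 2 ≤ pre a ∧ pre a ≤ pre x := by
  induction h with
  | refl => exact ⟨hx, le_rfl⟩
  | @step x hx0 h' ih =>
    rcases O.tree x hx with h1 | h1
    · rw [h1.1] at h'
      cases h' with
      | refl => exact absurd rfl ha
      | step h0 => exact absurd rfl h0
    · exact ⟨(ih h1.1).1, (ih h1.1).2.trans h1.2.1.le⟩

theorem anc_root (O : DfsOut n M S D P R pre par ord root cnt) {a x : ℕ} (h : Anc par a x)
    (ha : a ≠ 0) (hx : 2 ≤ pre x) : root a = root x := by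
  induction h with
  | refl => rfl
  | @step x hx0 h' ih =>
    rcases O.tree x hx with h1 | h1
    · rw [h1.1] at h'
      cases h' with
      | refl => exact absurd rfl ha
      | step h0 => exact absurd rfl h0
    · rw [ih h1.1, h1.2.2.2]

end DfsOut

/-- The adjacency of preorder numbers. -/
def IdxAdj (M : ℕ) (S D : ℕ → ℕ) (P : ℕ → Prop) (pre : ℕ → ℕ) (c x : ℕ) : Prop :=
  2 ≤ c ∧ ∃ h < M, P h ∧ pre (S h) = c ∧ pre (D h) = x

variable (O : DfsOut n M S D P R pre par ord root cnt)
  (hsym : ∀ h < M, P h → 2 ≤ pre (S h) → ∃ h' < M, P h' ∧ S h' = D h ∧ D h' = S h)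
  (L : LowInv cnt (n + 2) (IdxAdj M S D P pre) (fun i => A (ord i)) (fun i => R (ord i))
    (fun i => pre (par (ord i))) 2 low)

include O

include hsym in
-- Depth-first search of an undirected graph has no cross edges: `cross` applies to the half-edge or
-- to its reverse, whichever starts at the smaller number.
theorem cross_symm {h : ℕ} (hM : h < M) (hP : P h) (hS : 2 ≤ pre (S h)) :
    Anc par (S h) (D h) ∨ Anc par (D h) (S h) := by
  rcases lt_trichotomy (pre (S h)) (pre (D h)) with h1 | h1 | h1
  · exact .inl (O.cross h hM hP hS h1)
  · rw [O.pre_inj hS h1]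
    exact .inl .refl
  · obtain ⟨h', hM', hP', e1, e2⟩ := hsym h hM hP hS
    have hD := O.closed h hM hP hS
    right
    rw [← e1, ← e2]
    exact O.cross h' hM' hP' (by rwa [e1]) (by rwa [e1, e2])

include L

theorem low_par {v : ℕ} (hv : 2 ≤ pre v) : low (pre (par v)) ≤ low (pre v) := by
  have := L.le_child (pre v) hv (O.lt_cnt hv)
  rwa [O.ord_eq hv] at this

theorem low_anc {a x : ℕ} (h : Anc par a x) (ha : a ≠ 0) (hx : 2 ≤ pre x) :
    low (pre a) ≤ low (pre x) := by
  induction h with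
  | refl => exact le_rfl
  | @step x hx0 h' ih =>
    rcases O.tree x hx with h1 | h1
    · rw [h1.1] at h'
      cases h' with
      | refl => exact absurd rfl ha
      | step h0 => exact absurd rfl h0
    · exact (ih h1.1).trans (low_par O L hx)

theorem root_spec {v : ℕ} (hv : 2 ≤ pre v) : 2 ≤ pre (root v) ∧ low (pre (root v)) ≤ low (pre v) := by
  induction h : pre v using Nat.strong_induction_on generalizing v with
  | _ N ih =>
    rcases O.tree v hv with h1 | h1
    · rw [h1.2.1, ← h]
      exact ⟨hv, le_rfl⟩
    · have := ih _ (h ▸ h1.2.1) h1.1 rfl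
      rw [h1.2.2.2]
      have h2 := low_par O L hv
      rw [h] at h2
      exact ⟨this.1, this.2.trans h2⟩

include hsym in
-- Adjacent vertices are related by ancestry, hence have the same root, so the tree of v contains a
-- vertex of A. Its lowpoint is 0, and lowpoints do not increase towards the root.
theorem low_root
    (hconn : ∀ v, 2 ≤ pre v → ∃ a, A a ∧
      Relation.ReflTransGen (fun x y => ∃ h < M, P h ∧ S h = x ∧ D h = y) v a)
    {i : ℕ} (hi : 2 ≤ i) (hic : i < cnt) (hpp : pre (par (ord i)) = 1) : low i = 0 := by
  obtain ⟨ho1, ho2⟩ := O.ord_pre i hi hic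
  set v := ord i with hv
  have hv2 : 2 ≤ pre v := by omega
  obtain ⟨a, ha, hr⟩ := hconn v hv2
  have key : 2 ≤ pre a ∧ root a = root v := by
    clear ha
    induction hr with
    | refl => exact ⟨hv2, rfl⟩
    | tail _ h ih =>
      obtain ⟨e, he, hP, rfl, rfl⟩ := h
      have h2 := O.closed e he hP ih.1
      refine ⟨h2, ?_⟩
      rw [← ih.2]
      rcases cross_symm O hsym he hP ih.1 with h3 | h3
      · exact (O.anc_root h3 (O.ne_zero ih.1) h2).symm
      · exact O.anc_root h3 (O.ne_zero h2) ih.1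
  have h3 := root_spec O L key.1
  have h4 : root v = v := by
    rcases O.tree v hv2 with h | h
    · exact h.2.1
    · omega
  rw [key.2, h4, ho2, L.zero (pre a) key.1 (O.lt_cnt key.1) (by simp only [O.ord_eq key.1]; exact ha)]
    at h3
  omega

end

/-- The vertices in `inD` are ordered by `pos` so that each of them is in `A` or has a smaller
neighbour, and is in `Z` or has a larger neighbour; and a visited vertex outside `inD` is separated
from `A` and `Z` by a single vertex. -/
structure StOrder (M : ℕ) (S D : ℕ → ℕ) (P A Z : ℕ → Prop) (pre : ℕ → ℕ) (inD : ℕ → Prop)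
    (pos : ℕ → ℕ) : Prop where
  vis : ∀ v, inD v → 2 ≤ pre v
  inj : ∀ u v, inD u → inD v → pos u = pos v → u = v
  down : ∀ v, inD v → A v ∨ ∃ h < M, P h ∧ S h = v ∧ inD (D h) ∧ pos (D h) < pos v
  up : ∀ v, inD v → Z v ∨ ∃ h < M, P h ∧ S h = v ∧ inD (D h) ∧ pos v < pos (D h)
  flag : ∀ v, 2 ≤ pre v → A v ∨ Z v → inD v
  sep : ∀ v, 2 ≤ pre v → ¬ inD v → ∃ (K : ℕ → Prop) (p : ℕ), K v ∧ ¬ K p ∧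
    (∀ x, K x → 2 ≤ pre x ∧ ¬ A x ∧ ¬ Z x) ∧ ∀ h < M, P h → K (S h) → K (D h) ∨ D h = p

/-- A marked v lies strictly between its parent and its lowpoint. On the side of the parent, the
parent is the neighbour sought, or v is a root and belongs to Z. On the other side it is whatever
attains the lowpoint: the vertex `low v` itself, a virtual vertex, or a child with the same
lowpoint, which was placed between `low v` and v. The order is thus bidirectional without any search
for neighbours. -/
theorem stOrder {n M cnt : ℕ} {S D : ℕ → ℕ} {P Z A : ℕ → Prop}
    {pre par ord root low T lo sz blk : ℕ → ℕ}
    (O : DfsOut n M S D P Z pre par ord root cnt)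
    (hsym : ∀ h < M, P h → 2 ≤ pre (S h) → ∃ h' < M, P h' ∧ S h' = D h ∧ D h' = S h)
    (L : LowInv cnt (n + 2) (IdxAdj M S D P pre) (fun i => A (ord i)) (fun i => Z (ord i))
      (fun i => pre (par (ord i))) 2 low)
    (hroot : ∀ i, 2 ≤ i → i < cnt → pre (par (ord i)) = 1 → low i = 0)
    (I : PosInv cnt (fun i => pre (par (ord i))) low T cnt lo sz blk) :
    StOrder M S D P A Z pre (fun v => blk (pre v) = 1 ∧ v ≠ 0) fun v => lo (pre v) := by
  -- With all children placed, every interval has shrunk to a single cell, so `lo` is injective.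
  have hsz : ∀ j < cnt, sz j = 1 := by
    intro j hj
    rw [I.size j hj]
    simp
  have hbef : ∀ a < cnt, ∀ b, Before lo sz a b → lo a < lo b := by
    intro a ha b h
    have := hsz a ha
    unfold Before at h
    omega
  have hinj : ∀ a < cnt, ∀ b < cnt, lo a = lo b → a = b := by
    intro a ha b hb h
    by_contra hab
    rcases I.disj a ha b hb hab with h' | h'
    · have := hbef a ha b h'
      omega
    · have := hbef b hb a h'
      omega
  have hvis : ∀ v, blk (pre v) = 1 ∧ v ≠ 0 → 2 ≤ pre v := by
    rintro v ⟨h1, h2⟩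
    by_cases h0 : pre v = 0
    · rw [h0, I.blk_zero 0 (.inl rfl)] at h1
      omega
    · exact (O.pre_lt v h2 h0).1
  have hone : ∀ v, 2 ≤ pre v → lo (pre v) < lo 1 := fun v hv =>
    hbef _ (O.lt_cnt hv) _ (I.one _ (O.lt_cnt hv) (by omega))
  have hblk : ∀ v, 2 ≤ pre v → (blk (pre v) = 1 ↔ blk (pre (par v)) = 1 ∧
      low (pre v) < pre (par v)) := by
    intro v hv
    have := I.blk_iff (pre v) hv (O.lt_cnt hv)
    rwa [O.ord_eq hv] at this
  have hbtw : ∀ v, 2 ≤ pre v → low (pre v) < pre (par v) →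
      (lo (low (pre v)) < lo (pre v) ∧ lo (pre v) < lo (pre (par v))) ∨
        (lo (pre (par v)) < lo (pre v) ∧ lo (pre v) < lo (low (pre v))) := by
    intro v hv hl
    have h1 := I.between (pre v) hv (O.lt_cnt hv)
    rw [O.ord_eq hv] at h1
    have h2 := O.lt_cnt hv
    have h3 := O.par_lt hv
    exact (h1 hl).imp
      (fun h => ⟨hbef _ (by omega) _ h.1, hbef _ (by omega) _ h.2⟩)
      (fun h => ⟨hbef _ (by omega) _ h.1, hbef _ (by omega) _ h.2⟩)
  have hanc : ∀ a x, Anc par a x → a ≠ 0 → 2 ≤ pre x → blk (pre x) = 1 → blk (pre a) = 1 := by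
    intro a x h ha
    induction h with
    | refl => exact fun _ h => h
    | @step x hx0 h' ih =>
      intro hx hb
      rcases O.tree x hx with h1 | h1
      · rw [h1.1] at h'
        cases h' with
        | refl => exact absurd rfl ha
        | step h0 => exact absurd rfl h0
      · exact ih h1.1 ((hblk x hx).1 hb).1
  have hrootv : ∀ v, 2 ≤ pre v → par v = 0 → low (pre v) = 0 := by
    intro v hv h
    refine hroot (pre v) hv (O.lt_cnt hv) ?_
    rw [O.ord_eq hv, h, O.pre_zero]
  have hpar : ∀ v, 2 ≤ pre v → blk (pre v) = 1 →
      (par v = 0 ∧ Z v) ∨ (blk (pre (par v)) = 1 ∧ par v ≠ 0 ∧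
        ∃ h < M, P h ∧ S h = v ∧ D h = par v) := by
    intro v hv hb
    rcases O.tree v hv with h1 | ⟨h1, h2, ⟨e, he, e1, e2, e3⟩, h4⟩
    · exact .inl ⟨h1.1, h1.2.2⟩
    · right
      obtain ⟨e', he', e4, e5, e6⟩ := hsym e he e3 (by rwa [e1])
      exact ⟨((hblk v hv).1 hb).1, O.ne_zero h1, e', he', e4, by rw [e5, e2], by rw [e6, e1]⟩
  -- the vertices that witness the lowpoint of `v`
  have hlow : ∀ v, 2 ≤ pre v → blk (pre v) = 1 →
      (A v ∧ low (pre v) = 0) ∨ (Z v ∧ low (pre v) = 1) ∨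
      ∃ h < M, P h ∧ S h = v ∧ blk (pre (D h)) = 1 ∧ D h ≠ 0 ∧
        (pre (D h) = low (pre v) ∨
          (lo (low (pre v)) < lo (pre (D h)) ∧ lo (pre (D h)) < lo (pre v)) ∨
          (lo (pre v) < lo (pre (D h)) ∧ lo (pre (D h)) < lo (low (pre v)))) := by
    intro v hv hb
    have hb' := (hblk v hv).1 hb
    have hp := O.par_lt hv
    have hcnt := O.cnt_le
    have hvc := O.lt_cnt hv
    rcases L.attained (pre v) hv hvc with h | h | h | h | ⟨c', h4, h5, h6, h7⟩
    · omega
    · obtain ⟨_, e, he, e1, e2, e3⟩ := h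
      have hS : S e = v := O.pre_inj (by omega) e2
      have hD := O.closed e he e1 (by omega)
      refine .inr (.inr ⟨e, he, e1, hS, ?_, O.ne_zero hD, .inl e3⟩)
      rcases cross_symm O hsym he e1 (by omega) with h' | h'
      · have := (O.anc_le h' (O.ne_zero (by omega)) hD).2
        omega
      · exact hanc _ _ h' (O.ne_zero hD) (by omega) (by rwa [e2])
    · simp only [O.ord_eq hv] at h
      exact .inl h
    · simp only [O.ord_eq hv] at h
      exact .inr (.inl h)
    · obtain ⟨h8, h9⟩ := O.ord_pre c' h4 h5
      set c := ord c' with hc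
      have hcv : par c = v := (O.pre_inj hv h6.symm).symm
      have hc2 : 2 ≤ pre c := by omega
      rw [← h9] at h7
      have hbc : blk (pre c) = 1 := (hblk c hc2).2 ⟨by rwa [hcv], by rw [hcv]; omega⟩
      rcases hpar c hc2 hbc with h10 | ⟨h10, h11, e, he, e1, e2, e3⟩
      · rw [hcv] at h10
        exact absurd h10.1 (O.ne_zero hv)
      · obtain ⟨e', he', e4, e5, e6⟩ := hsym e he e1 (by rwa [e2])
        refine .inr (.inr ⟨e', he', e4, by rw [e5, e3, hcv], by rwa [e6, e2],
          by rw [e6, e2]; exact O.ne_zero hc2, .inr ?_⟩)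
        rw [e6, e2]
        have := hbtw c hc2 (by rw [hcv]; omega)
        rw [hcv, h7] at this
        omega
  -- A lowpoint 0 or 1 is below the number of any real parent and stays so for all ancestors; at the
  -- root the parent is 1 and the lowpoint is 0. So the condition for the mark holds along the whole
  -- chain.
  have hflag : ∀ v, 2 ≤ pre v → low (pre v) ≤ 1 → blk (pre v) = 1 := by
    intro v
    induction h : pre v using Nat.strong_induction_on generalizing v with
    | _ N ih =>
      subst h
      intro hv hl
      rw [hblk v hv]
      rcases O.tree v hv with h1 | h1
      · rw [h1.1, O.pre_zero, hrootv v hv h1.1]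
        exact ⟨I.blk_one, by omega⟩
      · exact ⟨ih _ h1.2.1 _ rfl h1.1 ((low_par O L hv).trans hl), by omega⟩
  have hA : ∀ v, 2 ≤ pre v → A v → low (pre v) = 0 := fun v hv h =>
    L.zero (pre v) hv (O.lt_cnt hv) (by simp only [O.ord_eq hv]; exact h)
  have hZ : ∀ v, 2 ≤ pre v → Z v → low (pre v) ≤ 1 := fun v hv h =>
    L.one (pre v) hv (O.lt_cnt hv) (by simp only [O.ord_eq hv]; exact h)
  refine ⟨hvis, ?_, ?_, ?_, ?_, ?_⟩
  · intro u v hu hv h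
    exact O.pre_inj (hvis u hu) (hinj _ (O.lt_cnt (hvis u hu)) _ (O.lt_cnt (hvis v hv)) h)
  · intro v hv
    have hv2 := hvis v hv
    have h1 := hone v hv2
    have h0 := I.zero
    rcases hbtw v hv2 ((hblk v hv2).1 hv.1).2 with h | h
    · rcases hlow v hv2 hv.1 with h' | h' | ⟨e, he, e1, e2, e3, e4, e5⟩
      · exact .inl h'.1
      · rw [h'.2] at h
        omega
      · refine .inr ⟨e, he, e1, e2, ⟨e3, e4⟩, ?_⟩
        rcases e5 with e5 | e5 | e5
        · rw [e5]
          exact h.1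
        · exact e5.2
        · omega
    · rcases hpar v hv2 hv.1 with h' | ⟨h2, h3, e, he, e1, e2, e3⟩
      · rw [h'.1, O.pre_zero] at h
        omega
      · exact .inr ⟨e, he, e1, e2, by rw [e3]; exact ⟨h2, h3⟩, by rw [e3]; exact h.1⟩
  · intro v hv
    have hv2 := hvis v hv
    have h1 := hone v hv2
    have h0 := I.zero
    rcases hbtw v hv2 ((hblk v hv2).1 hv.1).2 with h | h
    · rcases hpar v hv2 hv.1 with h' | ⟨h2, h3, e, he, e1, e2, e3⟩
      · exact .inl h'.2
      · exact .inr ⟨e, he, e1, e2, by rw [e3]; exact ⟨h2, h3⟩, by rw [e3]; exact h.2⟩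
    · rcases hlow v hv2 hv.1 with h' | h' | ⟨e, he, e1, e2, e3, e4, e5⟩
      · rw [h'.2] at h
        omega
      · exact .inl h'.1
      · refine .inr ⟨e, he, e1, e2, ⟨e3, e4⟩, ?_⟩
        rcases e5 with e5 | e5 | e5
        · rw [e5]
          exact h.2
        · omega
        · exact e5.1
  · intro v hv h
    refine ⟨hflag v hv ?_, O.ne_zero hv⟩
    rcases h with h | h
    · rw [hA v hv h]
      omega
    · exact hZ v hv h
  · intro v hv hD
    -- r is the highest unmarked ancestor of v. Its parent is marked, so the mark failed because of
    -- the lowpoint of r; the subtree of r will be the separated set.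
    have key : ∃ r, Anc par r v ∧ 2 ≤ pre r ∧ blk (pre r) ≠ 1 ∧ blk (pre (par r)) = 1 ∧
        par r ≠ 0 := by
      have hD' : blk (pre v) ≠ 1 := fun h => hD ⟨h, O.ne_zero hv⟩
      clear hD
      induction h : pre v using Nat.strong_induction_on generalizing v with
      | _ N ih =>
        subst h
        rcases O.tree v hv with h1 | h1
        · refine absurd (hflag v hv ?_) hD'
          rw [hrootv v hv h1.1]
          omega
        · by_cases hb : blk (pre (par v)) = 1
          · exact ⟨v, .refl, hv, hD', hb, O.ne_zero h1.1⟩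
          · obtain ⟨r, h2, h3⟩ := ih _ h1.2.1 _ h1.1 hb rfl
            exact ⟨r, .step (O.ne_zero hv) h2, h3⟩
    obtain ⟨r, hrv, hr2, hrb, hpb, hp0⟩ := key
    have hr0 := O.ne_zero hr2
    have hp := O.par_lt hr2
    have hp2 : 2 ≤ pre (par r) := hvis _ ⟨hpb, hp0⟩
    have hlr : pre (par r) ≤ low (pre r) := by
      by_contra h
      exact hrb ((hblk r hr2).2 ⟨hpb, by omega⟩)
    refine ⟨fun x => 2 ≤ pre x ∧ Anc par r x, par r, ⟨hv, hrv⟩, ?_, ?_, ?_⟩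
    · rintro ⟨h1, h2⟩
      have := (O.anc_le h2 hr0 h1).2
      omega
    · rintro x ⟨h1, h2⟩
      have := low_anc O L h2 hr0 h1
      refine ⟨h1, fun h => ?_, fun h => ?_⟩
      · have := hA x h1 h
        omega
      · have := hZ x h1 h
        omega
    · rintro e he hP ⟨h1, h2⟩
      have h3 := O.closed e he hP h1
      have h4 := low_anc O L h2 hr0 h1
      have h5 := L.le_adj (pre (S e)) (pre (D e)) ⟨h1, e, he, hP, rfl, rfl⟩
      rcases cross_symm O hsym he hP h1 with h6 | h6
      · exact .inl ⟨h3, h2.trans h6⟩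
      · rcases h2.comparable h6 with h7 | h7
        · exact .inl ⟨h3, h7⟩
        · cases h7 with
          | refl => exact .inl ⟨h3, .refl⟩
          | step _ h7 =>
            have := (O.anc_le h7 (O.ne_zero h3) hp2).2
            exact .inr (O.pre_inj h3 (by omega))

end Detour


namespace Detour

/-! ### The programs for the lowpoints and the layout -/

/-- Array `13`: the least preorder number of a neighbour. -/
def lowEdges : Prog :=
  .seq
    (.range 10 (.reg 14)
      (.seq (.put 13 (.reg 10) (.add (.reg 0) (.lit 2))) (.put 14 (.reg 10) (.lit 1))))
    (.range 10 (.reg 7)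
      (.ite (.and (.eq (.arr 8 (.reg 10)) (.lit 0))
          (.and (.not (.eq (.arr 22 (.arr 7 (.reg 10))) (.lit 0)))
            (.lt (.arr 22 (.arr 7 (.reg 10))) (.arr 13 (.arr 22 (.arr 6 (.reg 10)))))))
        (.put 13 (.arr 22 (.arr 6 (.reg 10))) (.arr 22 (.arr 7 (.reg 10))))
        .skip))

/-- Arrays `13, 14`: the lowpoints and the sizes of the subtrees, in reverse preorder. -/
def lowUp : Prog :=
  .range 10 (.sub (.reg 14) (.lit 2))
    (.seq (.set 11 (.sub (.sub (.reg 14) (.lit 1)) (.reg 10)))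
      (.seq (.set 12 (.arr 24 (.reg 11)))
        (.seq (.set 13 (.arr 22 (.arr 23 (.reg 12))))
          (.seq
            (.ite (.eq (.arr 11 (.reg 12)) (.lit 1))
              (.put 13 (.reg 11) (.lit 0))
              (.ite (.and (.eq (.arr 12 (.reg 12)) (.lit 1)) (.lt (.lit 1) (.arr 13 (.reg 11))))
                (.put 13 (.reg 11) (.lit 1)) .skip))
            (.seq
              (.ite (.lt (.arr 13 (.reg 11)) (.arr 13 (.reg 13)))
                (.put 13 (.reg 13) (.arr 13 (.reg 11))) .skip)
              (.put 14 (.reg 13) (.add (.arr 14 (.reg 13)) (.arr 14 (.reg 11)))))))))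

/-- Arrays `15, 16`: the positions in the layout, and the marks of the vertices on shortest
paths. -/
def layout : Prog :=
  .seq (.put 15 (.lit 1) (.lit 1))
    (.seq (.put 16 (.lit 1) (.lit 1))
      (.range 10 (.sub (.reg 14) (.lit 2))
        (.seq (.set 11 (.add (.reg 10) (.lit 2)))
          (.seq (.set 13 (.arr 22 (.arr 23 (.arr 24 (.reg 11)))))
            (.seq
              (.ite (.lt (.arr 15 (.arr 13 (.reg 11))) (.arr 15 (.reg 13)))
                (.seq (.put 15 (.reg 11) (.arr 15 (.reg 13)))
                  (.put 15 (.reg 13) (.add (.arr 15 (.reg 13)) (.arr 14 (.reg 11)))))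
                (.put 15 (.reg 11)
                  (.sub (.add (.arr 15 (.reg 13)) (.arr 14 (.reg 13))) (.arr 14 (.reg 11)))))
              (.seq
                (.ite (.and (.eq (.arr 16 (.reg 13)) (.lit 1)) (.lt (.arr 13 (.reg 11)) (.reg 13)))
                  (.put 16 (.reg 11) (.lit 1)) .skip)
                (.put 14 (.reg 13) (.sub (.arr 14 (.reg 13)) (.arr 14 (.reg 11))))))))))

theorem arrs_lowEdges : lowEdges.arrs = [13, 14, 13] := rfl

theorem regs_lowEdges : lowEdges.regs = [10, 10, 10, 10] := rfl

theorem arrs_lowUp : lowUp.arrs = [13, 13, 13, 14] := rfl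

theorem regs_lowUp : lowUp.regs = [10, 11, 12, 13, 10] := rfl

theorem arrs_layout : layout.arrs = [15, 16, 15, 15, 15, 16, 14] := rfl

theorem regs_layout : layout.regs = [10, 11, 13, 10] := rfl

section

variable {B n M cnt : ℕ} {S D W FA FZ : ℕ → ℕ} {P Z A : ℕ → Prop} {pre par ord root : ℕ → ℕ}
  {σ : State}

/-- The value n + 2 serves as infinity, since preorder numbers are less than `cnt ≤ n + 2`. A
half-edge with unvisited source only affects cell 0, about which the invariant says nothing beyond
an upper bound. -/
theorem runs_lowEdges (hM : M ≤ B) (hn : n + 2 ≤ B) (hn0 : σ.reg 0 = n) (hM7 : σ.reg 7 = M)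
    (hcnt : σ.reg 14 = cnt) (hS : σ.arr 6 = S) (hD : σ.arr 7 = D) (hW : σ.arr 8 = W)
    (hpre : σ.arr 22 = pre) (O : DfsOut n M S D P Z pre par ord root cnt)
    (hlt : ∀ v, pre v < cnt)
    (hP : ∀ h < M, 2 ≤ pre (S h) → (P h ↔ W h = 0 ∧ pre (D h) ≠ 0)) :
    Runs B lowEdges σ fun σ' k => LowInv cnt (n + 2) (IdxAdj M S D P pre) (fun i => A (ord i))
      (fun i => Z (ord i)) (fun i => pre (par (ord i))) cnt (σ'.arr 13) ∧
      SizeInv cnt (fun i => pre (par (ord i))) cnt (σ'.arr 14) ∧ k ≤ 4 * (M + n) + 12 := by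
  have hc := O.cnt_le
  rw [lowEdges, runs_seq]
  refine (Runs.range_const (N := cnt) (K := 2)
    (fun i σ' => ∀ c < i, σ'.arr 13 c = n + 2 ∧ σ'.arr 14 c = 1) (by omega)
      (by simp [Prog.regs]) ?_ (by omega) (fun i σ' k h => h) ?_).mono ?_
  · intro σ' hA
    simp [Expr.eval, hA.2 14 (by simp [Prog.regs_range, Prog.regs]), hcnt]
  · intro i hi σ₁ hA hr hI
    have hn1 : σ₁.reg 0 = n := by rw [hA.2 0 (by simp [Prog.regs_range, Prog.regs]), hn0]
    simp only [runs_seq, runs_put, Expr.eval, hr, hn1, State.put_reg]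
    refine ⟨by omega, by omega, by omega, by omega, ?_, le_rfl⟩
    intro c hcc
    simp only [State.put_arr_same, State.put_arr_ne _ _ _ (show 13 ≠ 14 by omega),
      State.put_arr_ne _ _ _ (show 14 ≠ 13 by omega), Function.update_apply]
    have := hI c
    split_ifs
    · simp
    · exact this (by omega)
  · rintro σ₁ k₁ hA₁ ⟨hI₁, hk₁⟩
    refine (Runs.range_const (N := M) (K := 2)
      (fun i σ' => (∀ h < i, P h → 2 ≤ pre (S h) → σ'.arr 13 (pre (S h)) ≤ pre (D h)) ∧
        (∀ c, 2 ≤ c → c < cnt → σ'.arr 13 c = n + 2 ∨ IdxAdj M S D P pre c (σ'.arr 13 c)) ∧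
        ∀ c < cnt, σ'.arr 13 c ≤ n + 2) (by omega)
      (by simp [Prog.regs]) ?_ ⟨by simp, ?_, ?_⟩ (fun i σ' k h => h) ?_).mono ?_
    · intro σ' hA
      simp [Expr.eval, hA.2 7 (by simp [Prog.regs_range, Prog.regs]),
        hA₁.2 7 (by simp [Prog.regs_range, Prog.regs]), hM7]
    · intro c _ hcc
      exact .inl (hI₁ c hcc).1
    · intro c hcc
      exact (hI₁ c hcc).1.le
    · rintro i hi σ₂ hA₂ hr ⟨h1, h2, h3⟩
      have harr : ∀ a, a ≠ 13 → a ≠ 14 → σ₂.arr a = σ.arr a := by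
        intro a ha ha'
        rw [hA₂.1 a (by simp [Prog.arrs_range, Prog.arrs, ha]),
          hA₁.1 a (by simp [Prog.arrs_range, Prog.arrs, ha, ha'])]
      simp only [runs_ite, runs_put, runs_skip, Test.Holds, Expr.eval, hr, harr 6 (by omega)
        (by omega), harr 7 (by omega) (by omega), harr 8 (by omega) (by omega), harr 22 (by omega)
        (by omega), hS, hD, hW, hpre, State.put_arr_same]
      have hls := hlt (S i)
      have hld := hlt (D i)
      constructor
      · rintro ⟨h4, h5, h6⟩
        refine ⟨by omega, by omega, ⟨?_, ?_, ?_⟩, by omega⟩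
        · intro h hh hPh hSh
          rw [Function.update_apply]
          split_ifs with heq
          · rcases Nat.lt_succ_iff_lt_or_eq.1 hh with h' | h'
            · have := h1 h h' hPh hSh
              rw [heq] at this
              omega
            · rw [h']
          · rcases Nat.lt_succ_iff_lt_or_eq.1 hh with h' | h'
            · exact h1 h h' hPh hSh
            · exact absurd (by rw [h']) heq
        · intro c hc hcc
          rw [Function.update_apply]
          split_ifs with heq
          · exact .inr ⟨hc, i, hi, (hP i hi (by omega)).2 ⟨h4, h5⟩, heq.symm, rfl⟩
          · exact h2 c hc hcc
        · intro c hcc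
          rw [Function.update_apply]
          split_ifs with heq
          · omega
          · exact h3 c hcc
      · intro h4
        refine ⟨⟨?_, h2, h3⟩, by omega⟩
        intro h hh hPh hSh
        rcases Nat.lt_succ_iff_lt_or_eq.1 hh with h' | h'
        · exact h1 h h' hPh hSh
        · subst h'
          obtain ⟨h5, h6⟩ := (hP h hi hSh).1 hPh
          by_contra h7
          exact h4 ⟨h5, h6, by omega⟩
    · rintro σ₂ k₂ hA₂ ⟨⟨h1, h2, h3⟩, hk₂⟩
      have h14 : σ₂.arr 14 = σ₁.arr 14 := hA₂.1 14 (by simp [Prog.arrs_range, Prog.arrs])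
      refine ⟨⟨?_, ?_, ?_, ?_, ?_, h3⟩, ⟨?_, ?_⟩, by omega⟩
      · rintro c x ⟨hc, h, hh, hPh, e1, e2⟩
        rw [← e1, ← e2]
        exact h1 h hh hPh (by omega)
      · intro c h4 h5
        omega
      · intro c h4 h5
        omega
      · intro c h4 h5
        omega
      · intro c hc hcc
        exact (h2 c hc hcc).imp id .inl
      · intro j hj
        rw [h14, (hI₁ j hj).2]
        simp
      · rw [h14, Finset.sum_congr rfl fun j hj => (hI₁ j (Finset.mem_range.1 hj)).2]
        simp

theorem runs_lowUp (hn : n + 2 ≤ B) (hcnt : σ.reg 14 = cnt)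
    (hpre : σ.arr 22 = pre) (hpar : σ.arr 23 = par) (hord : σ.arr 24 = ord)
    (hFA : ∀ v, σ.arr 11 v = 1 ↔ A v) (hFZ : ∀ v, σ.arr 12 v = 1 ↔ Z v)
    (O : DfsOut n M S D P Z pre par ord root cnt)
    (hL : LowInv cnt (n + 2) (IdxAdj M S D P pre) (fun i => A (ord i))
      (fun i => Z (ord i)) (fun i => pre (par (ord i))) cnt (σ.arr 13))
    (hI : SizeInv cnt (fun i => pre (par (ord i))) cnt (σ.arr 14)) :
    Runs B lowUp σ fun σ' k => LowInv cnt (n + 2) (IdxAdj M S D P pre) (fun i => A (ord i))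
      (fun i => Z (ord i)) (fun i => pre (par (ord i))) 2 (σ'.arr 13) ∧
      SizeInv cnt (fun i => pre (par (ord i))) 2 (σ'.arr 14) ∧ k ≤ 11 * n + 2 := by
  have hc := O.cnt_le
  have hc2 := O.two_le
  refine (Runs.range_const (N := cnt - 2) (K := 9)
    (fun j σ' => LowInv cnt (n + 2) (IdxAdj M S D P pre) (fun i => A (ord i))
      (fun i => Z (ord i)) (fun i => pre (par (ord i))) (cnt - j) (σ'.arr 13) ∧
      SizeInv cnt (fun i => pre (par (ord i))) (cnt - j) (σ'.arr 14)) (by omega)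
      (by simp [Prog.regs]) ?_ ⟨hL, hI⟩ (fun i σ' k h => h) ?_).mono ?_
  · intro σ' hA
    simp [Expr.eval, hA.2 14 (by simp [Prog.regs_range, Prog.regs]), hcnt]
  · rintro j hj σ₁ hA hr ⟨hL₁, hI₁⟩
    have harr : ∀ a, a ≠ 13 → a ≠ 14 → σ₁.arr a = σ.arr a := by
      intro a ha ha'
      rw [hA.1 a (by simp [Prog.arrs_range, Prog.arrs, ha, ha'])]
    have hcnt₁ : σ₁.reg 14 = cnt := by
      rw [hA.2 14 (by simp [Prog.regs_range, Prog.regs]), hcnt]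
    -- The counter j ascends while the treated vertex i descends from the last preorder number to 2.
    obtain ⟨i, hi⟩ : ∃ i, i = cnt - 1 - j := ⟨_, rfl⟩
    have hi1 : cnt - j = i + 1 := by omega
    have hi2 : cnt - (j + 1) = i := by omega
    rw [hi1] at hL₁ hI₁
    rw [hi2]
    have ho := O.ord_pre i (by omega) (by omega)
    have hon := O.pre_lt (ord i) (by omega) (by omega)
    have hpp := O.pp_lt (i := i) (by omega) (by omega)
    obtain ⟨hsz, hI₂⟩ := hI₁.step (by omega) hpp.2
    have hstep := fun x y => hL₁.step (x := x) (y := y) (by omega) (by omega) hpp.2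
    have hFA' := hFA (ord i)
    have hFZ' := hFZ (ord i)
    have htop := hL₁.le_top i (by omega)
    obtain ⟨low, hlow⟩ : ∃ low, σ₁.arr 13 = low := ⟨_, rfl⟩
    obtain ⟨sz, hsz'⟩ : ∃ sz, σ₁.arr 14 = sz := ⟨_, rfl⟩
    rw [hlow] at hstep htop
    rw [hsz'] at hI₂ hsz
    obtain ⟨p, hp⟩ : ∃ p, pre (par (ord i)) = p := ⟨_, rfl⟩
    simp only [hp] at hpp hsz hI₂ hstep
    simp only [runs_seq, runs_set, Expr.eval, hr, hcnt₁, ← hi, State.set_reg, State.set_arr,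
      if_true, harr 22 (by omega) (by omega), hpre,
      harr 23 (by omega) (by omega), hpar, harr 24 (by omega) (by omega), hord, hp]
    refine ⟨by omega, by omega, by omega, ?_⟩
    obtain ⟨τ, hτ⟩ : ∃ τ, τ = ((σ₁.set 11 i).set 12 (ord i)).set 13 p := ⟨_, rfl⟩
    have hτa : τ.arr = σ₁.arr := by rw [hτ]; rfl
    have hτ11 : τ.reg 11 = i := by rw [hτ]; simp
    have hτ12 : τ.reg 12 = ord i := by rw [hτ]; simp
    have hτ13 : τ.reg 13 = p := by rw [hτ]; simp
    rw [← hτ]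
    have first : Runs B (.ite (.eq (.arr 11 (.reg 12)) (.lit 1))
        (.put 13 (.reg 11) (.lit 0))
        (.ite (.and (.eq (.arr 12 (.reg 12)) (.lit 1)) (.lt (.lit 1) (.arr 13 (.reg 11))))
          (.put 13 (.reg 11) (.lit 1)) .skip)) τ fun σ' k => k ≤ 3 ∧ ∃ x ≤ low i,
          (A (ord i) → x = 0) ∧ (Z (ord i) → x ≤ 1) ∧
          (x = low i ∨ (A (ord i) ∧ x = 0) ∨ (Z (ord i) ∧ x = 1)) ∧
          σ'.arr 13 = Function.update low i x := by
      simp only [runs_ite, runs_put, runs_skip, Test.Holds, Expr.eval, hτa, hτ11, hτ12,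
        State.put_arr_same, hlow, harr 11 (by omega) (by omega), harr 12 (by omega) (by omega)]
      refine ⟨fun h => ⟨by omega, by omega, by omega, 0, by omega, by omega, by omega,
        .inr (.inl ⟨hFA'.1 h, rfl⟩), rfl⟩, fun h => ⟨fun h' => ⟨by omega, by omega, by omega, 1,
        by omega, fun h'' => absurd (hFA'.2 h'') h, by omega, .inr (.inr ⟨hFZ'.1 h'.1, rfl⟩), rfl⟩,
        fun h' => ⟨by omega, low i, le_rfl, fun h'' => absurd (hFA'.2 h'') h, fun h'' => ?_,
        .inl rfl, (Function.update_eq_self i low).symm⟩⟩⟩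
      have := hFZ'.2 h''
      omega
    refine first.mono ?_
    rintro τ' k hA' ⟨hk, x, hx, hxA, hxZ, hx', hτ'⟩
    have hstep' := hstep x _ hx hxA hxZ hx' rfl
    have hpi : Function.update low i x p = low p := Function.update_of_ne (by omega) _ _
    have r11 : τ'.reg 11 = i := by rw [hA'.2 11 (by simp [Prog.regs]), hτ11]
    have r13 : τ'.reg 13 = p := by rw [hA'.2 13 (by simp [Prog.regs]), hτ13]
    have a14 : τ'.arr 14 = sz := by rw [hA'.1 14 (by simp [Prog.arrs]), hτa, hsz']
    simp only [runs_ite, runs_put, runs_skip, Test.Holds, Expr.eval, r11, r13, hτ', a14, hpi,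
      Function.update_self, State.put_reg, State.put_arr_same,
      State.put_arr_ne _ _ _ (show 13 ≠ 14 by omega), State.put_arr_ne _ _ _ (show 14 ≠ 13 by omega)]
    refine ⟨fun h => ⟨by omega, by omega, by omega, by omega, ⟨?_, hI₂⟩, by omega⟩,
      fun h => ⟨by omega, by omega, ⟨?_, hI₂⟩, by omega⟩⟩
    · rwa [min_eq_right (by omega)] at hstep'
    · rw [min_eq_left (by omega)] at hstep'
      rwa [show Function.update (Function.update low i x) p (low p) = Function.update low i x from
        Function.update_eq_self_iff.2 hpi.symm] at hstep'
  · rintro σ' k hA ⟨⟨h1, h2⟩, hk⟩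
    rw [show cnt - (cnt - 2) = 2 by omega] at h1 h2
    exact ⟨h1, h2, by omega⟩

/-- Children of j exceed j, hence i, so starting the sum at i loses none of them. This is the form
in which the layout needs the subtree sizes. -/
theorem SizeInv.sum_eq {pp sz : ℕ → ℕ} (hI : SizeInv cnt pp 2 sz)
    (hpp : ∀ c, 2 ≤ c → c < cnt → 1 ≤ pp c ∧ pp c < c) {i : ℕ} (hi : 2 ≤ i) (j : ℕ) (hij : i ≤ j)
    (hj : j < cnt) : sz j = 1 + ∑ c ∈ (Finset.Ico i cnt).filter (fun c => pp c = j), sz c := by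
  rw [hI.eq j hj]
  congr 2
  ext c
  simp only [Finset.mem_filter, Finset.mem_Ico]
  constructor
  · rintro ⟨⟨h1, h2⟩, h3⟩
    have := hpp c h1 h2
    exact ⟨⟨by omega, h2⟩, h3⟩
  · rintro ⟨⟨h1, h2⟩, h3⟩
    exact ⟨⟨by omega, h2⟩, h3⟩

theorem runs_layout {low : ℕ → ℕ} (hn : n + 3 ≤ B) (hcnt : σ.reg 14 = cnt)
    (hpre : σ.arr 22 = pre) (hpar : σ.arr 23 = par) (hord : σ.arr 24 = ord) (hlow : σ.arr 13 = low)
    (h15 : ∀ i, σ.arr 15 i = 0) (h16 : ∀ i, σ.arr 16 i = 0)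
    (O : DfsOut n M S D P Z pre par ord root cnt)
    (hroot : ∀ i, 2 ≤ i → i < cnt → pre (par (ord i)) = 1 → low i = 0)
    (hI : SizeInv cnt (fun i => pre (par (ord i))) 2 (σ.arr 14)) :
    Runs B layout σ fun σ' k => (∃ sz, PosInv cnt (fun i => pre (par (ord i))) low (σ.arr 14) cnt
      (σ'.arr 15) sz (σ'.arr 16)) ∧ k ≤ 10 * n + 6 := by
  have hc := O.cnt_le
  have hc2 := O.two_le
  have hpp' : ∀ c, 2 ≤ c → c < cnt → 1 ≤ pre (par (ord c)) ∧ pre (par (ord c)) < c :=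
    fun c h1 h2 => O.pp_lt h1 h2
  obtain ⟨T, hT⟩ : ∃ T, σ.arr 14 = T := ⟨_, rfl⟩
  rw [hT] at hI ⊢
  simp only [layout, runs_seq, runs_put, Expr.eval]
  refine ⟨by omega, by omega, by omega, by omega, ?_⟩
  refine (Runs.range_const (N := cnt - 2) (K := 8)
    (fun j σ' => PosInv cnt (fun i => pre (par (ord i))) low T (j + 2) (σ'.arr 15) (σ'.arr 14)
      (σ'.arr 16)) (by omega)
      (by simp [Prog.regs]) ?_ ?_ (fun i σ' k h => h) ?_).mono ?_
  · intro σ' hA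
    simp [Expr.eval, hA.2 14 (by simp [Prog.regs_range, Prog.regs]), hcnt]
  -- At the start only the virtual vertices are placed: 0 is childless and fills cell 0, and the
  -- interval of 1 begins at cell 1 with room for all its descendants.
  · have h0 : T 0 = 1 := by
      rw [hI.eq 0 (by omega), Nat.add_eq_left]
      refine Finset.sum_eq_zero fun c hc => ?_
      simp only [Finset.mem_filter, Finset.mem_Ico] at hc
      have := hpp' c hc.1.1 hc.1.2
      omega
    have h1 := hI.le (j := 1) (by omega)
    simp only [State.set_arr, State.put_arr_same, State.put_arr_ne _ _ _ (show 15 ≠ 16 by omega),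
      State.put_arr_ne _ _ _ (show 16 ≠ 15 by omega), State.put_arr_ne _ _ _ (show 14 ≠ 16 by omega),
      State.put_arr_ne _ _ _ (show 14 ≠ 15 by omega), hT]
    have l0 : Function.update (σ.arr 15) 1 1 0 = 0 := by simp [h15]
    have l1 : Function.update (σ.arr 15) 1 1 1 = 1 := by simp
    refine ⟨hI.eq, ?_, ?_, l0, ?_, ?_, ?_, ?_, ?_⟩
    · intro j hj k hk hjk
      unfold Before
      obtain ⟨rfl, rfl⟩ | ⟨rfl, rfl⟩ : (j = 0 ∧ k = 1) ∨ (j = 1 ∧ k = 0) := by omega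
      · left
        rw [l0, l1, h0]
      · right
        rw [l0, l1, h0]
    · intro j hj
      obtain rfl | rfl : j = 0 ∨ j = 1 := by omega
      · rw [l0, h0]
        omega
      · rw [l1]
        omega
    · intro j hj hj1
      obtain rfl : j = 0 := by omega
      unfold Before
      rw [l0, l1, h0]
    · intro v hv hv'
      omega
    · intro v hv
      rw [Function.update_of_ne (by omega), h16]
    · simp
    · intro v hv hv'
      omega
  · rintro j hj σ₁ hA hr hI₁
    obtain ⟨i, hi⟩ : ∃ i, i = j + 2 := ⟨_, rfl⟩
    have hi' : j + 1 + 2 = i + 1 := by omega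
    rw [← hi] at hI₁
    rw [hi']
    have harr : ∀ a, a ≠ 14 → a ≠ 15 → a ≠ 16 → σ₁.arr a = σ.arr a := by
      intro a h14 h15 h16
      rw [hA.1 a (by simp [Prog.arrs_range, Prog.arrs, h14, h15, h16]), State.put_arr_ne _ _ _ h16,
        State.put_arr_ne _ _ _ h15]
    have hstep := fun lo' blk' => hI₁.step (lo' := lo') (blk' := blk') (by omega) (by omega) hpp'
      (fun j h1 h2 => hI.sum_eq hpp' (by omega) j h1 h2) (hroot i (by omega) (by omega))
    have hppi := hpp' i (by omega) (by omega)
    obtain ⟨lo, hlo⟩ : ∃ lo, σ₁.arr 15 = lo := ⟨_, rfl⟩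
    obtain ⟨blk, hblk⟩ : ∃ blk, σ₁.arr 16 = blk := ⟨_, rfl⟩
    obtain ⟨sz, hsz⟩ : ∃ sz, σ₁.arr 14 = sz := ⟨_, rfl⟩
    rw [hlo, hblk, hsz] at hstep hI₁
    have hb1 := hI₁.bound _ (show pre (par (ord i)) < i by omega)
    have hb2 : sz i ≤ sz (pre (par (ord i))) := by
      rw [hI₁.size _ (show pre (par (ord i)) < cnt by omega), sum_children T (by omega), if_pos rfl,
        hI₁.size i (by omega), ← hI.sum_eq hpp' (by omega) i le_rfl (by omega)]
      omega
    obtain ⟨p, hp⟩ : ∃ p, pre (par (ord i)) = p := ⟨_, rfl⟩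
    simp only [hp] at hstep hb1 hb2 hppi
    have h13 : σ₁.arr 13 = low := by rw [harr 13 (by omega) (by omega) (by omega), hlow]
    have hpi : p ≠ i := by omega
    simp only [runs_seq, runs_set, runs_put, runs_ite, runs_skip, Test.Holds, Expr.eval, hr, ← hi,
      State.set_reg, State.set_arr, State.put_reg, State.put_arr_same,
      State.put_arr_ne _ _ _ (show 14 ≠ 15 by omega), State.put_arr_ne _ _ _ (show 14 ≠ 16 by omega),
      State.put_arr_ne _ _ _ (show 15 ≠ 14 by omega), State.put_arr_ne _ _ _ (show 15 ≠ 16 by omega),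
      State.put_arr_ne _ _ _ (show 16 ≠ 14 by omega), State.put_arr_ne _ _ _ (show 16 ≠ 15 by omega),
      State.put_arr_ne _ _ _ (show 13 ≠ 15 by omega), if_true, if_false, Nat.reduceEqDiff, harr 22 (by omega) (by omega) (by omega), hpre,
      harr 23 (by omega) (by omega) (by omega), hpar, harr 24 (by omega) (by omega) (by omega), hord,
      hp, hlo, hblk, hsz, h13, Function.update_of_ne hpi]
    refine ⟨by omega, by omega, fun h1 => ⟨by omega, by omega, by omega, by omega,
      fun h2 => ⟨by omega, by omega, by omega, by omega, ?_, by omega⟩,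
      fun h2 => ⟨by omega, by omega, ?_, by omega⟩⟩, fun h1 => ⟨by omega, by omega,
      fun h2 => ⟨by omega, by omega, by omega, by omega, ?_, by omega⟩,
      fun h2 => ⟨by omega, by omega, ?_, by omega⟩⟩⟩
    · exact hstep _ _ (.inl ⟨h1, rfl⟩) (.inl ⟨h2, rfl⟩)
    · exact hstep _ _ (.inl ⟨h1, rfl⟩) (.inr ⟨h2, rfl⟩)
    · exact hstep _ _ (.inr ⟨h1, rfl⟩) (.inl ⟨h2, rfl⟩)
    · exact hstep _ _ (.inr ⟨h1, rfl⟩) (.inr ⟨h2, rfl⟩)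
  · rintro σ' k hA ⟨h1, hk⟩
    rw [show cnt - 2 + 2 = cnt by omega] at h1
    exact ⟨⟨_, h1⟩, by omega⟩

end

end Detour


namespace Detour

/-! ### Distances -/

section

variable {V : Type*} {G : SimpleGraph V} {w : Sym2 V → ℕ} {s t u v : V}

@[simp] theorem walkLength_nil : walkLength w (SimpleGraph.Walk.nil : G.Walk u u) = 0 := rfl

@[simp] theorem walkLength_cons {x : V} (h : G.Adj u v) (p : G.Walk v x) :
    walkLength w (SimpleGraph.Walk.cons h p) = w s(u, v) + walkLength w p := by
  simp [walkLength]

@[simp] theorem walkLength_append {x : V} (p : G.Walk u v) (q : G.Walk v x) :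
    walkLength w (p.append q) = walkLength w p + walkLength w q := by
  simp [walkLength]

@[simp] theorem walkLength_reverse (p : G.Walk u v) : walkLength w p.reverse = walkLength w p := by
  simp [walkLength]

@[simp] theorem walkLength_concat {x : V} (p : G.Walk u v) (h : G.Adj v x) :
    walkLength w (p.concat h) = walkLength w p + w s(v, x) := by
  simp [walkLength, SimpleGraph.Walk.edges_concat]

/-- Removing loops from a walk only deletes edges, whose lengths are nonnegative. So the distance,
defined by simple paths, bounds all walks. -/
theorem wdist_le (p : G.Walk u v) : wdist G w u v ≤ walkLength w p := by
  classical
  refine (ciInf_le (OrderBot.bddBelow _) (⟨p.bypass, p.bypass_isPath⟩ : G.Path u v)).trans ?_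
  exact ((p.edges_bypass_sublist_edges).map w).sum_le_sum (fun _ _ => Nat.zero_le _)

theorem exists_shortest (hG : G.Connected) (w : Sym2 V → ℕ) (u v : V) :
    ∃ p : G.Walk u v, p.IsPath ∧ walkLength w p = wdist G w u v := by
  classical
  obtain ⟨p, hp⟩ := (hG.preconnected u v).exists_isPath
  have : Nonempty (G.Path u v) := ⟨⟨p, hp⟩⟩
  obtain ⟨q, hq⟩ := Nat.sInf_mem
    (Set.range_nonempty fun p : G.Path u v => walkLength w (p : G.Walk u v))
  exact ⟨q, q.2, hq⟩

theorem isShortestPath_iff (hG : G.Connected) {p : G.Walk u v} :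
    IsShortestPath w p ↔ p.IsPath ∧ walkLength w p = wdist G w u v := by
  constructor
  · rintro ⟨h1, h2⟩
    obtain ⟨q, hq, hq'⟩ := exists_shortest hG w u v
    exact ⟨h1, le_antisymm ((h2 q hq).trans hq'.le) (wdist_le p)⟩
  · rintro ⟨h1, h2⟩
    exact ⟨h1, fun q _ => h2.le.trans (wdist_le q)⟩

theorem wdist_self : wdist G w u u = 0 :=
  Nat.le_zero.1 (wdist_le (SimpleGraph.Walk.nil : G.Walk u u))

theorem wdist_triangle (hG : G.Connected) (u v x : V) :
    wdist G w u x ≤ wdist G w u v + wdist G w v x := by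
  obtain ⟨p, -, hp⟩ := exists_shortest hG w u v
  obtain ⟨q, -, hq⟩ := exists_shortest hG w v x
  rw [← hp, ← hq, ← walkLength_append]
  exact wdist_le _

theorem wdist_adj_le (h : G.Adj u v) : wdist G w u v ≤ w s(u, v) := by
  have := wdist_le (w := w) (SimpleGraph.Walk.cons h .nil)
  simpa using this

theorem wdist_step (hG : G.Connected) (h : G.Adj u v) :
    wdist G w s v ≤ wdist G w s u + w s(u, v) :=
  (wdist_triangle hG s u v).trans (Nat.add_le_add_left (wdist_adj_le h) _)

theorem wdist_step' (hG : G.Connected) (h : G.Adj u v) :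
    wdist G w u t ≤ w s(u, v) + wdist G w v t :=
  (wdist_triangle hG u v t).trans (Nat.add_le_add_right (wdist_adj_le h) _)

theorem exists_eq_append {p : G.Walk u v} {d : G.Dart} (hd : d ∈ p.darts) :
    ∃ (q : G.Walk u d.fst) (r : G.Walk d.snd v), p = q.append (.cons d.adj r) := by
  induction p with
  | nil => simp at hd
  | cons h p ih =>
    rw [SimpleGraph.Walk.darts_cons, List.mem_cons] at hd
    rcases hd with rfl | hd
    · exact ⟨.nil, p, rfl⟩
    · obtain ⟨q, r, rfl⟩ := ih hd
      exact ⟨.cons h q, r, rfl⟩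

theorem dart_le (p : G.Walk s t) {d : G.Dart} (hd : d ∈ p.darts) :
    wdist G w s d.fst + w d.edge + wdist G w d.snd t ≤ walkLength w p := by
  obtain ⟨q, r, rfl⟩ := exists_eq_append hd
  have h1 := wdist_le (w := w) q
  have h2 := wdist_le (w := w) r
  have h3 : w d.edge = w s(d.fst, d.snd) := rfl
  rw [walkLength_append, walkLength_cons]
  omega

/-- All the steps of a walk that continues a shortest path are tight. -/
theorem tight_walk (hG : G.Connected) (p : G.Walk u t) (hp : walkLength w p = wdist G w u t)
    (hu : wdist G w s u + wdist G w u t = wdist G w s t) :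
    (∀ d ∈ p.darts, wdist G w s d.fst + w d.edge = wdist G w s d.snd ∧
      wdist G w d.fst t = w d.edge + wdist G w d.snd t) ∧
    ∀ v ∈ p.support, wdist G w s v + wdist G w v t = wdist G w s t := by
  induction p with
  | nil => simpa using hu
  | @cons a b c h p ih =>
    rw [walkLength_cons] at hp
    have h1 := wdist_le (w := w) p
    have h2 := wdist_step' (w := w) (t := c) hG h
    have h3 := wdist_step (w := w) (s := s) hG h
    have h4 := wdist_triangle (w := w) hG s b c
    obtain ⟨h5, h6⟩ := ih (by omega) (by omega)
    refine ⟨fun d hd => ?_, fun v hv => ?_⟩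
    · rw [SimpleGraph.Walk.darts_cons, List.mem_cons] at hd
      rcases hd with rfl | hd
      · change wdist G w s a + w s(a, b) = wdist G w s b ∧
          wdist G w a c = w s(a, b) + wdist G w b c
        omega
      · exact h5 d hd
    · rw [SimpleGraph.Walk.support_cons, List.mem_cons] at hv
      rcases hv with rfl | hv
      · exact hu
      · exact h6 v hv

theorem tight_of_shortest (hG : G.Connected) {p : G.Walk s t} (hp : IsShortestPath w p) :
    (∀ d ∈ p.darts, wdist G w s d.fst + w d.edge = wdist G w s d.snd ∧
      wdist G w d.fst t = w d.edge + wdist G w d.snd t) ∧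
    ∀ v ∈ p.support, wdist G w s v + wdist G w v t = wdist G w s t :=
  tight_walk hG p ((isShortestPath_iff hG).1 hp).2 (by rw [wdist_self, zero_add])

/-! ### The union of the shortest paths -/

/-- The vertices of `D`, with an order in which every vertex other than `s` has a predecessor and
every vertex other than `t` has a successor on a shortest path. The vertices are compared by their
distance from `s` first, and then by `pos`. -/
structure Cert (G : SimpleGraph V) (w : Sym2 V → ℕ) (s t : V) (inD : V → Prop) (pos : V → ℕ) :
    Prop where
  source : inD s
  target : inD t
  tight : ∀ v, inD v → wdist G w s v + wdist G w v t = wdist G w s t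
  inj : ∀ u v, inD u → inD v → pos u = pos v → u = v
  pred : ∀ v, inD v → v ≠ s → ∃ u, inD u ∧ G.Adj u v ∧ wdist G w s u + w s(u, v) = wdist G w s v ∧
    (wdist G w s u < wdist G w s v ∨ wdist G w s u = wdist G w s v ∧ pos u < pos v)
  succ : ∀ v, inD v → v ≠ t → ∃ u, inD u ∧ G.Adj v u ∧ wdist G w s v + w s(v, u) = wdist G w s u ∧
    (wdist G w s v < wdist G w s u ∨ wdist G w s v = wdist G w s u ∧ pos v < pos u)
  supp : ∀ p : G.Walk s t, IsShortestPath w p → ∀ v ∈ p.support, inD v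

/-- The key by which the vertices of `D` are ordered. -/
noncomputable def key (G : SimpleGraph V) (w : Sym2 V → ℕ) (s : V) (pos : V → ℕ) (v : V) :
    ℕ ×ₗ ℕ :=
  toLex (wdist G w s v, pos v)

theorem key_lt {pos : V → ℕ} {a b : V} : key G w s pos a < key G w s pos b ↔
    wdist G w s a < wdist G w s b ∨ wdist G w s a = wdist G w s b ∧ pos a < pos b := by
  simp [key, Prod.Lex.toLex_lt_toLex]

namespace Cert

variable {inD : V → Prop} {pos : V → ℕ} (C : Cert G w s t inD pos)

include C

theorem key_inj {a b : V} (ha : inD a) (hb : inD b) (h : key G w s pos a = key G w s pos b) :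
    a = b := by
  have : wdist G w s a = wdist G w s b ∧ pos a = pos b := by simpa [key] using h
  exact C.inj a b ha hb this.2

/-- Predecessors strictly decrease the key, so following them terminates at s and never repeats a
vertex, even along edges of length 0. -/
theorem exists_from_source (v : V) (hv : inD v) : ∃ p : G.Walk s v, p.IsPath ∧
    walkLength w p = wdist G w s v ∧
    ∀ x ∈ p.support, inD x ∧ key G w s pos x ≤ key G w s pos v := by
  induction h : key G w s pos v using WellFoundedLT.induction generalizing v with
  | _ k ih =>
    subst h
    by_cases hvs : v = s
    · subst hvs
      exact ⟨.nil, .nil, wdist_self.symm, by simpa using hv⟩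
    · obtain ⟨u, hu, hadj, hd, hlt⟩ := C.pred v hv hvs
      have hlt' := key_lt.2 hlt
      obtain ⟨p, hp, hl, hk⟩ := ih _ hlt' u hu rfl
      refine ⟨p.concat hadj, hp.concat (fun h => ?_) hadj, by rw [walkLength_concat]; omega, ?_⟩
      · exact absurd (hk v h).2 (not_le.2 hlt')
      · intro x hx
        rw [SimpleGraph.Walk.support_concat, List.mem_append, List.mem_singleton] at hx
        rcases hx with hx | rfl
        · exact ⟨(hk x hx).1, (hk x hx).2.trans hlt'.le⟩
        · exact ⟨hv, le_rfl⟩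

theorem exists_succ (v : V) (hv : inD v) (hvt : v ≠ t) : ∃ u, inD u ∧ G.Adj v u ∧
    wdist G w v t = w s(v, u) + wdist G w u t ∧ wdist G w s v + w s(v, u) = wdist G w s u ∧
    key G w s pos v < key G w s pos u := by
  obtain ⟨u, hu, hadj, hd, hlt⟩ := C.succ v hv hvt
  have h1 := C.tight v hv
  have h2 := C.tight u hu
  exact ⟨u, hu, hadj, by omega, hd, key_lt.2 hlt⟩

theorem exists_to_target [Finite V] (v : V) (hv : inD v) : ∃ p : G.Walk v t, p.IsPath ∧
    walkLength w p = wdist G w v t ∧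
    ∀ x ∈ p.support, inD x ∧ key G w s pos v ≤ key G w s pos x := by
  have wf : WellFounded fun a b : V => key G w s pos b < key G w s pos a :=
    @Finite.wellFounded_of_trans_of_irrefl _ _ (fun a b : V => key G w s pos b < key G w s pos a)
      ⟨fun _ _ _ h h' => h'.trans h⟩ ⟨fun _ h => lt_irrefl _ h⟩
  induction v using wf.induction with
  | _ v ih =>
    by_cases hvt : v = t
    · subst hvt
      exact ⟨.nil, .nil, wdist_self.symm, by simpa using hv⟩
    · obtain ⟨u, hu, hadj, hd, -, hlt⟩ := C.exists_succ v hv hvt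
      obtain ⟨p, hp, hl, hk⟩ := ih u hlt hu
      refine ⟨.cons hadj p, hp.cons fun h => ?_, by rw [walkLength_cons]; omega, ?_⟩
      · exact absurd (hk v h).2 (not_le.2 hlt)
      · intro x hx
        rw [SimpleGraph.Walk.support_cons, List.mem_cons] at hx
        rcases hx with rfl | hx
        · exact ⟨hv, le_rfl⟩
        · exact ⟨(hk x hx).1, hlt.le.trans (hk x hx).2⟩

/-- Keys are at most that of u before the edge and at least that of v after it, so the two chains
are disjoint and their concatenation is simple. -/
theorem mem_shortestEdges_of_lt [Finite V] (hG : G.Connected) {u v : V} (h : G.Adj u v)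
    (hu : inD u) (hv : inD v) (hd : wdist G w s u + w s(u, v) = wdist G w s v)
    (hk : key G w s pos u < key G w s pos v) : s(u, v) ∈ shortestEdges G w s t := by
  obtain ⟨p, hp, hpl, hpk⟩ := C.exists_from_source u hu
  obtain ⟨q, hq, hql, hqk⟩ := C.exists_to_target v hv
  refine ⟨p.append (.cons h q), (isShortestPath_iff hG).2 ⟨?_, ?_⟩, by simp⟩
  · rw [SimpleGraph.Walk.isPath_def, SimpleGraph.Walk.support_append,
      SimpleGraph.Walk.support_cons, List.tail_cons, List.nodup_append]
    refine ⟨hp.support_nodup, hq.support_nodup, fun a ha b hb hab => ?_⟩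
    subst hab
    exact absurd ((hqk a hb).2.trans (hpk a ha).2) (not_le.2 hk)
  · have := C.tight v hv
    rw [walkLength_append, walkLength_cons]
    omega

/-- A zero-length edge is tight in both directions; the key picks the direction in which a simple
shortest path is built through it. The right-hand side is what the program can test. -/
theorem mem_shortestEdges [Finite V] (hG : G.Connected) {u v : V} (h : G.Adj u v) :
    s(u, v) ∈ shortestEdges G w s t ↔ inD u ∧ inD v ∧
      (wdist G w s u + w s(u, v) = wdist G w s v ∨ wdist G w s v + w s(u, v) = wdist G w s u) := by
  constructor
  · rintro ⟨p, hp, he⟩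
    refine ⟨C.supp p hp u (p.fst_mem_support_of_mem_edges he),
      C.supp p hp v (p.snd_mem_support_of_mem_edges he), ?_⟩
    rw [SimpleGraph.Walk.edges, List.mem_map] at he
    obtain ⟨d, hd, he⟩ := he
    have h1 := ((tight_of_shortest hG hp).1 d hd).1
    have h2 : s(d.fst, d.snd) = s(u, v) := he
    rw [he] at h1
    rcases Sym2.eq_iff.1 h2 with ⟨h3, h4⟩ | ⟨h3, h4⟩
    · rw [h3, h4] at h1
      exact .inl h1
    · rw [h3, h4] at h1
      exact .inr h1
  · rintro ⟨hu, hv, hd⟩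
    have hne : key G w s pos u ≠ key G w s pos v := fun h' => h.ne (C.key_inj hu hv h')
    have hsw : s(u, v) = s(v, u) := Sym2.eq_swap
    rcases lt_or_gt_of_ne hne with hk | hk
    · refine C.mem_shortestEdges_of_lt hG h hu hv ?_ hk
      rcases key_lt.1 hk with h1 | h1 <;> omega
    · rw [hsw] at hd ⊢
      refine C.mem_shortestEdges_of_lt hG h.symm hv hu ?_ hk
      rcases key_lt.1 hk with h1 | h1 <;> omega

end Cert

/-! ### Crossing edges -/

/-- `r v` is a vertex of `D` from which `v` is reached outside `D` by tight edges for the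
potential `e`. -/
structure RootSpec (G : SimpleGraph V) (w : Sym2 V → ℕ) (inD : V → Prop) (e : V → ℕ)
    (r : V → V) : Prop where
  self : ∀ v, inD v → r v = v
  step : ∀ v, ¬ inD v → ∃ u, G.Adj u v ∧ e u + w s(u, v) = e v ∧ r u = r v

/-- The edges outside `D` that join different trees, when the first end is assigned to a tree by
`r` and the second one by `r'`. -/
def Cand (G : SimpleGraph V) (w : Sym2 V → ℕ) (s t : V) (r r' : V → V) (x y : V) : Prop :=
  G.Adj x y ∧ s(x, y) ∉ shortestEdges G w s t ∧ r x ≠ r' y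

/-- The vertices of `D`, with assignments of all vertices to trees rooted in `D`. -/
structure TreeData (G : SimpleGraph V) (w : Sym2 V → ℕ) (s t : V) (inD : V → Prop) (r r' : V → V) :
    Prop where
  source : inD s
  target : inD t
  mem : ∀ u v, s(u, v) ∈ shortestEdges G w s t → inD u ∧ inD v
  root : RootSpec G w inD (fun v => wdist G w s v) r
  root' : RootSpec G w inD (fun v => wdist G w v t) r'

/-- The value of ρ changes only at steps between fixed points, and there the new value is the vertex
just entered. So the last value is the initial one or has been visited; the same holds in reverse.
-/
theorem mem_support_or_eq {ρ : V → V} (p : G.Walk u v)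
    (h : ∀ d ∈ p.darts, ρ d.fst = ρ d.snd ∨ ρ d.fst = d.fst ∧ ρ d.snd = d.snd) :
    (ρ v ∈ p.support ∨ ρ v = ρ u) ∧ (ρ u ∈ p.support ∨ ρ u = ρ v) := by
  induction p with
  | nil => simp
  | @cons a b c hab p ih =>
    obtain ⟨ih1, ih2⟩ := ih fun d hd => h d (by simp [hd])
    have h0 := h ⟨(a, b), hab⟩ (by simp)
    simp only at h0
    have hb := p.start_mem_support
    rw [SimpleGraph.Walk.support_cons, List.mem_cons, List.mem_cons]
    constructor
    · rcases ih1 with h1 | h1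
      · exact .inl (.inr h1)
      · rcases h0 with h0 | h0
        · exact .inr (by rw [h1, h0])
        · exact .inl (.inr (by rwa [h1, h0.2]))
    · rcases h0 with h0 | h0
      · rw [h0]
        exact ih2.imp .inr id
      · exact .inl (.inl h0.1)

/-- A path between vertices fixed by `ρ` has all its edges in `s` if its steps outside `s` do not
change `ρ`. -/
theorem edges_subset_of_retraction {ρ : V → V} {E : Set (Sym2 V)} (p : G.Walk u v) (hp : p.IsPath)
    (hu : ρ u = u) (hv : ρ v = v) (hE : ∀ d ∈ p.darts, d.edge ∉ E → ρ d.fst = ρ d.snd)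
    (hE' : ∀ d ∈ p.darts, d.edge ∈ E → ρ d.fst = d.fst ∧ ρ d.snd = d.snd) :
    ∀ e ∈ p.edges, e ∈ E := by
  have h : ∀ d ∈ p.darts, ρ d.fst = ρ d.snd ∨ ρ d.fst = d.fst ∧ ρ d.snd = d.snd := fun d hd => by
    by_cases hd' : d.edge ∈ E
    · exact .inr (hE' d hd hd')
    · exact .inl (hE d hd hd')
  intro e he
  rw [SimpleGraph.Walk.edges, List.mem_map] at he
  obtain ⟨d, hd, rfl⟩ := he
  by_contra hd'
  have heq := hE d hd hd'
  obtain ⟨q, r, rfl⟩ := exists_eq_append hd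
  -- The common value of ρ at the ends of the step d is a vertex that occurs both before and after
  -- d, contradicting simplicity.
  have h1 := (mem_support_or_eq q fun d' h' => h d' (by simp [h'])).1
  have h2 := (mem_support_or_eq r fun d' h' => h d' (by simp [h'])).2
  rw [SimpleGraph.Walk.isPath_def, SimpleGraph.Walk.support_append,
    SimpleGraph.Walk.support_cons, List.tail_cons, List.nodup_append] at hp
  refine hp.2.2 (ρ d.fst) ?_ (ρ d.fst) ?_ rfl
  · rcases h1 with h1 | h1
    · exact h1
    · rw [h1, hu]
      exact q.start_mem_support
  · rw [heq]
    rcases h2 with h2 | h2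
    · exact h2
    · rw [h2, hv]
      exact r.end_mem_support

namespace TreeData

variable {inD : V → Prop} {r r' : V → V} (X : TreeData G w s t inD r r') {ℓ : ℕ}

include X

/-- For v outside D, the edge to its parent u in the d_t-forest lies outside D and has cost d_s(v) +
d_t(v) ≤ ℓ. Not being a candidate, it gives r v = r' u = r' v. -/
theorem root_eq
    (hno : ∀ x y, Cand G w s t r r' x y → ℓ < wdist G w s x + w s(x, y) + wdist G w y t) {v : V}
    (hv : wdist G w s v + wdist G w v t ≤ ℓ) : r v = r' v := by
  by_cases h : inD v
  · rw [X.root.self v h, X.root'.self v h]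
  · obtain ⟨u, hadj, hd, hr⟩ := X.root'.step v h
    by_contra hne
    have := hno v u ⟨hadj.symm, fun hm => h (X.mem _ _ hm).1, by rwa [hr]⟩
    rw [Sym2.eq_swap] at this
    omega

/-- The edge is no candidate, so r x = r' y; and y satisfies the bound of `root_eq`, so r' y = r y.
-/
theorem root_eq_of_adj (hG : G.Connected)
    (hno : ∀ x y, Cand G w s t r r' x y → ℓ < wdist G w s x + w s(x, y) + wdist G w y t) {x y : V}
    (h : G.Adj x y) (hxy : s(x, y) ∉ shortestEdges G w s t)
    (hl : wdist G w s x + w s(x, y) + wdist G w y t ≤ ℓ) : r x = r y := by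
  have h1 := wdist_step (w := w) (s := s) hG h
  rw [X.root_eq hno (v := y) (by omega)]
  by_contra hne
  have := hno x y ⟨h, hxy, hne⟩
  omega

/-- A detour is at least as long as some candidate. -/
theorem exists_cand_le (hG : G.Connected) {p : G.Walk s t} (hp : IsDetour w p) :
    ∃ x y, Cand G w s t r r' x y ∧
      wdist G w s x + w s(x, y) + wdist G w y t ≤ walkLength w p := by
  by_contra hcon
  have hno : ∀ x y, Cand G w s t r r' x y →
      walkLength w p < wdist G w s x + w s(x, y) + wdist G w y t := by
    intro x y h
    by_contra h'
    exact hcon ⟨x, y, h, by omega⟩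
  obtain ⟨hpath, e, he, he'⟩ := hp
  refine he' (edges_subset_of_retraction (ρ := r) p hpath (X.root.self s X.source)
    (X.root.self t X.target) (fun d hd h => ?_) (fun d _ h => ?_) e he)
  · exact X.root_eq_of_adj hG hno d.adj h (dart_le p hd)
  · have := X.mem _ _ h
    exact ⟨X.root.self _ this.1, X.root.self _ this.2⟩

end TreeData

end

end Detour


namespace Detour

/-! ### Shortest-path trees -/

section

variable {V : Type*} {G : SimpleGraph V} {w : Sym2 V → ℕ} {s t u v : V}

/-- The steps of a path of a shortest-path tree to the root. -/
theorem tree_darts (hG : G.Connected) {T : SimpleGraph V} (hT : IsShortestPathTree G w s T)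
    (p : T.Walk v u) (hu : u = s) (hp : p.IsPath) :
    ∀ d ∈ p.darts, wdist G w s d.snd + w s(d.fst, d.snd) = wdist G w s d.fst ∧
      wdist G w s d.fst + wdist G w d.fst t ≤ wdist G w s v + wdist G w v t := by
  induction p with
  | nil => simp
  | @cons a b c h p ih =>
    subst hu
    have h1 := hT.2.2 a (SimpleGraph.Walk.cons h p).reverse hp.reverse
    have hp' := (SimpleGraph.Walk.cons_isPath_iff h p).1 hp
    have h2 := hT.2.2 b p.reverse hp'.1.reverse
    rw [walkLength_reverse] at h1 h2
    rw [walkLength_cons] at h1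
    have h3 := wdist_step' (w := w) (t := t) hG (hT.1 h).symm
    rw [Sym2.eq_swap] at h3
    intro d hd
    rw [SimpleGraph.Walk.darts_cons, List.mem_cons] at hd
    rcases hd with rfl | hd
    · simp only
      omega
    · have := ih rfl hp'.1 d hd
      omega

variable {inD : V → Prop} {r r' : V → V} (X : TreeData G w s t inD r r')
  {T : SimpleGraph V} (hT : IsShortestPathTree G w s T)

include X hT

/-- Without candidates of length at most `ℓ`, the function `r` is constant on the parts of short
tree paths outside `D`. -/
theorem forest_reachable_root (hG : G.Connected) {ℓ : ℕ}
    (hno : ∀ x y, Cand G w s t r r' x y → ℓ < wdist G w s x + w s(x, y) + wdist G w y t)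
    (p : T.Walk v u) (hu : u = s) (hp : p.IsPath) (hv : wdist G w s v + wdist G w v t ≤ ℓ) :
    (forest G w s t T).Reachable (r v) v := by
  induction p with
  | nil =>
    subst hu
    rw [X.root.self _ X.source]
  | @cons a b c h p ih =>
    have hp' := (SimpleGraph.Walk.cons_isPath_iff h p).1 hp
    by_cases he : s(a, b) ∈ shortestEdges G w s t
    · rw [X.root.self _ (X.mem _ _ he).1]
    · have hd := tree_darts (t := t) hG hT _ hu hp ⟨(a, b), h⟩ (by simp)
      simp only at hd
      have h3 := wdist_step' (w := w) (t := t) hG (hT.1 h).symm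
      have hsw : s(b, a) = s(a, b) := Sym2.eq_swap
      -- Taken away from the root, the tree edge has cost d_s(a) + d_t(a), which is at most ℓ.
      have heq := X.root_eq_of_adj hG hno (hT.1 h).symm (by rwa [hsw]) (by rw [hsw]; omega)
      rw [hsw] at h3
      have hadj : (forest G w s t T).Adj b a := by
        rw [forest, SimpleGraph.deleteEdges_adj, hsw]
        exact ⟨h.symm, he⟩
      have := ih hu hp'.1 (by omega)
      rw [heq] at this
      exact this.trans hadj.reachable

/-- A crossing edge yields a candidate that is not longer. -/
theorem exists_cand_of_crossing (hG : G.Connected) {x y : V} (h : IsCrossing G w s t T x y) :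
    ∃ x' y', Cand G w s t r r' x' y' ∧ wdist G w s x' + w s(x', y') + wdist G w y' t ≤
      wdist G w s x + w s(x, y) + wdist G w y t := by
  by_contra hcon
  have hno : ∀ x' y', Cand G w s t r r' x' y' →
      wdist G w s x + w s(x, y) + wdist G w y t <
        wdist G w s x' + w s(x', y') + wdist G w y' t := by
    intro x' y' h
    by_contra h'
    exact hcon ⟨x', y', h, by omega⟩
  obtain ⟨h1, -, h2, h3⟩ := h
  have h4 := wdist_step (w := w) (s := s) hG h1
  have h5 := wdist_step' (w := w) (t := t) hG h1
  obtain ⟨p, hp⟩ := (hT.2.1.connected.preconnected x s).exists_isPath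
  obtain ⟨q, hq⟩ := (hT.2.1.connected.preconnected y s).exists_isPath
  have h6 := forest_reachable_root X hT hG hno p rfl hp (by omega)
  have h7 := forest_reachable_root X hT hG hno q rfl hq (by omega)
  rw [X.root_eq_of_adj hG hno h1 h2 le_rfl] at h6
  exact h3 (h6.symm.trans h7)

variable (hdet : ∀ x y, Cand G w s t r r' x y → ∃ p : G.Walk s t, IsDetour w p ∧
    walkLength w p ≤ wdist G w s x + w s(x, y) + wdist G w y t)

include hdet

/-- A candidate of cost at most d(s,t) would give a detour that is a shortest path, which is absurd.
But all vertices of the tree path have d_s + d_t ≤ d(s,t), since this sum does not increase towards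
the root. So r is unchanged across its edges outside D, and the retraction argument applies. -/
theorem tree_path_edges (hG : G.Connected) (hDt : ∀ v, inD v →
    wdist G w s v + wdist G w v t = wdist G w s t) (p : T.Walk v s) (hp : p.IsPath) (hv : inD v) :
    ∀ e ∈ p.edges, e ∈ shortestEdges G w s t := by
  have hno : ∀ x y, Cand G w s t r r' x y →
      wdist G w s t < wdist G w s x + w s(x, y) + wdist G w y t := by
    intro x y h
    by_contra h'
    obtain ⟨q, ⟨hq, e, he, he'⟩, hl⟩ := hdet x y h
    have := wdist_le (w := w) q
    exact he' ⟨q, (isShortestPath_iff hG).2 ⟨hq, by omega⟩, he⟩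
  refine edges_subset_of_retraction (ρ := r) p hp (X.root.self v hv) (X.root.self s X.source)
    (fun d hd h => ?_) (fun d _ h => ?_)
  · obtain ⟨h1, h2⟩ := tree_darts (t := t) hG hT p rfl hp d hd
    have hsw : s(d.snd, d.fst) = d.edge := Sym2.eq_swap
    have hed : s(d.fst, d.snd) = d.edge := rfl
    have := hDt v hv
    refine (X.root_eq_of_adj hG hno (hT.1 d.adj).symm (by rwa [hsw]) ?_).symm
    rw [hsw]
    rw [hed] at h1
    omega
  · have := X.mem _ _ h
    exact ⟨X.root.self _ this.1, X.root.self _ this.2⟩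

/-- The tree path from a to b runs inside the two tree paths to s, hence in D, whereas a path of the
forest has no edge in D. -/
theorem eq_of_forest_reachable (hG : G.Connected) (hDt : ∀ v, inD v →
    wdist G w s v + wdist G w v t = wdist G w s t) {a b : V} (ha : inD a) (hb : inD b)
    (h : (forest G w s t T).Reachable a b) : a = b := by
  classical
  have hle : forest G w s t T ≤ T := SimpleGraph.deleteEdges_le _
  obtain ⟨q, hq⟩ := h.exists_isPath
  obtain ⟨pa, hpa⟩ := (hT.2.1.connected.preconnected a s).exists_isPath
  obtain ⟨pb, hpb⟩ := (hT.2.1.connected.preconnected b s).exists_isPath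
  have hea := tree_path_edges X hT hdet hG hDt pa hpa ha
  have heb := tree_path_edges X hT hdet hG hDt pb hpb hb
  have huniq := (hT.2.1.isAcyclic.subsingleton_path a b).elim ⟨q.mapLe hle, hq.mapLe hle⟩
    ⟨(pa.append pb.reverse).bypass, SimpleGraph.Walk.bypass_isPath _⟩
  have hedges : ∀ e ∈ q.edges, e ∈ shortestEdges G w s t := by
    intro e he
    have h1 : e ∈ (q.mapLe hle).edges := by simpa using he
    rw [show q.mapLe hle = (pa.append pb.reverse).bypass from congrArg Subtype.val huniq] at h1
    have h2 := SimpleGraph.Walk.edges_bypass_subset_edges _ h1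
    rw [SimpleGraph.Walk.edges_append, List.mem_append, SimpleGraph.Walk.edges_reverse,
      List.mem_reverse] at h2
    exact h2.elim (hea e) (heb e)
  cases q with
  | nil => rfl
  | cons hadj q =>
    rw [forest, SimpleGraph.deleteEdges_adj] at hadj
    exact absurd (hedges _ (by simp)) hadj.2

omit hT hdet in
theorem exists_forest_root (p : T.Walk v u) (hu : u = s) :
    ∃ a, inD a ∧ (forest G w s t T).Reachable a v := by
  induction p with
  | nil => exact ⟨_, hu ▸ X.source, .refl _⟩
  | @cons a b c h p ih =>
    by_cases he : s(a, b) ∈ shortestEdges G w s t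
    · exact ⟨a, (X.mem _ _ he).1, .refl _⟩
    · obtain ⟨x, hx, hr⟩ := ih hu
      have hadj : (forest G w s t T).Adj a b := by
        rw [forest, SimpleGraph.deleteEdges_adj]
        exact ⟨h, he⟩
      exact ⟨x, hx, hr.trans hadj.symm.reachable⟩

/-- A detour crosses between two trees of the forest. -/
theorem exists_crossing_le (hG : G.Connected) (hDt : ∀ v, inD v →
    wdist G w s v + wdist G w v t = wdist G w s t) {p : G.Walk s t} (hp : IsDetour w p) :
    ∃ x y, IsCrossing G w s t T x y ∧
      wdist G w s x + w s(x, y) + wdist G w y t ≤ walkLength w p := by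
  by_contra hcon
  have hroot : ∀ v, ∃ a, inD a ∧ (forest G w s t T).Reachable a v := fun v => by
    obtain ⟨q, -⟩ := (hT.2.1.connected.preconnected v s).exists_isPath
    exact exists_forest_root X q rfl
  -- ρ sends each vertex to the only vertex of D in its component of the forest. A step outside D
  -- that is not crossing stays in one component, as tree edges outside D are forest edges.
  choose ρ hρ hρr using hroot
  have hself : ∀ v, inD v → ρ v = v := fun v hv =>
    eq_of_forest_reachable X hT hdet hG hDt (hρ v) hv (hρr v)
  obtain ⟨hpath, e, he, he'⟩ := hp
  refine he' (edges_subset_of_retraction (ρ := ρ) p hpath (hself s X.source) (hself t X.target)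
    (fun d hd h => ?_) (fun d _ h => ?_) e he)
  · have hreach : (forest G w s t T).Reachable d.fst d.snd := by
      by_contra hr
      refine hcon ⟨d.fst, d.snd, ⟨d.adj, fun hadj => hr ?_, h, hr⟩, dart_le p hd⟩
      refine SimpleGraph.Adj.reachable ?_
      rw [forest, SimpleGraph.deleteEdges_adj]
      exact ⟨hadj, h⟩
    exact eq_of_forest_reachable X hT hdet hG hDt (hρ _) (hρ _)
      (((hρr _).trans hreach).trans (hρr _).symm)
  · have := X.mem _ _ h
    exact ⟨hself _ this.1, hself _ this.2⟩

theorem iInf_detour_eq (hG : G.Connected) (hDt : ∀ v, inD v →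
    wdist G w s v + wdist G w v t = wdist G w s t) :
    (⨅ (p : G.Walk s t) (_ : IsDetour w p), (walkLength w p : ℕ∞)) =
      ⨅ (x : V) (y : V), crossCost G w s t T x y := by
  apply le_antisymm
  · refine le_iInf fun x => le_iInf fun y => ?_
    rw [crossCost]
    split_ifs with h
    · obtain ⟨x', y', hc, hl⟩ := exists_cand_of_crossing X hT hG h
      obtain ⟨p, hp, hpl⟩ := hdet x' y' hc
      exact iInf₂_le_of_le p hp (by exact_mod_cast hpl.trans hl)
    · exact le_top
  · refine le_iInf₂ fun p hp => ?_
    obtain ⟨x, y, hc, hl⟩ := exists_crossing_le X hT hdet hG hDt hp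
    refine iInf₂_le_of_le x y ?_
    rw [crossCost, if_pos hc]
    exact_mod_cast hl

end

end Detour


namespace Detour

/-! ### The input of the machine -/

/-- The half-edges of `G`: every edge occurs with both orientations. Vertices are shifted by `1`. -/
structure HalfEdges {n : ℕ} (G : SimpleGraph (Fin n)) (w : Sym2 (Fin n) → ℕ) (M : ℕ)
    (S D W : ℕ → ℕ) : Prop where
  adj : ∀ h < M, ∃ x y : Fin n, G.Adj x y ∧ S h = x + 1 ∧ D h = y + 1 ∧ W h = w s(x, y)
  surj : ∀ x y : Fin n, G.Adj x y → ∃ h < M, S h = x + 1 ∧ D h = y + 1 ∧ W h = w s(x, y)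

/-- The part of the memory that stays fixed after the half-edges have been set up. -/
structure Base {n : ℕ} (G : SimpleGraph (Fin n)) (w : Sym2 (Fin n) → ℕ) (s t : Fin n) (M : ℕ)
    (S D W : ℕ → ℕ) (σ : State) : Prop where
  reg0 : σ.reg 0 = n
  reg4 : σ.reg 4 = 0
  reg5 : σ.reg 5 = s + 1
  reg6 : σ.reg 6 = t + 1
  reg7 : σ.reg 7 = M
  reg8 : σ.reg 8 = wdist G w s t
  arr3 : ∀ v : Fin n, σ.arr 3 v = wdist G w s v
  arr4 : ∀ v : Fin n, σ.arr 4 v = wdist G w v t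
  arr6 : σ.arr 6 = S
  arr7 : σ.arr 7 = D
  arr8 : σ.arr 8 = W

theorem Base.agree {n : ℕ} {G : SimpleGraph (Fin n)} {w : Sym2 (Fin n) → ℕ} {s t : Fin n} {M : ℕ}
    {S D W : ℕ → ℕ} {σ σ' : State} (b : Base G w s t M S D W σ)
    (ha : ∀ a < 9, a ≠ 5 → σ'.arr a = σ.arr a) (hr : ∀ x < 9, σ'.reg x = σ.reg x) :
    Base G w s t M S D W σ' where
  reg0 := by rw [hr 0 (by omega), b.reg0]
  reg4 := by rw [hr 4 (by omega), b.reg4]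
  reg5 := by rw [hr 5 (by omega), b.reg5]
  reg6 := by rw [hr 6 (by omega), b.reg6]
  reg7 := by rw [hr 7 (by omega), b.reg7]
  reg8 := by rw [hr 8 (by omega), b.reg8]
  arr3 := by rw [ha 3 (by omega) (by omega)]; exact b.arr3
  arr4 := by rw [ha 4 (by omega) (by omega)]; exact b.arr4
  arr6 := by rw [ha 6 (by omega) (by omega), b.arr6]
  arr7 := by rw [ha 7 (by omega) (by omega), b.arr7]
  arr8 := by rw [ha 8 (by omega) (by omega), b.arr8]

/-- Set up the half-edges and some constants. -/
def setup : Prog :=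
  .seq (.set 5 (.add (.reg 2) (.lit 1)))
    (.seq (.set 6 (.add (.reg 3) (.lit 1)))
      (.seq (.set 7 (.add (.reg 1) (.reg 1)))
        (.seq (.set 8 (.arr 3 (.reg 3)))
          (.range 10 (.reg 1)
            (.seq (.put 6 (.reg 10) (.add (.arr 0 (.reg 10)) (.lit 1)))
              (.seq (.put 7 (.reg 10) (.add (.arr 1 (.reg 10)) (.lit 1)))
                (.seq (.put 8 (.reg 10) (.arr 2 (.reg 10)))
                  (.seq (.put 6 (.add (.reg 1) (.reg 10)) (.add (.arr 1 (.reg 10)) (.lit 1)))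
                    (.seq (.put 7 (.add (.reg 1) (.reg 10)) (.add (.arr 0 (.reg 10)) (.lit 1)))
                      (.put 8 (.add (.reg 1) (.reg 10)) (.arr 2 (.reg 10))))))))))))

theorem arrs_setup : setup.arrs = [6, 7, 8, 6, 7, 8] := rfl

theorem cells_apply {k : ℕ} (g : Fin k → ℕ) (i : Fin k) : cells g i = g i := by
  simp [cells]

section

variable {n m : ℕ} {G : SimpleGraph (Fin n)} {w : Sym2 (Fin n) → ℕ} {s t : Fin n}
  {src dst : Fin m → Fin n} {B : ℕ}

theorem runs_setup (hE : IsEdgeList G src dst) (hB : InputBound G w s t src dst B) :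
    Runs (6 * B) setup (inputState G w s t src dst) fun σ' k =>
      (∃ S D W, HalfEdges G w (2 * m) S D W ∧ Base G w s t (2 * m) S D W σ') ∧
      k ≤ 8 * m + 6 := by
  obtain ⟨hn, hm, hw, hd⟩ := hB
  have hs := s.2
  have ht := t.2
  have hdt := (hd t).1
  simp only [setup, runs_seq, runs_set, Expr.eval, State.set_reg, State.set_arr, if_false,
    Nat.reduceEqDiff]
  have e1 : (inputState G w s t src dst).reg 1 = m := rfl
  have e2 : (inputState G w s t src dst).reg 2 = s := rfl
  have e3 : (inputState G w s t src dst).reg 3 = t := rfl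
  have e4 : (inputState G w s t src dst).arr 3 t = wdist G w s t := cells_apply _ t
  rw [e1, e2, e3, e4]
  refine ⟨by omega, by omega, by omega, by omega, ?_⟩
  -- Edge e yields the half-edge e and its reverse m + e; codes of vertices are shifted by one so
  -- that 0 can mean "none".
  refine (Runs.range_const (N := m) (K := 6)
    (fun i σ' => ∀ e : Fin m, (e : ℕ) < i →
      (σ'.arr 6 e = src e + 1 ∧ σ'.arr 7 e = dst e + 1 ∧ σ'.arr 8 e = w s(src e, dst e)) ∧
      (σ'.arr 6 (m + e) = dst e + 1 ∧ σ'.arr 7 (m + e) = src e + 1 ∧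
        σ'.arr 8 (m + e) = w s(src e, dst e))) (by omega)
    (by simp [Prog.regs]) ?_ ?_ (fun i σ' k h => h) ?_).mono ?_
  · intro σ' hA
    simp only [Expr.eval]
    rw [hA.2 1 (by simp [Prog.regs_range, Prog.regs])]
    simp [e1]
  · intro e he
    omega
  · intro i hi σ₁ hA hr hI
    have r1 : σ₁.reg 1 = m := by
      rw [hA.2 1 (by simp [Prog.regs_range, Prog.regs])]
      simp [e1]
    have a0 : σ₁.arr 0 i = src ⟨i, hi⟩ := by
      rw [hA.1 0 (by simp [Prog.arrs_range, Prog.arrs])]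
      exact cells_apply (fun i => (src i : ℕ)) ⟨i, hi⟩
    have a1 : σ₁.arr 1 i = dst ⟨i, hi⟩ := by
      rw [hA.1 1 (by simp [Prog.arrs_range, Prog.arrs])]
      exact cells_apply (fun i => (dst i : ℕ)) ⟨i, hi⟩
    have a2 : σ₁.arr 2 i = w s(src ⟨i, hi⟩, dst ⟨i, hi⟩) := by
      rw [hA.1 2 (by simp [Prog.arrs_range, Prog.arrs])]
      exact cells_apply (fun i => w s(src i, dst i)) ⟨i, hi⟩
    have h1 := (src ⟨i, hi⟩).2
    have h2 := (dst ⟨i, hi⟩).2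
    have h3 := hw ⟨i, hi⟩
    simp only [runs_seq, runs_put, Expr.eval, hr, r1, a0, a1, a2, State.put_reg,
      State.put_arr_same, ne_eq, Nat.reduceEqDiff, not_false_eq_true,
      State.put_arr_ne]
    refine ⟨by omega, by omega, by omega, by omega, by omega, by omega, by omega, by omega,
      by omega, by omega, by omega, by omega, ?_, by omega⟩
    intro e he
    by_cases hei : (e : ℕ) = i
    · obtain rfl : e = ⟨i, hi⟩ := Fin.ext hei
      have : i ≠ m + i := by omega
      simp [Function.update_of_ne this]
    · have h4 : (e : ℕ) ≠ m + i := by omega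
      have h5 : m + (e : ℕ) ≠ i := by omega
      have h6 : m + (e : ℕ) ≠ m + i := by omega
      simp only [Function.update_of_ne hei, Function.update_of_ne h4, Function.update_of_ne h5,
        Function.update_of_ne h6]
      exact hI e (by omega)
  · rintro σ' k hA ⟨hI, hk⟩
    refine ⟨⟨σ'.arr 6, σ'.arr 7, σ'.arr 8, ⟨?_, ?_⟩, ?_⟩, by omega⟩
    · intro h hh
      have hadj : ∀ e : Fin m, G.Adj (src e) (dst e) := fun e => by
        have : s(src e, dst e) ∈ G.edgeSet := hE.2 ▸ ⟨e, rfl⟩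
        simpa using this
      by_cases hm' : h < m
      · obtain ⟨⟨h1, h2, h3⟩, -⟩ := hI ⟨h, hm'⟩ hm'
        exact ⟨_, _, hadj ⟨h, hm'⟩, h1, h2, h3⟩
      · obtain ⟨-, h1, h2, h3⟩ := hI ⟨h - m, by omega⟩ (by simp only; omega)
        simp only [show m + (h - m) = h by omega] at h1 h2 h3
        exact ⟨_, _, (hadj ⟨h - m, by omega⟩).symm, h1, h2, by rw [h3, Sym2.eq_swap]⟩
    · intro x y hxy
      have : s(x, y) ∈ Set.range fun i => s(src i, dst i) := by
        rw [hE.2]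
        simpa using hxy
      obtain ⟨e, he⟩ := this
      simp only at he
      obtain ⟨⟨h1, h2, h3⟩, h4, h5, h6⟩ := hI e e.2
      have hlt := e.2
      rcases Sym2.eq_iff.1 he with ⟨h7, h8⟩ | ⟨h7, h8⟩
      · exact ⟨e, by omega, by rw [h1, h7], by rw [h2, h8], by rw [h3, he]⟩
      · exact ⟨m + e, by omega, by rw [h4, h8], by rw [h5, h7], by rw [h6, he]⟩
    · have hr : ∀ x, x ≠ 10 → σ'.reg x = ((((((inputState G w s t src dst).set 5 (↑s + 1)).set 6
          (↑t + 1)).set 7 (m + m)).set 8 (wdist G w s t))).reg x := fun x hx =>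
        hA.2 x (by simp [Prog.regs_range, Prog.regs, hx])
      have ha : ∀ a < 6, σ'.arr a = (inputState G w s t src dst).arr a := fun a ha => by
        rw [hA.1 a (by simp [Prog.arrs_range, Prog.arrs]; omega)]
        simp
      refine ⟨?_, ?_, ?_, ?_, ?_, ?_, ?_, ?_, rfl, rfl, rfl⟩
      · rw [hr 0 (by omega)]; rfl
      · rw [hr 4 (by omega)]; rfl
      · rw [hr 5 (by omega)]; simp
      · rw [hr 6 (by omega)]; simp
      · rw [hr 7 (by omega)]; simp; omega
      · rw [hr 8 (by omega)]; simp
      · intro v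
        rw [ha 3 (by omega)]
        exact cells_apply (fun v => wdist G w s v) v
      · intro v
        rw [ha 4 (by omega)]
        exact cells_apply (fun v => wdist G w v t) v

end

/-! ### The vertices on the shortest paths -/

/-- The half-edge `h` is a step of positive length of a shortest walk from `s` to `t`. -/
def PosTight (ds dt : ℕ → ℕ) (d : ℕ) (S D W : ℕ → ℕ) (h : ℕ) : Prop :=
  ds (S h - 1) + W h + dt (D h - 1) = d ∧ 0 < W h

/-- The half-edge `h` has length `0` and leads to a vertex on a shortest walk from `s` to `t`. -/
def ZeroTight (ds dt : ℕ → ℕ) (d : ℕ) (D W : ℕ → ℕ) (h : ℕ) : Prop :=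
  W h = 0 ∧ ds (D h - 1) + dt (D h - 1) = d

/-- Arrays `11, 12`: the vertices where shortest paths enter and leave a component of the edges of
length `0`. -/
def flags : Prog :=
  .seq (.put 11 (.reg 5) (.lit 1))
    (.seq (.put 12 (.reg 6) (.lit 1))
      (.range 10 (.reg 7)
        (.ite (.and (.eq (.add (.add (.arr 3 (.sub (.arr 6 (.reg 10)) (.lit 1))) (.arr 8 (.reg 10)))
              (.arr 4 (.sub (.arr 7 (.reg 10)) (.lit 1)))) (.reg 8))
            (.lt (.lit 0) (.arr 8 (.reg 10))))
          (.seq (.put 12 (.arr 6 (.reg 10)) (.lit 1)) (.put 11 (.arr 7 (.reg 10)) (.lit 1)))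
          .skip)))

theorem arrs_flags : flags.arrs = [11, 12, 12, 11] := rfl

theorem regs_flags : flags.regs = [10, 10] := rfl

theorem runs_flags {B M d a z : ℕ} {S D W ds dt : ℕ → ℕ} {σ : State} (hM : M ≤ B)
    (hS : ∀ h < M, S h ≤ B) (hD : ∀ h < M, D h ≤ B) (ha : a ≤ B) (hz : z ≤ B) (hB : 1 ≤ B)
    (r5 : σ.reg 5 = a) (r6 : σ.reg 6 = z) (r7 : σ.reg 7 = M) (r8 : σ.reg 8 = d)
    (a3 : σ.arr 3 = ds) (a4 : σ.arr 4 = dt) (a6 : σ.arr 6 = S) (a7 : σ.arr 7 = D)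
    (a8 : σ.arr 8 = W) (h11 : ∀ i, σ.arr 11 i = 0) (h12 : ∀ i, σ.arr 12 i = 0) :
    Runs B flags σ fun σ' k =>
      (∀ v, σ'.arr 11 v = 1 ↔ v = a ∨ ∃ h < M, PosTight ds dt d S D W h ∧ D h = v) ∧
      (∀ v, σ'.arr 12 v = 1 ↔ v = z ∨ ∃ h < M, PosTight ds dt d S D W h ∧ S h = v) ∧
      k ≤ 5 * M + 4 := by
  simp only [flags, runs_seq, runs_put, Expr.eval, r5, r6, State.put_reg]
  refine ⟨ha, hB, hz, hB, ?_⟩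
  refine (Runs.range_const (N := M) (K := 3)
    (fun i σ' =>
      (∀ v, σ'.arr 11 v = 1 ↔ v = a ∨ ∃ h < i, PosTight ds dt d S D W h ∧ D h = v) ∧
      (∀ v, σ'.arr 12 v = 1 ↔ v = z ∨ ∃ h < i, PosTight ds dt d S D W h ∧ S h = v)) hM
    (by simp [Prog.regs]) ?_ ⟨?_, ?_⟩ (fun i σ' k h => h) ?_).mono ?_
  · intro σ' hA
    simp only [Expr.eval]
    rw [hA.2 7 (by simp [Prog.regs_range, Prog.regs])]
    simp [r7]
  · intro v
    simp [State.put_arr_same, State.put_arr_ne, Function.update_apply, h11]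
  · intro v
    simp [State.put_arr_same, State.put_arr_ne, Function.update_apply, h12]
  · rintro i hi σ₁ hA hr ⟨h1, h2⟩
    have harr : ∀ b, b ≠ 11 → b ≠ 12 → σ₁.arr b = σ.arr b := by
      intro b hb hb'
      rw [hA.1 b (by simp [Prog.arrs_range, Prog.arrs, hb, hb']), State.put_arr_ne _ _ _ hb',
        State.put_arr_ne _ _ _ hb]
    have r8' : σ₁.reg 8 = d := by
      rw [hA.2 8 (by simp [Prog.regs_range, Prog.regs])]
      simp [r8]
    have hex : ∀ f : ℕ → ℕ, ∀ v, (∃ h < i + 1, PosTight ds dt d S D W h ∧ f h = v) ↔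
        (∃ h < i, PosTight ds dt d S D W h ∧ f h = v) ∨ (PosTight ds dt d S D W i ∧ f i = v) := by
      intro f v
      constructor
      · rintro ⟨h, hh, hp⟩
        rcases Nat.lt_succ_iff_lt_or_eq.1 hh with h' | rfl
        · exact .inl ⟨h, h', hp⟩
        · exact .inr hp
      · rintro (⟨h, hh, hp⟩ | hp)
        · exact ⟨h, by omega, hp⟩
        · exact ⟨i, by omega, hp⟩
    simp only [runs_ite, runs_seq, runs_put, runs_skip, Test.Holds, Expr.eval, hr, r8',
      harr 3 (by omega) (by omega), harr 4 (by omega) (by omega), harr 6 (by omega) (by omega),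
      harr 7 (by omega) (by omega), harr 8 (by omega) (by omega), a3, a4, a6, a7, a8,
      State.put_reg, State.put_arr_same, State.put_arr_ne _ _ _ (show 7 ≠ 12 by omega),
      State.put_arr_ne _ _ _ (show 11 ≠ 12 by omega), State.put_arr_ne _ _ _ (show 12 ≠ 11 by omega)]
    refine ⟨fun h => ⟨hS i hi, hB, hD i hi, hB, ⟨fun v => ?_, fun v => ?_⟩, by omega⟩,
      fun h => ⟨⟨fun v => ?_, fun v => ?_⟩, by omega⟩⟩
    · have hp : PosTight ds dt d S D W i := h
      rw [hex, Function.update_apply, ← or_assoc, ← h1 v]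
      simp only [hp, true_and, eq_comm (a := D i)]
      split_ifs with hv <;> simp [hv]
    · have hp : PosTight ds dt d S D W i := h
      rw [hex, Function.update_apply, ← or_assoc, ← h2 v]
      simp only [hp, true_and, eq_comm (a := S i)]
      split_ifs with hv <;> simp [hv]
    · have hp : ¬ PosTight ds dt d S D W i := h
      rw [hex, h1 v]
      simp [hp]
    · have hp : ¬ PosTight ds dt d S D W i := h
      rw [hex, h2 v]
      simp [hp]
  · rintro σ' k hA ⟨⟨h1, h2⟩, hk⟩
    exact ⟨h1, h2, by omega⟩

end Detour


/-! ### Tight half-edges, zero-length components and the vertex set of D -/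

namespace Detour

section

variable {n M : ℕ} {G : SimpleGraph (Fin n)} {w : Sym2 (Fin n) → ℕ} {s t : Fin n}
  {S D W ds dt : ℕ → ℕ}

/-- The vertices where the components of the edges of length `0` are entered. -/
def Entry (M : ℕ) (ds dt : ℕ → ℕ) (d : ℕ) (S D W : ℕ → ℕ) (a v : ℕ) : Prop :=
  v = a ∨ ∃ h < M, PosTight ds dt d S D W h ∧ D h = v

/-- The vertices where the components of the edges of length `0` are left. -/
def Leave (M : ℕ) (ds dt : ℕ → ℕ) (d : ℕ) (S D W : ℕ → ℕ) (z v : ℕ) : Prop :=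
  v = z ∨ ∃ h < M, PosTight ds dt d S D W h ∧ S h = v

theorem HalfEdges.code (H : HalfEdges G w M S D W) {h : ℕ} (hh : h < M) {x y : Fin n}
    (hx : S h = x + 1) (hy : D h = y + 1) : G.Adj x y ∧ W h = w s(x, y) := by
  obtain ⟨x', y', h1, h2, h3, h4⟩ := H.adj h hh
  obtain rfl : x' = x := Fin.ext (by omega)
  obtain rfl : y' = y := Fin.ext (by omega)
  exact ⟨h1, h4⟩

variable (hG : G.Connected) (H : HalfEdges G w M S D W) (hds : ∀ v : Fin n, ds v = wdist G w s v)
  (hdt : ∀ v : Fin n, dt v = wdist G w v t)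

include hG H hds hdt

/-- The tested equality is the extreme case of several triangle inequalities for d(s,t), so all of
them hold with equality. -/
theorem posTight_spec {h : ℕ} (hh : h < M) (hp : PosTight ds dt (wdist G w s t) S D W h)
    {x y : Fin n} (hx : S h = x + 1) (hy : D h = y + 1) :
    0 < w s(x, y) ∧ wdist G w s x + w s(x, y) = wdist G w s y ∧
      wdist G w s x + wdist G w x t = wdist G w s t ∧
      wdist G w s y + wdist G w y t = wdist G w s t := by
  obtain ⟨hadj, hW⟩ := H.code hh hx hy
  obtain ⟨h1, h2⟩ := hp
  rw [hx, hy, hW] at h1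
  simp only [Nat.add_sub_cancel, hds, hdt] at h1
  have h3 := wdist_step (w := w) (s := s) hG hadj
  have h4 := wdist_step' (w := w) (t := t) hG hadj
  have h5 := wdist_triangle (w := w) hG s x t
  have h6 := wdist_triangle (w := w) hG s y t
  omega

theorem leave_tight {x : Fin n}
    (h : Leave M ds dt (wdist G w s t) S D W (t + 1) (x + 1)) :
    wdist G w s x + wdist G w x t = wdist G w s t := by
  rcases h with h | ⟨h, hh, hp, hx⟩
  · obtain rfl : x = t := Fin.ext (by omega)
    rw [wdist_self, add_zero]
  · obtain ⟨a, b, -, ha, hb, -⟩ := H.adj h hh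
    exact (posTight_spec hG H hds hdt hh hp hx hb).2.2.1

omit hG in
theorem posTight_of {x y : Fin n} (hxy : G.Adj x y) (hw : 0 < w s(x, y))
    (h : wdist G w s x + w s(x, y) + wdist G w y t = wdist G w s t) :
    ∃ h < M, PosTight ds dt (wdist G w s t) S D W h ∧ S h = x + 1 ∧ D h = y + 1 := by
  obtain ⟨h', hh, h1, h2, h3⟩ := H.surj x y hxy
  refine ⟨h', hh, ⟨?_, by rwa [h3]⟩, h1, h2⟩
  rw [h1, h2, h3]
  simpa only [Nat.add_sub_cancel, hds, hdt] using h

omit hG in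
theorem zeroTight_of {x y : Fin n} (hxy : G.Adj x y) (hw : w s(x, y) = 0)
    (h : wdist G w s y + wdist G w y t = wdist G w s t) :
    ∃ h < M, ZeroTight ds dt (wdist G w s t) D W h ∧ S h = x + 1 ∧ D h = y + 1 := by
  obtain ⟨h', hh, h1, h2, h3⟩ := H.surj x y hxy
  refine ⟨h', hh, ⟨by rwa [h3], ?_⟩, h1, h2⟩
  rw [h2]
  simpa only [Nat.add_sub_cancel, hds, hdt] using h

/-- Follow a shortest path back towards s as long as the edges have length 0: the vertex reached is
s or the head of a tight positive edge. This supplies the entry that `low_root` needs in every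
component. -/
theorem exists_entry {x u : Fin n} (p : G.Walk x u) (hu : u = s)
    (hp : walkLength w p = wdist G w s x) (hx : wdist G w s x + wdist G w x t = wdist G w s t) :
    ∃ a, Entry M ds dt (wdist G w s t) S D W (s + 1) a ∧
      Relation.ReflTransGen (fun x y => ∃ h < M, ZeroTight ds dt (wdist G w s t) D W h ∧
        S h = x ∧ D h = y) (x + 1) a := by
  induction p with
  | nil =>
    subst hu
    exact ⟨_, .inl rfl, .refl⟩
  | @cons a b c h p ih =>
    subst hu
    rw [walkLength_cons] at hp
    have h1 := wdist_le (w := w) p.reverse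
    rw [walkLength_reverse] at h1
    have h2 := wdist_step (w := w) (s := c) hG h.symm
    have h3 := wdist_step' (w := w) (t := t) hG h.symm
    have h4 := wdist_triangle (w := w) hG c b t
    have hsw : s(b, a) = s(a, b) := Sym2.eq_swap
    rw [hsw] at h2 h3
    by_cases hw : w s(a, b) = 0
    · obtain ⟨e, he, hP, e1, e2⟩ := zeroTight_of H hds hdt h hw (by omega)
      obtain ⟨z, hz, hr⟩ := ih rfl (by omega) (by omega)
      exact ⟨z, hz, .head ⟨e, he, hP, e1, e2⟩ hr⟩
    · obtain ⟨e, he, hP, e1, e2⟩ := posTight_of H hds hdt h.symm (by rw [hsw]; omega)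
        (by rw [hsw]; omega)
      exact ⟨_, .inr ⟨e, he, hP, e2⟩, .refl⟩

variable {pre par ord root : ℕ → ℕ} {cnt : ℕ}
  (O : DfsOut n M S D (ZeroTight ds dt (wdist G w s t) D W)
    (Leave M ds dt (wdist G w s t) S D W (t + 1)) pre par ord root cnt)

include O

omit hG H hds hdt in
theorem vis_code {v : ℕ} (hv : 2 ≤ pre v) : ∃ x : Fin n, v = x + 1 := by
  have h0 := O.ne_zero hv
  have := O.pre_lt v h0 (by omega)
  exact ⟨⟨v - 1, by omega⟩, by simp only; omega⟩

theorem vis_tight {x : Fin n} (hv : 2 ≤ pre (x + 1)) :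
    wdist G w s x + wdist G w x t = wdist G w s t := by
  rcases O.tree _ hv with h | ⟨-, -, ⟨h, hh, h1, h2, h3, h4⟩, -⟩
  · exact leave_tight hG H hds hdt h.2.2
  · rw [h2] at h4
    simpa only [Nat.add_sub_cancel, hds, hdt] using h4

/-- On a shortest path to t, the zero-length edges after x lead to t or to the tail of a tight
positive edge, which is a root of the search; the search comes back along them. -/
theorem tight_vis {x u : Fin n} (p : G.Walk x u) (hu : u = t)
    (hp : walkLength w p = wdist G w x t) (hx : wdist G w s x + wdist G w x t = wdist G w s t) :
    2 ≤ pre (x + 1) := by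
  induction p with
  | nil =>
    subst hu
    exact O.roots _ (by omega) (by omega) (.inl rfl)
  | @cons a b c h p ih =>
    subst hu
    rw [walkLength_cons] at hp
    have h1 := wdist_le (w := w) p
    have h2 := wdist_step (w := w) (s := s) hG h
    have h3 := wdist_step' (w := w) (t := c) hG h
    have h4 := wdist_triangle (w := w) hG s b c
    have hsw : s(b, a) = s(a, b) := Sym2.eq_swap
    by_cases hw : w s(a, b) = 0
    · obtain ⟨e, he, hP, e1, e2⟩ := zeroTight_of H hds hdt h.symm (by rwa [hsw]) hx
      have h5 := ih rfl (by omega) (by omega)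
      rw [← e2]
      exact O.closed e he hP (by rwa [e1])
    · obtain ⟨e, he, hP, e1, e2⟩ := posTight_of H hds hdt h (by omega) (by omega)
      exact O.roots _ (by omega) (by omega) (.inr ⟨e, he, hP, e1⟩)

theorem vis_iff {x : Fin n} :
    2 ≤ pre (x + 1) ↔ wdist G w s x + wdist G w x t = wdist G w s t := by
  refine ⟨vis_tight hG H hds hdt O, fun h => ?_⟩
  obtain ⟨p, -, hp⟩ := exists_shortest hG w x t
  exact tight_vis hG H hds hdt O p rfl hp h

/-- `ZeroTight` constrains only the head. A visited source is tight as well, so the reverse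
half-edge qualifies. -/
theorem zero_symm {h : ℕ} (hh : h < M) (hP : ZeroTight ds dt (wdist G w s t) D W h)
    (hS : 2 ≤ pre (S h)) :
    ∃ h' < M, ZeroTight ds dt (wdist G w s t) D W h' ∧ S h' = D h ∧ D h' = S h := by
  obtain ⟨x, y, h1, h2, h3, h4⟩ := H.adj h hh
  rw [h2] at hS
  rw [h2, h3]
  exact zeroTight_of H hds hdt h1.symm (by rw [Sym2.eq_swap, ← h4]; exact hP.1)
    (vis_tight hG H hds hdt O hS)

theorem zeroTight_iff {h : ℕ} (hh : h < M) (hS : 2 ≤ pre (S h)) :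
    ZeroTight ds dt (wdist G w s t) D W h ↔ W h = 0 ∧ pre (D h) ≠ 0 := by
  constructor
  · intro hP
    have := O.closed h hh hP hS
    exact ⟨hP.1, by omega⟩
  · rintro ⟨h1, h2⟩
    obtain ⟨x, y, -, -, h4, -⟩ := H.adj h hh
    refine ⟨h1, ?_⟩
    have h5 := (O.pre_lt (D h) (by omega) h2).1
    rw [h4] at h5
    rw [h4]
    simpa only [Nat.add_sub_cancel, hds, hdt] using vis_tight hG H hds hdt O h5

omit hG H hds hdt in
theorem pre_lt_cnt (v : ℕ) : pre v < cnt := by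
  have h2 := O.two_le
  by_cases h : v = 0
  · rw [h, O.pre_zero]
    omega
  · by_cases h' : pre v = 0
    · omega
    · exact (O.pre_lt v h h').2.1

theorem connected_entry {v : ℕ} (hv : 2 ≤ pre v) :
    ∃ a, Entry M ds dt (wdist G w s t) S D W (s + 1) a ∧
      Relation.ReflTransGen (fun x y => ∃ h < M, ZeroTight ds dt (wdist G w s t) D W h ∧
        S h = x ∧ D h = y) v a := by
  obtain ⟨x, rfl⟩ := vis_code O hv
  obtain ⟨p, -, hp⟩ := exists_shortest hG w s x
  exact exists_entry hG H hds hdt p.reverse rfl (by rwa [walkLength_reverse])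
    (vis_tight hG H hds hdt O hv)

/-- A smaller neighbour in the order is a predecessor at the same distance from s. An entry other
than s is preceded by the tail of a tight positive edge, which is an exit and hence in D by `flag`.
Successors are symmetric. -/
theorem cert_of_stOrder {inD : ℕ → Prop} {pos : ℕ → ℕ}
    (X : StOrder M S D (ZeroTight ds dt (wdist G w s t) D W)
      (Entry M ds dt (wdist G w s t) S D W (s + 1)) (Leave M ds dt (wdist G w s t) S D W (t + 1))
      pre inD pos) :
    Cert G w s t (fun x => inD (x + 1)) fun x => pos (x + 1) := by
  have hvis : ∀ x : Fin n, _ := fun x => vis_iff hG H hds hdt O (x := x)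
  have hs : inD (s + 1) :=
    X.flag _ ((hvis s).2 (by rw [wdist_self, zero_add])) (.inl (.inl rfl))
  have ht : inD (t + 1) :=
    X.flag _ ((hvis t).2 (by rw [wdist_self, add_zero])) (.inr (.inl rfl))
  refine ⟨hs, ht, fun x hx => (hvis x).1 (X.vis _ hx), ?_, ?_, ?_, ?_⟩
  · intro u v hu hv h
    have := X.inj _ _ hu hv h
    exact Fin.ext (by omega)
  · intro v hv hvs
    rcases X.down _ hv with (h | ⟨h, hh, hp, hD⟩) | ⟨h, hh, hp, hS, hD, hlt⟩
    · exact absurd (Fin.ext (by omega)) hvs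
    · obtain ⟨x, y, h1, h2, h3, h4⟩ := H.adj h hh
      obtain rfl : y = v := Fin.ext (by omega)
      obtain ⟨h5, h6, h7, h8⟩ := posTight_spec hG H hds hdt hh hp h2 h3
      exact ⟨x, X.flag _ ((hvis x).2 h7) (.inr (.inr ⟨h, hh, hp, h2⟩)), h1, h6, .inl (by omega)⟩
    · obtain ⟨x, y, h1, h2, h3, h4⟩ := H.adj h hh
      obtain rfl : x = v := Fin.ext (by omega)
      rw [h3] at hD hlt
      have hw : w s(y, x) = 0 := by rw [Sym2.eq_swap, ← h4]; exact hp.1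
      have h5 := wdist_step (w := w) (s := s) hG h1
      have h6 := wdist_step (w := w) (s := s) hG h1.symm
      rw [Sym2.eq_swap] at h5
      exact ⟨y, hD, h1.symm, by omega, .inr ⟨by omega, hlt⟩⟩
  · intro v hv hvt
    rcases X.up _ hv with (h | ⟨h, hh, hp, hS⟩) | ⟨h, hh, hp, hS, hD, hlt⟩
    · exact absurd (Fin.ext (by omega)) hvt
    · obtain ⟨x, y, h1, h2, h3, h4⟩ := H.adj h hh
      obtain rfl : x = v := Fin.ext (by omega)
      obtain ⟨h5, h6, h7, h8⟩ := posTight_spec hG H hds hdt hh hp h2 h3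
      exact ⟨y, X.flag _ ((hvis y).2 h8) (.inl (.inr ⟨h, hh, hp, h3⟩)), h1, h6, .inl (by omega)⟩
    · obtain ⟨x, y, h1, h2, h3, h4⟩ := H.adj h hh
      obtain rfl : x = v := Fin.ext (by omega)
      rw [h3] at hD hlt
      have hw : w s(x, y) = 0 := by rw [← h4]; exact hp.1
      have h5 := wdist_step (w := w) (s := s) hG h1
      have h6 := wdist_step (w := w) (s := s) hG h1.symm
      rw [Sym2.eq_swap] at h6
      exact ⟨y, hD, h1, by omega, .inr ⟨by omega, hlt⟩⟩
  · intro p hp v hv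
    by_contra hvD
    obtain ⟨ht1, ht2⟩ := tight_of_shortest hG hp
    obtain ⟨K, q, hKv, hKq, hK, hKstep⟩ := X.sep _ ((hvis v).2 (ht2 v hv)) hvD
    have hKs : ¬ K (s + 1) := fun h => (hK _ h).2.1 (.inl rfl)
    have hKt : ¬ K (t + 1) := fun h => (hK _ h).2.2 (.inl rfl)
    -- c is the vertex with code q. If q codes no vertex, no step of the path leaves K, and any
    -- vertex outside K will do.
    obtain ⟨c, hKc, hc⟩ : ∃ c : Fin n, ¬ K (c + 1) ∧ ∀ y : Fin n, y + 1 = q → y = c := by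
      by_cases h : ∃ y : Fin n, y + 1 = q
      · obtain ⟨y, rfl⟩ := h
        exact ⟨y, hKq, fun z hz => Fin.ext (by omega)⟩
      · exact ⟨s, hKs, fun y hy => absurd ⟨y, hy⟩ h⟩
    classical
    have hstep : ∀ d ∈ p.darts, (K (d.fst + 1) → ¬ K (d.snd + 1) → d.snd = c) ∧
        (K (d.snd + 1) → ¬ K (d.fst + 1) → d.fst = c) := by
      intro d hd
      have h1 := ht1 d hd
      have h2 := ht2 d.fst (p.dart_fst_mem_support_of_mem_darts hd)
      have h3 := ht2 d.snd (p.dart_snd_mem_support_of_mem_darts hd)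
      have he : w d.edge = w s(d.fst, d.snd) := rfl
      rw [he] at h1
      have hsw : s(d.snd, d.fst) = s(d.fst, d.snd) := Sym2.eq_swap
      by_cases hw : w s(d.fst, d.snd) = 0
      · constructor
        · intro h4 h5
          obtain ⟨e, he, hP, e1, e2⟩ := zeroTight_of H hds hdt d.adj hw h3
          have := hKstep e he hP (by rwa [e1])
          rw [e2] at this
          exact hc _ (this.resolve_left h5)
        · intro h4 h5
          obtain ⟨e, he, hP, e1, e2⟩ := zeroTight_of H hds hdt d.adj.symm (by rwa [hsw]) h2
          have := hKstep e he hP (by rwa [e1])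
          rw [e2] at this
          exact hc _ (this.resolve_left h5)
      · obtain ⟨e, he, hP, e1, e2⟩ := posTight_of H hds hdt d.adj (by omega) (by omega)
        exact ⟨fun h4 _ => absurd (.inr ⟨e, he, hP, e1⟩) (hK _ h4).2.2,
          fun h4 _ => absurd (.inr ⟨e, he, hP, e2⟩) (hK _ h4).2.1⟩
    -- Collapsing K to the cut vertex c is a retraction that fixes s and t, so a simple path has all
    -- its edges outside K and misses v.
    have hedges := edges_subset_of_retraction (G := G) (ρ := fun x : Fin n => if K (x + 1) then c else x)
      (E := {e : Sym2 (Fin n) | ∀ x ∈ e, ¬ K (x + 1)}) p hp.1 (if_neg hKs) (if_neg hKt) ?_ ?_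
    · rw [SimpleGraph.Walk.mem_support_iff_exists_mem_edges] at hv
      rcases hv with rfl | ⟨e, he, hve⟩
      · exact hKt hKv
      · exact hedges e he v hve hKv
    · intro d hd hdE
      obtain ⟨h1, h2⟩ := hstep d hd
      by_cases h3 : K (d.fst + 1) <;> by_cases h4 : K (d.snd + 1)
      · simp only [if_pos h3, if_pos h4]
      · simp only [if_pos h3, h1 h3 h4, ite_self]
      · simp only [if_pos h4, h2 h4 h3, ite_self]
      · refine absurd (fun x hx => ?_) hdE
        have hx' : x ∈ s(d.fst, d.snd) := hx
        rcases Sym2.mem_iff.1 hx' with rfl | rfl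
        · exact h3
        · exact h4
    · intro d hd hdE
      have h3 : ¬ K (d.fst + 1) := hdE _ (Sym2.mem_mk_left d.fst d.snd)
      have h4 : ¬ K (d.snd + 1) := hdE _ (Sym2.mem_mk_right d.fst d.snd)
      exact ⟨if_neg h3, if_neg h4⟩

end

end Detour


namespace Detour

/-! ### Walks along pointers -/

section

variable {V : Type*} {G : SimpleGraph V} {w : Sym2 V → ℕ} {s t u v : V}

theorem wdist_comm (hG : G.Connected) (u v : V) : wdist G w u v = wdist G w v u := by
  suffices h : ∀ u v, wdist G w u v ≤ wdist G w v u from le_antisymm (h u v) (h v u)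
  intro u v
  obtain ⟨p, -, hp⟩ := exists_shortest hG w v u
  rw [← hp, ← walkLength_reverse]
  exact wdist_le _

/-- If every vertex outside `sink` has a smaller neighbour, then there are descending paths to
`sink`. -/
theorem exists_descent [Finite V] {α : Type*} [Preorder α] (rank : V → α) {A sink : V → Prop}
    {g : V → V → Prop}
    (h : ∀ v, A v → ¬ sink v → ∃ u, A u ∧ G.Adj v u ∧ g v u ∧ rank u < rank v) (v : V) (hv : A v) :
    ∃ c, sink c ∧ ∃ p : G.Walk v c, p.IsPath ∧
      (∀ d ∈ p.darts, g d.fst d.snd ∧ ¬ sink d.fst ∧ A d.fst ∧ A d.snd ∧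
        rank d.snd < rank d.fst) ∧
      ∀ z ∈ p.support, A z ∧ rank z ≤ rank v ∧ (sink z → z = c) := by
  have wf : WellFounded fun a b : V => rank a < rank b :=
    @Finite.wellFounded_of_trans_of_irrefl _ _ (fun a b : V => rank a < rank b)
      ⟨fun _ _ _ h h' => h.trans h'⟩ ⟨fun _ h => lt_irrefl _ h⟩
  induction v using wf.induction with
  | _ v ih =>
    by_cases hs : sink v
    · exact ⟨v, hs, .nil, .nil, by simp, by simpa using hv⟩
    · obtain ⟨u, hu, hadj, hg, hlt⟩ := h v hv hs
      obtain ⟨c, hc, p, hp, hd, hz⟩ := ih u hlt hu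
      refine ⟨c, hc, .cons hadj p, hp.cons fun h' => ?_, ?_, ?_⟩
      · exact lt_irrefl _ (hlt.trans_le (hz v h').2.1)
      · intro d hd'
        rw [SimpleGraph.Walk.darts_cons, List.mem_cons] at hd'
        rcases hd' with rfl | hd'
        · exact ⟨hg, hs, hv, hu, hlt⟩
        · exact hd d hd'
      · intro z hz'
        rw [SimpleGraph.Walk.support_cons, List.mem_cons] at hz'
        rcases hz' with rfl | hz'
        · exact ⟨hv, le_rfl, fun h' => absurd h' hs⟩
        · exact ⟨(hz z hz').1, (hz z hz').2.1.trans hlt.le, (hz z hz').2.2⟩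

theorem walkLength_add {e : V → ℕ} (p : G.Walk u v)
    (h : ∀ d ∈ p.darts, e d.snd + w s(d.fst, d.snd) = e d.fst) : walkLength w p + e v = e u := by
  induction p with
  | nil => simp
  | @cons a b c hab p ih =>
    have h1 := h ⟨(a, b), hab⟩ (by simp)
    have h2 := ih fun d hd => h d (by simp [hd])
    simp only at h1
    rw [walkLength_cons]
    omega

theorem isPath_append {x : V} {p : G.Walk u v} {q : G.Walk v x} (hp : p.IsPath) (hq : q.IsPath)
    (h : ∀ z ∈ p.support, z ∈ q.support → z = v) : (p.append q).IsPath := by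
  rw [SimpleGraph.Walk.isPath_def, SimpleGraph.Walk.support_append, List.nodup_append]
  have h1 := hq.support_nodup
  rw [← SimpleGraph.Walk.cons_tail_support, List.nodup_cons] at h1
  refine ⟨hp.support_nodup, h1.2, ?_⟩
  rintro a ha b hb rfl
  have := h a ha (List.mem_of_mem_tail hb)
  subst this
  exact h1.1 hb

end

section

variable {n : ℕ} {G : SimpleGraph (Fin n)} {w : Sym2 (Fin n) → ℕ} {s t c : Fin n}
  {inD : Fin n → Prop} {e : Fin n → ℕ} {r : Fin n → Fin n} {root par : ℕ → ℕ} {rank : Fin n → ℕ}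

/-- The trees rooted in `D` whose edges are tight for the potential `e`, as stored in arrays. -/
structure TreeSpec (G : SimpleGraph (Fin n)) (w : Sym2 (Fin n) → ℕ) (inD : Fin n → Prop)
    (e : Fin n → ℕ) (r : Fin n → Fin n) (root par : ℕ → ℕ) (rank : Fin n → ℕ) : Prop where
  root_eq : ∀ v : Fin n, root (v + 1) = r v + 1
  self : ∀ v, inD v → r v = v
  step : ∀ v, ¬ inD v → ∃ u, G.Adj u v ∧ e u + w s(u, v) = e v ∧ r u = r v ∧
    par (v + 1) = u + 1 ∧ rank u < rank v

theorem TreeSpec.rootSpec (T : TreeSpec G w inD e r root par rank) : RootSpec G w inD e r where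
  self := T.self
  step v hv := by
    obtain ⟨u, h1, h2, h3, -⟩ := T.step v hv
    exact ⟨u, h1, h2, h3⟩

theorem TreeSpec.inD_root (T : TreeSpec G w inD e r root par rank) (v : Fin n) : inD (r v) := by
  induction h : rank v using Nat.strong_induction_on generalizing v with
  | _ k ih =>
    by_cases hv : inD v
    · rwa [T.self v hv]
    · obtain ⟨u, -, -, h3, -, h5⟩ := T.step v hv
      rw [← h3]
      exact ih _ (h ▸ h5) u rfl

/-- The path that follows the pointers `par` to the root, and the pointers `g` in `D` from there
on. -/
theorem TreeSpec.exists_chain (T : TreeSpec G w inD e r root par rank) {α : Type*} [Preorder α]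
    {K : Fin n → α} {g : ℕ → ℕ} {e' : Fin n → ℕ}
    (hg : ∀ v, inD v → v ≠ c → ∃ u, inD u ∧ G.Adj v u ∧ g (v + 1) = u + 1 ∧
      e' u + w s(v, u) = e' v ∧ K u < K v) (v : Fin n) :
    ∃ p : G.Walk v c, p.IsPath ∧
      (∀ d ∈ p.darts, d.fst ≠ c ∧
        ((inD d.fst ∧ g (d.fst + 1) = d.snd + 1 ∧ K d.snd < K d.fst ∧ K d.fst ≤ K (r v)) ∨
        (¬ inD d.fst ∧ par (d.fst + 1) = d.snd + 1))) ∧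
      (inD c → K c ≤ K (r v)) ∧
      walkLength w p + e (r v) + e' c = e v + e' (r v) := by
  obtain ⟨b, hb, p, hp, hpd, hpz⟩ := exists_descent (G := G) rank (A := fun z => r z = r v)
    (sink := inD) (g := fun a b => par (a + 1) = b + 1 ∧ e b + w s(a, b) = e a) (by
      intro z hz hzD
      obtain ⟨u, h1, h2, h3, h4, h5⟩ := T.step z hzD
      exact ⟨u, h3.trans hz, h1.symm, ⟨h4, by rwa [Sym2.eq_swap]⟩, h5⟩) v rfl
  have hbv : b = r v := by
    rw [← T.self b hb]
    exact (hpz b p.end_mem_support).1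
  subst hbv
  obtain ⟨c', rfl, q, hq, hqd, hqz⟩ := exists_descent (G := G) K (A := inD) (sink := (· = c))
    (g := fun a b => g (a + 1) = b + 1 ∧ e' b + w s(a, b) = e' a) (by
      intro z hz hzc
      obtain ⟨u, h1, h2, h3, h4, h5⟩ := hg z hz hzc
      exact ⟨u, h1, h2, ⟨h3, h4⟩, h5⟩) (r v) hb
  refine ⟨p.append q, isPath_append hp hq fun z hz hz' => (hpz z hz).2.2 (hqz z hz').1, ?_, ?_, ?_⟩
  · intro d hd
    rw [SimpleGraph.Walk.darts_append, List.mem_append] at hd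
    rcases hd with hd | hd
    · have h1 := hpd d hd
      refine ⟨fun h => h1.2.1 ?_, .inr ⟨h1.2.1, h1.1.1⟩⟩
      rw [h]
      exact (hqz _ q.end_mem_support).1
    · have h1 := hqd d hd
      exact ⟨h1.2.1, .inl ⟨h1.2.2.1, h1.1.1, h1.2.2.2.2,
        (hqz _ (q.dart_fst_mem_support_of_mem_darts hd)).2.1⟩⟩
  · exact fun _ => (hqz _ q.end_mem_support).2.1
  · have h1 := walkLength_add (w := w) (e := e) p fun d hd => (hpd d hd).1.2
    have h2 := walkLength_add (w := w) (e := e') q fun d hd => (hqd d hd).1.2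
    rw [walkLength_append]
    omega

/-! ### Paths along the final pointers -/

/-- Every vertex with a pointer has a path along the pointers to `t`, of length at most `ℓ` and
with an edge outside `E` unless the vertex is in `Z`. -/
def Linked (G : SimpleGraph (Fin n)) (w : Sym2 (Fin n) → ℕ) (t : Fin n) (E : Set (Sym2 (Fin n)))
    (Z : Fin n → Prop) (nx : ℕ → ℕ) (ℓ : ℕ) : Prop :=
  ∀ z : Fin n, nx (z + 1) ≠ 0 → ∃ p : G.Walk z t, p.IsPath ∧
    (∀ d ∈ p.darts, nx (d.fst + 1) = d.snd + 1) ∧ (∀ u ∈ p.support, nx (u + 1) ≠ 0) ∧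
    walkLength w p ≤ ℓ ∧ (Z z ∨ ∃ e ∈ p.edges, e ∉ E)

variable {E : Set (Sym2 (Fin n))} {Z : Fin n → Prop} {nx : ℕ → ℕ} {ℓ : ℕ}

theorem Linked.mono (h : Linked G w t E Z nx ℓ) {ℓ' : ℕ} (hℓ : ℓ ≤ ℓ') :
    Linked G w t E Z nx ℓ' := by
  intro z hz
  obtain ⟨p, h1, h2, h3, h4, h5⟩ := h z hz
  exact ⟨p, h1, h2, h3, h4.trans hℓ, h5⟩

/-- The path from u enters v and continues along the pointers. It is simple because all vertices on
it have pointers and u had none. An edge outside E is the new one, or lies on the path of v when v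
is not in Z. -/
theorem Linked.update (h : Linked G w t E Z nx ℓ) {u v : Fin n} (hv : nx (v + 1) ≠ 0)
    (hadj : G.Adj u v) (hu : nx (u + 1) = 0) (huv : s(u, v) ∉ E ∨ ¬ Z v) :
    Linked G w t E Z (Function.update nx (u + 1) (v + 1)) (ℓ + w s(u, v)) := by
  have hne : ∀ z : Fin n, nx (z + 1) ≠ 0 →
      Function.update nx (u + 1) ((v : ℕ) + 1) (z + 1) = nx (z + 1) := by
    intro z hz
    rw [Function.update_of_ne]
    rintro h'
    rw [h'] at hz
    exact hz hu
  have hmark : ∀ z : Fin n, nx (z + 1) ≠ 0 → ∀ p : G.Walk z t,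
      (∀ d ∈ p.darts, nx (d.fst + 1) = d.snd + 1) → (∀ u ∈ p.support, nx (u + 1) ≠ 0) →
      (∀ d ∈ p.darts, Function.update nx (u + 1) ((v : ℕ) + 1) (d.fst + 1) = d.snd + 1) ∧
      (∀ x ∈ p.support, Function.update nx (u + 1) ((v : ℕ) + 1) (x + 1) ≠ 0) := by
    intro z _ p h2 h3
    refine ⟨fun d hd => ?_, fun x hx => ?_⟩
    · rw [hne _ (h3 _ (p.dart_fst_mem_support_of_mem_darts hd))]
      exact h2 d hd
    · rw [hne _ (h3 x hx)]
      exact h3 x hx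
  intro z hz
  by_cases hzu : z = u
  · subst hzu
    obtain ⟨p, h1, h2, h3, h4, h5⟩ := h v hv
    obtain ⟨h6, h7⟩ := hmark v hv p h2 h3
    refine ⟨.cons hadj p, h1.cons fun h' => h3 _ h' hu, ?_, ?_, ?_, .inr ?_⟩
    · intro d hd
      rw [SimpleGraph.Walk.darts_cons, List.mem_cons] at hd
      rcases hd with rfl | hd
      · simp
      · exact h6 d hd
    · intro x hx
      rw [SimpleGraph.Walk.support_cons, List.mem_cons] at hx
      rcases hx with rfl | hx
      · simp
      · exact h7 x hx
    · rw [walkLength_cons]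
      omega
    · rcases huv with h' | h'
      · exact ⟨_, by simp, h'⟩
      · obtain ⟨e, he, he'⟩ := h5.resolve_left h'
        exact ⟨e, by simp [he], he'⟩
  · have hz' : nx (z + 1) ≠ 0 := by
      rwa [Function.update_of_ne] at hz
      exact fun h' => hzu (Fin.ext (by omega))
    obtain ⟨p, h1, h2, h3, h4, h5⟩ := h z hz'
    obtain ⟨h6, h7⟩ := hmark z hz' p h2 h3
    exact ⟨p, h1, h6, h7, by omega, h5⟩

/-- The pointers along a single path to `t`. -/
theorem linked_of_path {y : Fin n} (p : G.Walk y t) (hp : p.IsPath)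
    (hd : ∀ d ∈ p.darts, nx (d.fst + 1) = d.snd + 1) (ht : nx (t + 1) ≠ 0)
    (hz : ∀ z : Fin n, nx (z + 1) ≠ 0 → z ∈ p.support) (hZ : Z t)
    (hE : ∀ d ∈ p.darts, Z d.fst ∨ d.edge ∉ E) : Linked G w t E Z nx (walkLength w p) := by
  intro z hz'
  obtain ⟨q, p', rfl⟩ := SimpleGraph.Walk.mem_support_iff_exists_append.1 (hz z hz')
  refine ⟨p', hp.of_append_right, fun d h => hd d (by simp [h]), ?_, by simp, ?_⟩
  · intro u hu
    by_cases hut : u = t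
    · rwa [hut]
    · obtain ⟨q₁, q₂, rfl⟩ := SimpleGraph.Walk.mem_support_iff_exists_append.1 hu
      cases q₂ with
      | nil => exact absurd rfl hut
      | @cons a b c h q₂ =>
        rw [hd ⟨(u, b), h⟩ (by simp)]
        omega
  · cases p' with
    | nil => exact .inl hZ
    | @cons a b c h p' =>
      rcases hE ⟨(z, b), h⟩ (by simp) with h1 | h1
      · exact .inl h1
      · exact .inr ⟨_, by simp, h1⟩

end

end Detour


namespace Detour

/-! ### Loops along walks -/

theorem runs_loop_true {B : ℕ} {b : Test} {c : Prog} {σ : State} {Q : State → ℕ → Prop}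
    (hb : b.Holds σ)
    (h : Runs B c σ fun σ₁ k₁ => Runs B (.loop b c) σ₁ fun σ₂ k₂ => Q σ₂ (k₁ + k₂ + 1)) :
    Runs B (.loop b c) σ Q := by
  obtain ⟨_, _, h₁, _, _, h₂, hq⟩ := h
  exact ⟨_, _, .loop_true hb h₁ h₂, hq⟩

theorem runs_loop_false {B : ℕ} {b : Test} {c : Prog} {σ : State} {Q : State → ℕ → Prop}
    (hb : ¬ b.Holds σ) (h : Q σ 1) : Runs B (.loop b c) σ Q :=
  ⟨_, _, .loop_false hb, h⟩

/-- A loop that moves along a walk. -/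
theorem Runs.walk {V : Type*} {G : SimpleGraph V} {x c : V} {B K : ℕ} {b : Test} {body : Prog}
    {σ : State} (I : ∀ u, G.Walk u c → State → Prop)
    (hb : ∀ u p σ₁, Agree body σ σ₁ → I u p σ₁ → (b.Holds σ₁ ↔ ¬ p.Nil))
    (hstep : ∀ u v (h : G.Adj u v) (p : G.Walk v c) σ₁, Agree body σ σ₁ → I u (.cons h p) σ₁ →
      Runs B body σ₁ fun σ₂ k => I v p σ₂ ∧ k ≤ K) (p : G.Walk x c) (h : I x p σ) :
    Runs B (.loop b body) σ fun σ' k => I c .nil σ' ∧ k ≤ (K + 1) * p.length + 1 := by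
  suffices H : ∀ u (p : G.Walk u c) σ₁, Agree body σ σ₁ → I u p σ₁ →
      Runs B (.loop b body) σ₁ fun σ' k => I c .nil σ' ∧ k ≤ (K + 1) * p.length + 1 from
    H x p σ (Agree.refl _ _) h
  clear h p
  intro u p
  induction p with
  | nil =>
    intro σ₁ hA hI
    exact runs_loop_false (by rw [hb _ _ _ hA hI]; simp) ⟨hI, by simp⟩
  | @cons a b' c hab p ih =>
    intro σ₁ hA hI
    refine runs_loop_true (by rw [hb _ _ _ hA hI]; simp) ?_
    refine (hstep _ _ hab p σ₁ hA hI).mono ?_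
    rintro σ₂ k hA₂ ⟨hI₂, hk⟩
    refine (ih I hb hstep σ₂ (hA.trans hA₂) hI₂).mono ?_
    rintro σ₃ k' - ⟨hI₃, hk'⟩
    refine ⟨hI₃, ?_⟩
    rw [SimpleGraph.Walk.length_cons, Nat.mul_add]
    omega

/-! ### The output -/

/-- The vertex `v` lies on a shortest path. -/
def onPath (v : Expr) : Test := .eq (.arr 16 (.arr 22 v)) (.lit 1)

/-- Set the pointers from the vertex in register `18` to `t`. -/
def forward (f : ℕ) : Prog :=
  .loop (.not (.eq (.reg 18) (.reg 6)))
    (.seq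
      (.ite (onPath (.reg 18)) (.put 19 (.reg 18) (.arr 18 (.reg 18)))
        (.put 19 (.reg 18) (.arr f (.reg 18))))
      (.set 18 (.arr 19 (.reg 18))))

/-- Set the pointers to the vertex in register `18` from `s`, unless they have been set. -/
def backward (f : ℕ) : Prog :=
  .loop (.not (.eq (.reg 18) (.reg 5)))
    (.seq
      (.ite (onPath (.reg 18)) (.set 19 (.arr 17 (.reg 18))) (.set 19 (.arr f (.reg 18))))
      (.seq (.ite (.eq (.arr 19 (.reg 19)) (.lit 0)) (.put 19 (.reg 19) (.reg 18)) .skip)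
        (.set 18 (.reg 19))))

/-- Write the vertices along the pointers from the vertex in register `18` to `t`. -/
def emit : Prog :=
  .loop (.not (.eq (.reg 18) (.reg 6)))
    (.seq (.put 5 (.reg 4) (.sub (.reg 18) (.lit 1)))
      (.seq (.set 4 (.add (.reg 4) (.lit 1))) (.set 18 (.arr 19 (.reg 18)))))

/-- Set the pointers from `s` to the vertex in register `x`, and write the vertices along them. -/
def deliver (x f : ℕ) : Prog :=
  .seq (.set 18 (.reg x))
    (.seq (backward f)
      (.seq (.set 18 (.reg 5))
        (.seq emit
          (.seq (.put 5 (.reg 4) (.sub (.reg 6) (.lit 1)))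
            (.set 4 (.add (.reg 4) (.lit 1)))))))

/-- Write a detour through the edge from the vertex in register `x` to the vertex in register
`y`. -/
def finalize (x y f f' : ℕ) : Prog :=
  .seq (.set 18 (.reg y))
    (.seq (forward f')
      (.seq (.put 19 (.reg 6) (.reg 6))
        (.seq (.ite (.eq (.arr 19 (.reg x)) (.lit 0)) (.put 19 (.reg x) (.reg y)) .skip)
          (deliver x f))))

section

variable {n B : ℕ} {G : SimpleGraph (Fin n)} {w : Sym2 (Fin n) → ℕ} {s t : Fin n}
  {inD : Fin n → Prop} {E : Set (Sym2 (Fin n))} {Z : Fin n → Prop} {σ : State}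

theorem ne_iff_not_nil {u c : Fin n} (p : G.Walk u c) (h : ∀ d ∈ p.darts, d.fst ≠ c) :
    ¬ (u : ℕ) + 1 = c + 1 ↔ ¬ p.Nil := by
  cases p with
  | nil => simp
  | cons hadj p =>
    have : u ≠ c := h ⟨(u, _), hadj⟩ (by simp)
    simpa [Fin.ext_iff] using this

theorem runs_forward {f : ℕ} (hf : f ≠ 19) (hn : n ≤ B) {y : Fin n} (p : G.Walk y t)
    (hin : ∀ v : Fin n, σ.arr 16 (σ.arr 22 (v + 1)) = 1 ↔ inD v)
    (hp : ∀ d ∈ p.darts, d.fst ≠ t ∧ ((inD d.fst ∧ σ.arr 18 (d.fst + 1) = d.snd + 1) ∨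
      (¬ inD d.fst ∧ σ.arr f (d.fst + 1) = d.snd + 1)))
    (h19 : ∀ i, σ.arr 19 i = 0) (r18 : σ.reg 18 = y + 1) (r6 : σ.reg 6 = t + 1) :
    Runs B (forward f) σ fun σ' k =>
      (∀ d ∈ p.darts, σ'.arr 19 (d.fst + 1) = d.snd + 1) ∧
      (∀ z : Fin n, σ'.arr 19 (z + 1) ≠ 0 → z ∈ p.support) ∧ k ≤ 4 * p.length + 1 := by
  refine (Runs.walk (K := 3) (fun (u : Fin n) (q : G.Walk u t) σ' => σ'.reg 18 = u + 1 ∧ q.support ⊆ p.support ∧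
    q.darts ⊆ p.darts ∧
    (∀ d ∈ p.darts, d ∈ q.darts ∨ σ'.arr 19 (d.fst + 1) = d.snd + 1) ∧
    ∀ z : Fin n, σ'.arr 19 (z + 1) ≠ 0 → z ∈ p.support) ?_ ?_ p ?_).mono ?_
  · rintro u q σ₁ hA ⟨h1, h2, h3, h4⟩
    have r6' : σ₁.reg 6 = t + 1 := by rw [hA.2 6 (by simp [Prog.regs]), r6]
    simp only [Test.Holds, Expr.eval, h1, r6']
    exact ne_iff_not_nil q fun d hd => (hp d (h3 hd)).1
  · rintro u v hadj q σ₁ hA ⟨h1, h2, h3, h4, h5⟩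
    have ha : ∀ a, a ≠ 19 → σ₁.arr a = σ.arr a := fun a ha =>
      hA.1 a (by simp [Prog.arrs, ha])
    have hv := v.2
    have hu := u.2
    have hstep := (hp ⟨(u, v), hadj⟩ (h3 (by simp))).2
    have hpost : ∀ σ₂ : State, σ₂.arr 19 = Function.update (σ₁.arr 19) (u + 1) (v + 1) →
        σ₂.reg 18 = v + 1 → σ₂.reg 18 = v + 1 ∧ q.support ⊆ p.support ∧ q.darts ⊆ p.darts ∧
        (∀ d ∈ p.darts, d ∈ q.darts ∨ σ₂.arr 19 (d.fst + 1) = d.snd + 1) ∧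
        ∀ z : Fin n, σ₂.arr 19 (z + 1) ≠ 0 → z ∈ p.support := by
      intro σ₂ e1 e2
      refine ⟨e2, fun z hz => h2 (by simp [hz]), fun d hd => h3 (by simp [hd]), ?_, ?_⟩
      · intro d hd
        rw [e1]
        -- The pointer prescribed for a step depends on its source only, so writing the cell of u
        -- suits every step of p that starts there.
        by_cases hdu : d.fst = u
        · right
          have hd' := (hp d hd).2
          rw [hdu] at hd' ⊢
          rw [Function.update_self]
          rcases hstep with ⟨h6, h7⟩ | ⟨h6, h7⟩
          · exact h7.symm.trans (hd'.resolve_right fun h => h.1 h6).2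
          · exact h7.symm.trans (hd'.resolve_left fun h => h6 h.1).2
        · rw [Function.update_of_ne (fun h => hdu (Fin.ext (by omega)))]
          rcases h4 d hd with h | h
          · rw [SimpleGraph.Walk.darts_cons, List.mem_cons] at h
            rcases h with rfl | h
            · exact absurd rfl hdu
            · exact .inl h
          · exact .inr h
      · intro z hz
        by_cases hzu : z = u
        · subst hzu
          exact h2 (by simp)
        · rw [e1, Function.update_of_ne (fun h => hzu (Fin.ext (by omega)))] at hz
          exact h5 z hz
    simp only [onPath, runs_seq, runs_ite, runs_put, runs_set, Test.Holds, Expr.eval, h1,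
      ha 16 (by omega), ha 18 (by omega), ha 22 (by omega), ha f hf, hin, State.put_reg,
      State.put_arr_same, Function.update_self]
    rcases hstep with ⟨h6, h7⟩ | ⟨h6, h7⟩
    · simp only [h7]
      refine ⟨fun _ => ⟨by omega, by omega, by omega, hpost _ ?_ ?_, le_rfl⟩,
        fun h => absurd h6 h⟩
      · simp [State.put_arr_same]
      · simp
    · simp only [h7]
      refine ⟨fun h => absurd h h6, fun _ => ⟨by omega, by omega, by omega, hpost _ ?_ ?_, le_rfl⟩⟩
      · simp [State.put_arr_same]
      · simp
  · exact ⟨r18, List.Subset.refl _, List.Subset.refl _, fun d hd => .inl hd,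
      fun z hz => absurd (h19 _) hz⟩
  · rintro σ' k hA ⟨⟨-, -, -, h4, h5⟩, hk⟩
    exact ⟨fun d hd => (h4 d hd).resolve_left (by simp), h5, hk⟩

/-- Keeping a pointer that is already set is what removes loops when the two branches meet. Since ℓ
bounds the paths of all linked vertices at once, that case merely weakens the bound. -/
theorem runs_backward {f ℓ : ℕ} (hf : f ≠ 19) (hn : n ≤ B) {x : Fin n} (p : G.Walk x s)
    (hin : ∀ v : Fin n, σ.arr 16 (σ.arr 22 (v + 1)) = 1 ↔ inD v)
    (hp : ∀ d ∈ p.darts, d.fst ≠ s ∧ ((inD d.fst ∧ σ.arr 17 (d.fst + 1) = d.snd + 1) ∨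
      (¬ inD d.fst ∧ σ.arr f (d.fst + 1) = d.snd + 1)))
    (hE : ∀ d ∈ p.darts, d.edge ∉ E ∨ ¬ Z d.fst)
    (h19 : Linked G w t E Z (σ.arr 19) ℓ) (hx : σ.arr 19 (x + 1) ≠ 0)
    (r18 : σ.reg 18 = x + 1) (r5 : σ.reg 5 = s + 1) :
    Runs B (backward f) σ fun σ' k => σ'.arr 19 (s + 1) ≠ 0 ∧
      Linked G w t E Z (σ'.arr 19) (ℓ + walkLength w p) ∧ k ≤ 6 * p.length + 1 := by
  refine (Runs.walk (K := 5) (fun (u : Fin n) (q : G.Walk u s) σ' => σ'.reg 18 = u + 1 ∧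
    q.darts ⊆ p.darts ∧ σ'.arr 19 (u + 1) ≠ 0 ∧ ∃ ℓ', Linked G w t E Z (σ'.arr 19) ℓ' ∧
      ℓ' + walkLength w q = ℓ + walkLength w p) ?_ ?_ p ?_).mono ?_
  · rintro u q σ₁ hA ⟨h1, h2, -⟩
    have r5' : σ₁.reg 5 = s + 1 := by rw [hA.2 5 (by simp [Prog.regs]), r5]
    simp only [Test.Holds, Expr.eval, h1, r5']
    exact ne_iff_not_nil q fun d hd => (hp d (h2 hd)).1
  · rintro u v hadj q σ₁ hA ⟨h1, h2, h3, ℓ', h4, h5⟩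
    have ha : ∀ a, a ≠ 19 → σ₁.arr a = σ.arr a := fun a ha =>
      hA.1 a (by simp [Prog.arrs, ha])
    have hv := v.2
    have hu := u.2
    have hmem : (⟨(u, v), hadj⟩ : G.Dart) ∈ p.darts := h2 (by simp)
    have hstep := (hp _ hmem).2
    have hE' := hE _ hmem
    rw [walkLength_cons] at h5
    have hsw : s(v, u) = s(u, v) := Sym2.eq_swap
    have hnew : σ₁.arr 19 (v + 1) = 0 →
        Linked G w t E Z (Function.update (σ₁.arr 19) (v + 1) (u + 1)) (ℓ' + w s(u, v)) := by
      intro h0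
      have := h4.update h3 hadj.symm h0 (by rw [hsw]; exact hE')
      rwa [hsw] at this
    have hold := h4.mono (show ℓ' ≤ ℓ' + w s(u, v) by omega)
    have hq : q.darts ⊆ p.darts := fun d hd => h2 (by simp [hd])
    simp only [onPath, runs_seq, runs_ite, runs_put, runs_set, runs_skip, Test.Holds, Expr.eval, h1,
      ha 16 (by omega), ha 17 (by omega), ha 22 (by omega), ha f hf, hin, State.put_reg,
      State.set_reg, State.set_arr, if_true, State.put_arr_same, Nat.reduceEqDiff, if_false]
    have hcases : ∀ {g : ℕ → ℕ}, g (u + 1) = v + 1 → g (u + 1) ≤ B := fun h => by omega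
    rcases hstep with ⟨h6, h7⟩ | ⟨h6, h7⟩
    · simp only [h7]
      refine ⟨fun _ => ⟨by omega, fun h0 => ⟨by omega, by omega, by omega, ⟨trivial, hq, ?_, _, hnew h0,
        by omega⟩, by omega⟩, fun h0 => ⟨by omega, ⟨trivial, hq, h0, _, hold, by omega⟩, by omega⟩⟩,
        fun h => absurd h6 h⟩
      simp
    · simp only [h7]
      refine ⟨fun h => absurd h h6, fun _ => ⟨by omega, fun h0 => ⟨by omega, by omega, by omega,
        ⟨trivial, hq, ?_, _, hnew h0, by omega⟩, by omega⟩,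
        fun h0 => ⟨by omega, ⟨trivial, hq, h0, _, hold, by omega⟩, by omega⟩⟩⟩
      simp
  · exact ⟨r18, List.Subset.refl _, hx, ℓ, h19, rfl⟩
  · rintro σ' k hA ⟨⟨-, -, h3, ℓ', h4, h5⟩, hk⟩
    simp only [walkLength_nil, add_zero] at h5
    exact ⟨h3, h5 ▸ h4, hk⟩

theorem runs_emit (hn : n ≤ B) {x : Fin n} (p : G.Walk x t) (hp : p.IsPath)
    (hnx : ∀ d ∈ p.darts, σ.arr 19 (d.fst + 1) = d.snd + 1)
    (r4 : σ.reg 4 = 0) (r18 : σ.reg 18 = x + 1) (r6 : σ.reg 6 = t + 1) :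
    Runs B emit σ fun σ' k =>
      (List.range (σ'.reg 4)).map (σ'.arr 5) ++ [(t : ℕ)] = p.support.map Fin.val ∧
      σ'.reg 4 + 1 ≤ n ∧ k ≤ 4 * p.length + 1 := by
  have hlen : p.support.length ≤ n := by
    have := hp.length_lt
    rw [Fintype.card_fin] at this
    rw [SimpleGraph.Walk.length_support]
    omega
  -- The vertices written and those still to come form the support of a simple path, so the output
  -- counter never exceeds n.
  have hcount : ∀ (u : Fin n) (q : G.Walk u t) (σ' : State),
      (List.range (σ'.reg 4)).map (σ'.arr 5) ++ q.support.map Fin.val = p.support.map Fin.val →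
      σ'.reg 4 + q.support.length ≤ n := by
    intro u q σ' h
    have := congrArg List.length h
    simp only [List.length_append, List.length_map, List.length_range] at this
    omega
  refine (Runs.walk (K := 3) (fun (u : Fin n) (q : G.Walk u t) σ' => σ'.reg 18 = u + 1 ∧
    q.darts ⊆ p.darts ∧ q.IsPath ∧
    (List.range (σ'.reg 4)).map (σ'.arr 5) ++ q.support.map Fin.val = p.support.map Fin.val)
    ?_ ?_ p ?_).mono ?_
  · rintro u q σ₁ hA ⟨h1, h2, h3, -⟩
    have r6' : σ₁.reg 6 = t + 1 := by rw [hA.2 6 (by simp [Prog.regs]), r6]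
    simp only [Test.Holds, Expr.eval, h1, r6']
    cases q with
    | nil => simp
    | cons hadj q =>
      have hu : u ≠ t := by
        rintro rfl
        exact ((SimpleGraph.Walk.cons_isPath_iff _ _).1 h3).2 q.end_mem_support
      simpa [Fin.ext_iff] using hu
  · rintro u v hadj q σ₁ hA ⟨h1, h2, h3, h4⟩
    have hcnt := hcount _ _ _ h4
    have a19 : σ₁.arr 19 = σ.arr 19 := hA.1 19 (by simp [Prog.arrs])
    have hu := u.2
    have hv := v.2
    have hst : σ.arr 19 (u + 1) = v + 1 := hnx ⟨(u, v), hadj⟩ (h2 (by simp))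
    rw [SimpleGraph.Walk.support_cons, List.length_cons] at hcnt
    simp only [runs_seq, runs_put, runs_set, Expr.eval, h1, State.put_reg, State.set_reg,
      State.set_arr, State.put_arr_ne _ _ _ (show 19 ≠ 5 by omega), a19, hst, if_true, if_false,
      State.put_arr_same, Nat.reduceEqDiff, Nat.add_sub_cancel]
    refine ⟨by omega, by omega, by omega, by omega, ⟨trivial, fun d hd => h2 (by simp [hd]),
      ((SimpleGraph.Walk.cons_isPath_iff _ _).1 h3).1, ?_⟩, le_rfl⟩
    rw [← h4, List.range_succ, List.map_append, SimpleGraph.Walk.support_cons, List.map_cons]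
    have : (List.range (σ₁.reg 4)).map (Function.update (σ₁.arr 5) (σ₁.reg 4) (u : ℕ)) =
        (List.range (σ₁.reg 4)).map (σ₁.arr 5) := by
      refine List.map_congr_left fun i hi => ?_
      rw [Function.update_of_ne (List.mem_range.1 hi).ne]
    rw [this]
    simp
  · exact ⟨r18, List.Subset.refl _, hp, by simp [r4]⟩
  · rintro σ' k hA ⟨⟨-, -, -, h4⟩, hk⟩
    have := hcount _ _ _ h4
    simp only [SimpleGraph.Walk.support_nil, List.length_singleton] at this
    simp only [SimpleGraph.Walk.support_nil, List.map_cons, List.map_nil] at h4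
    exact ⟨h4, this, hk⟩

/-- Pointers are set on the path from b to t, then on the edge ab, then from a back to s. The
pointer path from s is simple by construction, and s being outside Z forces an edge outside E. -/
theorem runs_finalize {x y f f' : ℕ} {a b : Fin n} (hf : 20 ≤ f) (hf' : 20 ≤ f') (hx : x < 18)
    (hy : y < 18) (hn : n ≤ B) (hab : G.Adj a b) (habE : s(a, b) ∉ E)
    (hin : ∀ v : Fin n, σ.arr 16 (σ.arr 22 (v + 1)) = 1 ↔ inD v)
    (p : G.Walk a s) (hpp : p.IsPath)
    (hp : ∀ d ∈ p.darts, d.fst ≠ s ∧ ((inD d.fst ∧ σ.arr 17 (d.fst + 1) = d.snd + 1) ∨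
      (¬ inD d.fst ∧ σ.arr f (d.fst + 1) = d.snd + 1)))
    (hpE : ∀ d ∈ p.darts, d.edge ∉ E ∨ ¬ Z d.fst)
    (q : G.Walk b t) (hqp : q.IsPath)
    (hq : ∀ d ∈ q.darts, d.fst ≠ t ∧ ((inD d.fst ∧ σ.arr 18 (d.fst + 1) = d.snd + 1) ∨
      (¬ inD d.fst ∧ σ.arr f' (d.fst + 1) = d.snd + 1)))
    (hqE : ∀ d ∈ q.darts, Z d.fst ∨ d.edge ∉ E) (hs : ¬ Z s) (ht : Z t)
    (h19 : ∀ i, σ.arr 19 i = 0) (rx : σ.reg x = a + 1) (ry : σ.reg y = b + 1)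
    (r4 : σ.reg 4 = 0) (r5 : σ.reg 5 = s + 1) (r6 : σ.reg 6 = t + 1) :
    Runs B (finalize x y f f') σ fun σ' k =>
      (∃ r : G.Walk s t, r.IsPath ∧ (∃ e ∈ r.edges, e ∉ E) ∧
        walkLength w r ≤ walkLength w p + w s(a, b) + walkLength w q ∧
        σ'.output = r.support.map Fin.val) ∧ k ≤ 14 * n + 11 := by
  have ha := a.2
  have hb := b.2
  have hs' := s.2
  have ht' := t.2
  have lp := hpp.length_lt
  have lq := hqp.length_lt
  rw [Fintype.card_fin] at lp lq
  simp only [finalize, runs_seq, runs_set, Expr.eval, ry]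
  refine ⟨by omega, ?_⟩
  refine (runs_forward (f := f') (inD := inD) (by omega) hn q (by simpa using hin)
    (by simpa using hq) (by simpa using h19) (by simp) (by simpa using r6)).mono ?_
  rintro σ₁ k₁ hA₁ ⟨h1, h2, hk₁⟩
  have hr1 : ∀ z, z ≠ 18 → σ₁.reg z = σ.reg z := fun z hz => by
    rw [hA₁.2 z (by simp [forward, Prog.regs, hz]), State.set_reg, if_neg hz]
  have ha1 : ∀ z, z ≠ 19 → σ₁.arr z = σ.arr z := fun z hz => by
    rw [hA₁.1 z (by simp [forward, Prog.arrs, hz]), State.set_arr]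
  simp only [runs_put, Expr.eval, hr1 6 (by omega), r6]
  refine ⟨by omega, by omega, ?_⟩
  -- The pointer from t to itself only marks t as linked; all loops stop at t and never follow it.
  have hL := linked_of_path (G := G) (w := w) (E := E) (Z := Z)
    (nx := Function.update (σ₁.arr 19) (t + 1) (t + 1)) q hqp (fun d hd => by
      rw [Function.update_of_ne fun h => (hq d hd).1 (Fin.ext (by omega))]
      exact h1 d hd) (by simp) (fun z hz => by
      by_cases hzt : z = t
      · rw [hzt]
        exact q.end_mem_support
      · rw [Function.update_of_ne fun h => hzt (Fin.ext (by omega))] at hz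
        exact h2 z hz) ht hqE
  have hmb : Function.update (σ₁.arr 19) ((t : ℕ) + 1) ((t : ℕ) + 1) (b + 1) ≠ 0 := by
    by_cases hbt : b = t
    · simp [hbt]
    · rw [Function.update_of_ne fun h => hbt (Fin.ext (by omega))]
      cases q with
      | nil => exact absurd rfl hbt
      | cons hadj q =>
        rw [h1 ⟨(b, _), hadj⟩ (by simp)]
        omega
  set nx := Function.update (σ₁.arr 19) ((t : ℕ) + 1) ((t : ℕ) + 1) with hnx
  have hcont : ∀ (σ₂ : State) (k₂ : ℕ), k₂ ≤ 2 → (∀ z, z ≠ 18 → σ₂.reg z = σ.reg z) →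
      (∀ z, z ≠ 19 → σ₂.arr z = σ.arr z) → σ₂.arr 19 (a + 1) ≠ 0 →
      Linked G w t E Z (σ₂.arr 19) (walkLength w q + w s(a, b)) →
      Runs B (deliver x f) σ₂ fun σ' k =>
        (∃ r : G.Walk s t, r.IsPath ∧ (∃ e ∈ r.edges, e ∉ E) ∧
          walkLength w r ≤ walkLength w p + w s(a, b) + walkLength w q ∧
          σ'.output = r.support.map Fin.val) ∧ 1 + (k₁ + (1 + (k₂ + k))) ≤ 14 * n + 11 := by
    intro σ₂ k₂ hk₂ hr2 ha2 hma hL2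
    simp only [deliver, runs_seq, runs_set, Expr.eval, hr2 x (by omega), rx]
    refine ⟨by omega, ?_⟩
    refine (runs_backward (f := f) (inD := inD) (w := w) (t := t) (E := E) (Z := Z)
      (ℓ := walkLength w q + w s(a, b)) (by omega) hn p ?_ ?_ hpE (by simpa only [State.set_arr] using hL2)
      (by simpa only [State.set_arr] using hma) (by simp) ?_).mono ?_
    · simpa only [State.set_arr, ha2 16 (by omega), ha2 22 (by omega)] using hin
    · simpa only [State.set_arr, ha2 17 (by omega), ha2 f (by omega)] using hp
    · rw [State.set_reg, if_neg (by omega), hr2 5 (by omega), r5]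
    rintro σ₃ k₃ hA₃ ⟨h3, h4, hk₃⟩
    have hr3 : ∀ z, z ≠ 18 → z ≠ 19 → σ₃.reg z = σ.reg z := fun z hz hz' => by
      rw [hA₃.2 z (by simp [backward, Prog.regs, hz, hz']), State.set_reg, if_neg hz, hr2 z hz]
    simp only [hr3 5 (by omega) (by omega), r5]
    obtain ⟨r, h5, h6, -, h7, h8⟩ := h4 s h3
    refine ⟨by omega, ?_⟩
    refine (runs_emit hn r h5 (by simpa using h6) ?_ (by simp) ?_).mono ?_
    · rw [State.set_reg, if_neg (by omega), hr3 4 (by omega) (by omega), r4]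
    · rw [State.set_reg, if_neg (by omega), hr3 6 (by omega) (by omega), r6]
    rintro σ₄ k₄ hA₄ ⟨h9, h10, hk₄⟩
    have r6' : σ₄.reg 6 = t + 1 := by
      rw [hA₄.2 6 (by simp [emit, Prog.regs]), State.set_reg, if_neg (by omega),
        hr3 6 (by omega) (by omega), r6]
    have lr := h5.length_lt
    rw [Fintype.card_fin] at lr
    simp only [runs_put, Expr.eval, r6', State.put_reg, Nat.add_sub_cancel]
    refine ⟨by omega, by omega, by omega, ⟨r, h5, h8.resolve_left hs, by omega, ?_⟩, by omega⟩
    rw [← h9, State.output]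
    simp only [State.set_reg, State.set_arr, State.put_arr_same, if_true, List.range_succ,
      List.map_append, List.map_cons, List.map_nil, Function.update_self]
    congr 1
    refine List.map_congr_left fun i hi => ?_
    rw [Function.update_of_ne (List.mem_range.1 hi).ne]
  simp only [runs_ite, runs_put, runs_skip, Test.Holds, Expr.eval, State.put_reg,
    hr1 x (by omega), hr1 y (by omega), rx, ry, State.put_arr_same, ← hnx]
  constructor
  · intro h0
    refine ⟨by omega, by omega, ?_⟩
    have hL' := hL.update hmb hab h0 (.inl habE)
    refine (hcont _ 2 le_rfl ?_ ?_ ?_ ?_).mono ?_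
    · intro z hz
      simpa using hr1 z hz
    · intro z hz
      rw [State.put_arr_ne _ _ _ hz, State.put_arr_ne _ _ _ hz, ha1 z hz]
    · simp [State.put_arr_same]
    · simpa only [State.put_arr_same] using hL'
    · rintro σ' k - h
      exact h
  · intro h0
    refine (hcont _ 2 le_rfl ?_ ?_ ?_ ?_).mono ?_
    · intro z hz
      simpa using hr1 z hz
    · intro z hz
      rw [State.put_arr_ne _ _ _ hz, ha1 z hz]
    · simpa only [State.put_arr_same] using h0
    · rw [State.put_arr_same]
      exact hL.mono (by omega)
    · rintro σ' k - h
      exact h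

end

end Detour


/-! ### Predecessors, tight forests, the best candidate and the detour through it -/

namespace Detour

/-- The memory after the vertices on shortest paths have been determined and ordered. -/
structure Ordered {n : ℕ} (G : SimpleGraph (Fin n)) (w : Sym2 (Fin n) → ℕ) (s t : Fin n) (M : ℕ)
    (S D W : ℕ → ℕ) (inD : Fin n → Prop) (pos : Fin n → ℕ) (σ : State) : Prop where
  base : Base G w s t M S D W σ
  mark : ∀ v : Fin n, σ.arr 16 (σ.arr 22 (v + 1)) = 1 ↔ inD v
  place : ∀ v : Fin n, σ.arr 15 (σ.arr 22 (v + 1)) = pos v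

/-- `u v` is a step along a shortest path, in the order of the vertices. -/
def Step {V : Type*} (G : SimpleGraph V) (w : Sym2 V → ℕ) (s : V) (inD : V → Prop) (pos : V → ℕ)
    (u v : V) : Prop :=
  inD u ∧ inD v ∧ G.Adj u v ∧ wdist G w s u + w s(u, v) = wdist G w s v ∧
    key G w s pos u < key G w s pos v

/-- Arrays `17, 18`: the predecessors and the successors on shortest paths. -/
def predSucc : Prog :=
  .range 10 (.reg 7)
    (.ite
      (.and (onPath (.arr 6 (.reg 10)))
        (.and (onPath (.arr 7 (.reg 10)))
          (.and
            (.eq (.add (.arr 3 (.sub (.arr 6 (.reg 10)) (.lit 1))) (.arr 8 (.reg 10)))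
              (.arr 3 (.sub (.arr 7 (.reg 10)) (.lit 1))))
            (.not
              (.and (.not (.lt (.lit 0) (.arr 8 (.reg 10))))
                (.not
                  (.lt (.arr 15 (.arr 22 (.arr 6 (.reg 10))))
                    (.arr 15 (.arr 22 (.arr 7 (.reg 10)))))))))))
      (.seq (.put 17 (.arr 7 (.reg 10)) (.arr 6 (.reg 10)))
        (.put 18 (.arr 6 (.reg 10)) (.arr 7 (.reg 10))))
      .skip)

/-- Depth-first search from the vertices on shortest paths, along the half-edges that are tight for
the potential in array `e`. -/
def trees (b e : ℕ) : Prog :=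
  dfs b (onPath (.reg 11))
    (.and
      (.eq (.add (.arr e (.sub (.reg 11) (.lit 1))) (.arr 8 (.reg 12)))
        (.arr e (.sub (.reg 13) (.lit 1))))
      (.not (onPath (.reg 13))))

/-- Registers `16, 17`: the ends of a best half-edge between different trees, or `0`. -/
def search : Prog :=
  .seq (.set 16 (.lit 0))
    (.range 10 (.reg 7)
      (.ite
        (.and
          (.and
            (.not
              (.and (onPath (.arr 6 (.reg 10)))
                (.and (onPath (.arr 7 (.reg 10)))
                  (.not
                    (.and
                      (.not
                        (.eq (.add (.arr 3 (.sub (.arr 6 (.reg 10)) (.lit 1))) (.arr 8 (.reg 10)))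
                          (.arr 3 (.sub (.arr 7 (.reg 10)) (.lit 1)))))
                      (.not
                        (.eq (.add (.arr 3 (.sub (.arr 7 (.reg 10)) (.lit 1))) (.arr 8 (.reg 10)))
                          (.arr 3 (.sub (.arr 6 (.reg 10)) (.lit 1))))))))))
            (.not (.eq (.arr 35 (.arr 6 (.reg 10))) (.arr 45 (.arr 7 (.reg 10))))))
          (.not
            (.and (.not (.eq (.reg 16) (.lit 0)))
              (.not
                (.lt
                  (.add (.add (.arr 3 (.sub (.arr 6 (.reg 10)) (.lit 1))) (.arr 8 (.reg 10)))
                    (.arr 4 (.sub (.arr 7 (.reg 10)) (.lit 1))))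
                  (.reg 15))))))
        (.seq
          (.set 15
            (.add (.add (.arr 3 (.sub (.arr 6 (.reg 10)) (.lit 1))) (.arr 8 (.reg 10)))
              (.arr 4 (.sub (.arr 7 (.reg 10)) (.lit 1)))))
          (.seq (.set 16 (.arr 6 (.reg 10))) (.set 17 (.arr 7 (.reg 10)))))
        .skip))

/-- Write a detour through the edge between the vertices in registers `16` and `17`. -/
def answer : Prog :=
  .ite
    (.not
      (.and
        (.not
          (.lt (.arr 3 (.sub (.arr 35 (.reg 16)) (.lit 1)))
            (.arr 3 (.sub (.arr 45 (.reg 17)) (.lit 1)))))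
        (.not
          (.and
            (.eq (.arr 3 (.sub (.arr 35 (.reg 16)) (.lit 1)))
              (.arr 3 (.sub (.arr 45 (.reg 17)) (.lit 1))))
            (.lt (.arr 15 (.arr 22 (.arr 35 (.reg 16))))
              (.arr 15 (.arr 22 (.arr 45 (.reg 17)))))))))
    (finalize 16 17 33 43) (finalize 17 16 43 33)

section

variable {n M B : ℕ} {G : SimpleGraph (Fin n)} {w : Sym2 (Fin n) → ℕ} {s t : Fin n}
  {S D W : ℕ → ℕ} {inD : Fin n → Prop} {pos : Fin n → ℕ} {σ : State}

theorem Ordered.agree {σ' : State} (b : Ordered G w s t M S D W inD pos σ)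
    (ha : ∀ a < 23, a ≠ 5 → a ≠ 17 → a ≠ 18 → a ≠ 19 → σ'.arr a = σ.arr a)
    (hr : ∀ x < 9, σ'.reg x = σ.reg x) : Ordered G w s t M S D W inD pos σ' where
  base := b.base.agree
    (fun a h h' => ha a (by omega) h' (by omega) (by omega) (by omega)) hr
  mark v := by
    rw [ha 16 (by omega) (by omega) (by omega) (by omega) (by omega),
      ha 22 (by omega) (by omega) (by omega) (by omega) (by omega)]
    exact b.mark v
  place v := by
    rw [ha 15 (by omega) (by omega) (by omega) (by omega) (by omega),
      ha 22 (by omega) (by omega) (by omega) (by omega) (by omega)]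
    exact b.place v

theorem runs_predSucc (hM : M ≤ B) (hn : n ≤ B) (H : HalfEdges G w M S D W)
    (C : Cert G w s t inD pos) (b : Ordered G w s t M S D W inD pos σ)
    (h17 : ∀ i, σ.arr 17 i = 0) (h18 : ∀ i, σ.arr 18 i = 0) :
    Runs B predSucc σ fun σ' k =>
      (∀ v : Fin n, inD v → v ≠ s → ∃ u : Fin n, σ'.arr 17 (v + 1) = u + 1 ∧
        Step G w s inD pos u v) ∧
      (∀ v : Fin n, inD v → v ≠ t → ∃ u : Fin n, σ'.arr 18 (v + 1) = u + 1 ∧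
        Step G w s inD pos v u) ∧ k ≤ 5 * M + 2 := by
  refine (Runs.range_const (N := M) (K := 3)
    (fun i σ' =>
      (∀ v : Fin n, σ'.arr 17 (v + 1) ≠ 0 → ∃ u : Fin n, σ'.arr 17 (v + 1) = u + 1 ∧
        Step G w s inD pos u v) ∧
      (∀ v : Fin n, σ'.arr 18 (v + 1) ≠ 0 → ∃ u : Fin n, σ'.arr 18 (v + 1) = u + 1 ∧
        Step G w s inD pos v u) ∧
      ∀ h < i, ∀ x y : Fin n, S h = x + 1 → D h = y + 1 → Step G w s inD pos x y →
        σ'.arr 17 (y + 1) ≠ 0 ∧ σ'.arr 18 (x + 1) ≠ 0) hM (by simp [Prog.regs]) ?_ ?_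
    (fun i σ' k h => h) ?_).mono ?_
  · intro σ' hA
    simp [Expr.eval, hA.2 7 (by simp [Prog.regs_range, Prog.regs]), b.base.reg7]
  · exact ⟨fun v h => absurd (h17 _) h, fun v h => absurd (h18 _) h, fun h hh => by omega⟩
  · rintro i hi σ₁ hA hr ⟨h1, h2, h3⟩
    have b₁ : Ordered G w s t M S D W inD pos σ₁ := b.agree
      (fun a _ _ h h' _ => hA.1 a (by simp [Prog.arrs_range, Prog.arrs, h, h']))
      (fun x hx => hA.2 x (by simp [Prog.regs_range, Prog.regs]; omega))
    obtain ⟨x, y, hadj, e1, e2, e3⟩ := H.adj i hi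
    have hx := x.2
    have hy := y.2
    -- Tests lack disjunction, so "positive length or smaller position" is written with negations.
    -- For a tight edge it is the lexicographic comparison of keys.
    have hiff : (inD x ∧ inD y ∧ wdist G w s x + w s(x, y) = wdist G w s y ∧
        ¬ (¬ 0 < w s(x, y) ∧ ¬ pos x < pos y)) ↔ Step G w s inD pos x y := by
      rw [Step, key_lt]
      constructor
      · rintro ⟨h4, h5, h6, h7⟩
        exact ⟨h4, h5, hadj, h6, by omega⟩
      · rintro ⟨h4, h5, -, h6, h7⟩
        exact ⟨h4, h5, h6, by omega⟩
    simp only [runs_ite, runs_seq, runs_put, runs_skip, onPath, Test.Holds, Expr.eval, hr,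
      b₁.base.arr6, b₁.base.arr7, b₁.base.arr8, e1, e2, e3, Nat.add_sub_cancel, b₁.base.arr3,
      b₁.mark, b₁.place, hiff, State.put_arr_ne _ _ _ (show 6 ≠ 17 by omega),
      State.put_arr_ne _ _ _ (show 7 ≠ 17 by omega), State.put_arr_ne _ _ _ (show 17 ≠ 18 by omega),
      State.put_arr_ne _ _ _ (show 18 ≠ 17 by omega), State.put_arr_same, State.put_reg]
    constructor
    · intro hst
      refine ⟨by omega, by omega, by omega, by omega, ⟨fun v hv => ?_, fun v hv => ?_,
        fun h hh x' y' e1' e2' hst' => ?_⟩, by omega⟩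
      · by_cases hvy : v = y
        · subst hvy
          exact ⟨x, by simp, hst⟩
        · rw [Function.update_of_ne fun h => hvy (Fin.ext (by omega))] at hv ⊢
          exact h1 v hv
      · by_cases hvx : v = x
        · subst hvx
          exact ⟨y, by simp, hst⟩
        · rw [Function.update_of_ne fun h => hvx (Fin.ext (by omega))] at hv ⊢
          exact h2 v hv
      · rcases Nat.lt_succ_iff_lt_or_eq.1 hh with hh | rfl
        · obtain ⟨h4, h5⟩ := h3 h hh x' y' e1' e2' hst'
          constructor
          · rw [Function.update_apply]
            split_ifs
            · omega
            · exact h4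
          · rw [Function.update_apply]
            split_ifs
            · omega
            · exact h5
        · rw [← e2', ← e1', e1, e2]
          simp
    · intro hst
      refine ⟨⟨h1, h2, fun h hh x' y' e1' e2' hst' => ?_⟩, by omega⟩
      rcases Nat.lt_succ_iff_lt_or_eq.1 hh with hh | rfl
      · exact h3 h hh x' y' e1' e2' hst'
      · obtain rfl : x = x' := Fin.ext (by omega)
        obtain rfl : y = y' := Fin.ext (by omega)
        exact absurd hst' hst
  · rintro σ' k hA ⟨⟨h1, h2, h3⟩, hk⟩
    refine ⟨fun v hv hvs => ?_, fun v hv hvt => ?_, hk⟩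
    · obtain ⟨u, hu, hadj, hd, hlt⟩ := C.pred v hv hvs
      obtain ⟨h, hh, e1, e2, -⟩ := H.surj u v hadj
      exact h1 v (h3 h hh u v e1 e2 ⟨hu, hv, hadj, hd, key_lt.2 hlt⟩).1
    · obtain ⟨u, hu, hadj, hd, hlt⟩ := C.succ v hv hvt
      obtain ⟨h, hh, e1, e2, -⟩ := H.surj v u hadj
      exact h2 v (h3 h hh v u e1 e2 ⟨hv, hu, hadj, hd, key_lt.2 hlt⟩).2

/-- Tree edges never lead into D, so the roots are exactly the vertices of D. Every vertex is
visited: going back along a shortest path to c, each vertex is in D or is reached by a tight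
half-edge from its successor. -/
theorem treeSpec_of_dfsOut {P R : ℕ → Prop} {pre par ord root : ℕ → ℕ} {cnt : ℕ} {c : Fin n}
    (hG : G.Connected) (H : HalfEdges G w M S D W) (O : DfsOut n M S D P R pre par ord root cnt)
    (hP : ∀ h < M, ∀ x y : Fin n, S h = x + 1 → D h = y + 1 →
      (P h ↔ wdist G w x c + w s(x, y) = wdist G w y c ∧ ¬ inD y))
    (hR : ∀ x : Fin n, R (x + 1) ↔ inD x) (hc : inD c) :
    ∃ r, TreeSpec G w inD (fun v => wdist G w v c) r root par fun v => pre (v + 1) := by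
  have hvis : ∀ (x u : Fin n) (p : G.Walk x u), u = c → walkLength w p = wdist G w x c →
      2 ≤ pre (x + 1) := by
    intro x u p hu hp
    induction p with
    | nil =>
      subst hu
      exact O.roots _ (by omega) (by omega) ((hR _).2 hc)
    | @cons a b c' hab p ih =>
      subst hu
      rw [walkLength_cons] at hp
      have h1 := wdist_le (w := w) p
      have h2 := wdist_step' (w := w) (t := c') hG hab
      have h3 := ih rfl (by omega)
      by_cases ha : inD a
      · exact O.roots _ (by omega) (by omega) ((hR _).2 ha)
      · obtain ⟨h, hh, e1, e2, -⟩ := H.surj b a hab.symm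
        have h4 := O.closed h hh ((hP h hh b a e1 e2).2 ⟨by rw [Sym2.eq_swap]; omega, ha⟩)
          (by rwa [e1])
        rwa [e2] at h4
  have hvis : ∀ x : Fin n, 2 ≤ pre (x + 1) := fun x => by
    obtain ⟨p, -, hp⟩ := exists_shortest hG w x c
    exact hvis x c p rfl hp
  have hcases : ∀ v : Fin n, (root (v + 1) = v + 1 ∧ inD v) ∨ ∃ u : Fin n, G.Adj u v ∧
      wdist G w u c + w s(u, v) = wdist G w v c ∧ ¬ inD v ∧ par (v + 1) = u + 1 ∧
      root (v + 1) = root (u + 1) ∧ pre (u + 1) < pre (v + 1) := by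
    intro v
    rcases O.tree _ (hvis v) with ⟨-, h1, h2⟩ | ⟨-, h2, ⟨h, hh, e1, e2, hPh⟩, h4⟩
    · exact .inl ⟨h1, (hR v).1 h2⟩
    · obtain ⟨x, y, hadj, e3, e4, -⟩ := H.adj h hh
      obtain rfl : y = v := Fin.ext (by omega)
      have hpar : par (y + 1) = x + 1 := by omega
      rw [hpar] at h2 h4
      obtain ⟨h5, h6⟩ := (hP h hh x y e3 e4).1 hPh
      exact .inr ⟨x, hadj, h5, h6, hpar, h4, h2⟩
  have hroot : ∀ v : Fin n, ∃ z : Fin n, root (v + 1) = z + 1 := by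
    intro v
    induction h : pre ((v : ℕ) + 1) using Nat.strong_induction_on generalizing v with
    | _ k ih =>
      rcases hcases v with h1 | ⟨u, -, -, -, -, h5, h6⟩
      · exact ⟨v, h1.1⟩
      · rw [h5]
        exact ih _ (h ▸ h6) u rfl
  choose r hr using hroot
  refine ⟨r, hr, fun v hv => ?_, fun v hv => ?_⟩
  · rcases hcases v with h1 | ⟨u, -, -, h4, -⟩
    · have := hr v
      exact Fin.ext (by omega)
    · exact absurd hv h4
  · rcases hcases v with h1 | ⟨u, h1, h2, h3, h4, h5, h6⟩
    · exact absurd h1.2 hv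
    · rw [hr, hr] at h5
      exact ⟨u, h1, h2, Fin.ext (by omega), h4, h6⟩

theorem runs_trees {b e : ℕ} {c : Fin n} (hb : 30 ≤ b) (he : e < 5) (hM : M + 1 ≤ B)
    (hn : n + 2 ≤ B) (hG : G.Connected) (H : HalfEdges G w M S D W)
    (o : Ordered G w s t M S D W inD pos σ) (hc : inD c)
    (hae : ∀ v : Fin n, σ.arr e v = wdist G w v c)
    (h0 : ∀ j < 7, ∀ i, σ.arr (b + j) i = 0) :
    Runs B (trees b e) σ fun σ' k =>
      (∃ r rank, TreeSpec G w inD (fun v => wdist G w v c) r (σ'.arr (b + 5)) (σ'.arr (b + 3))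
        rank) ∧ k ≤ 18 * (M + n) + 6 := by
  refine (runs_dfs (n := n) (M := M) (S := S) (D := D)
    (P := fun h => σ.arr e (S h - 1) + W h = σ.arr e (D h - 1) ∧
      ¬ σ.arr 16 (σ.arr 22 (D h)) = 1) (R := fun v => σ.arr 16 (σ.arr 22 v) = 1)
    (by omega) hM hn o.base.reg0 o.base.reg7 o.base.arr6 o.base.arr7 ?_ ?_ h0 ?_ ?_).mono ?_
  · intro h hh
    obtain ⟨x, y, -, e1, -⟩ := H.adj h hh
    omega
  · intro h hh
    obtain ⟨x, y, -, -, e1, -⟩ := H.adj h hh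
    omega
  · intro σ' ha hr
    simp only [onPath, Test.Holds, Expr.eval, ha 16 (by omega), ha 22 (by omega)]
  · intro σ' ha hr h12 h11 h13
    simp only [onPath, Test.Holds, Expr.eval, ha 16 (by omega), ha 22 (by omega), ha 8 (by omega),
      ha e (by omega), h11, h13, o.base.arr8]
  · rintro σ' k hA ⟨O, hk⟩
    obtain ⟨r, hr⟩ := treeSpec_of_dfsOut (w := w) (inD := inD) (c := c) hG H O (fun h hh x y e1 e2 => by
      obtain ⟨x', y', hadj, e3, e4, e5⟩ := H.adj h hh
      obtain rfl : x = x' := Fin.ext (by omega)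
      obtain rfl : y = y' := Fin.ext (by omega)
      simp only [e1, e2, e5, Nat.add_sub_cancel, hae, o.mark]) o.mark hc
    exact ⟨⟨r, _, hr⟩, hk⟩

theorem runs_search {r r' : Fin n → Fin n} (hM : M ≤ B) (hn : n ≤ B) (hG : G.Connected)
    (H : HalfEdges G w M S D W) (C : Cert G w s t inD pos) (o : Ordered G w s t M S D W inD pos σ)
    (h35 : ∀ v : Fin n, σ.arr 35 (v + 1) = r v + 1)
    (h45 : ∀ v : Fin n, σ.arr 45 (v + 1) = r' v + 1)
    (hf : ∀ x y, G.Adj x y → wdist G w s x + w s(x, y) + wdist G w y t ≤ B) :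
    Runs B search σ fun σ' k =>
      ((σ'.reg 16 = 0 ∧ ∀ x y, ¬ Cand G w s t r r' x y) ∨
      ∃ x y : Fin n, σ'.reg 16 = x + 1 ∧ σ'.reg 17 = y + 1 ∧ Cand G w s t r r' x y ∧
        ∀ x' y', Cand G w s t r r' x' y' → wdist G w s x + w s(x, y) + wdist G w y t ≤
          wdist G w s x' + w s(x', y') + wdist G w y' t) ∧ k ≤ 6 * M + 3 := by
  rw [search, runs_seq, runs_set]
  refine ⟨Nat.zero_le _, ?_⟩
  refine (Runs.range_const (N := M) (K := 4)
    (fun i σ' =>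
      ((σ'.reg 16 = 0 ∧ ∀ h < i, ∀ x y : Fin n, S h = x + 1 → D h = y + 1 →
        ¬ Cand G w s t r r' x y) ∨
      ∃ x y : Fin n, σ'.reg 16 = x + 1 ∧ σ'.reg 17 = y + 1 ∧ Cand G w s t r r' x y ∧
        σ'.reg 15 = wdist G w s x + w s(x, y) + wdist G w y t ∧
        ∀ h < i, ∀ x' y' : Fin n, S h = x' + 1 → D h = y' + 1 → Cand G w s t r r' x' y' →
          σ'.reg 15 ≤ wdist G w s x' + w s(x', y') + wdist G w y' t)) hM (by simp [Prog.regs]) ?_ ?_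
    (fun i σ' k h => by simpa using h) ?_).mono ?_
  · intro σ' hA
    simp [Expr.eval, hA.2 7 (by simp [Prog.regs_range, Prog.regs]), o.base.reg7]
  · exact .inl ⟨by simp [Expr.eval], fun h hh => by omega⟩
  · rintro i hi σ₁ hA hr hI
    have o₁ : Ordered G w s t M S D W inD pos σ₁ := o.agree
      (fun a _ _ _ _ _ => by
        rw [hA.1 a (by simp [Prog.arrs_range, Prog.arrs]), State.set_arr])
      (fun x hx => by
        rw [hA.2 x (by simp [Prog.regs_range, Prog.regs]; omega), State.set_reg,
          if_neg (by omega)])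
    have harr : σ₁.arr = σ.arr := by
      funext a
      rw [hA.1 a (by simp [Prog.arrs_range, Prog.arrs]), State.set_arr]
    obtain ⟨x, y, hadj, e1, e2, e3⟩ := H.adj i hi
    have hx := x.2
    have hy := y.2
    have hsw : s(x, y) = s(y, x) := Sym2.eq_swap
    -- The program decides whether the edge belongs to D by the criterion of
    -- `Cert.mem_shortestEdges`.
    have hiff : (¬ (inD x ∧ inD y ∧ ¬ (¬ wdist G w s x + w s(x, y) = wdist G w s y ∧
        ¬ wdist G w s y + w s(x, y) = wdist G w s x)) ∧ ¬ (r x : ℕ) = r' y) ↔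
        Cand G w s t r r' x y := by
      rw [Cand, C.mem_shortestEdges hG hadj, ne_eq, Fin.ext_iff]
      simp only [hadj, true_and, not_and_or, not_or, not_not]
    have hcode : ∀ x' y' : Fin n, S i = x' + 1 → D i = y' + 1 → x' = x ∧ y' = y := by
      intro x' y' h h'
      exact ⟨Fin.ext (by omega), Fin.ext (by omega)⟩
    have hle := hf x y hadj
    simp only [runs_ite, runs_seq, runs_set, runs_skip, onPath, Test.Holds, Expr.eval, hr,
      o₁.base.arr6, o₁.base.arr7, o₁.base.arr8, e1, e2, e3, Nat.add_sub_cancel, o₁.base.arr3,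
      o₁.base.arr4, o.mark, harr, h35, h45, hiff, State.set_reg, State.set_arr, Nat.reduceEqDiff,
      if_true, if_false]
    constructor
    · rintro ⟨hc, hb⟩
      refine ⟨by omega, by omega, by omega, .inr ⟨x, y, rfl, rfl, hc, rfl,
        fun h hh x' y' e1' e2' hc' => ?_⟩, by omega⟩
      rcases Nat.lt_succ_iff_lt_or_eq.1 hh with hh | rfl
      · rcases hI with ⟨-, hI⟩ | ⟨a, b, h1, h2, h3, h4, h5⟩
        · exact absurd hc' (hI h hh x' y' e1' e2')
        · have := h5 h hh x' y' e1' e2' hc'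
          omega
      · obtain ⟨rfl, rfl⟩ := hcode x' y' e1' e2'
        exact le_rfl
    · intro hc
      refine ⟨?_, by omega⟩
      rcases hI with ⟨h0, hI⟩ | ⟨a, b, h1, h2, h3, h4, h5⟩
      · refine .inl ⟨h0, fun h hh x' y' e1' e2' hc' => ?_⟩
        rcases Nat.lt_succ_iff_lt_or_eq.1 hh with hh | rfl
        · exact hI h hh x' y' e1' e2' hc'
        · obtain ⟨rfl, rfl⟩ := hcode x' y' e1' e2'
          exact hc ⟨hc', fun h => h.1 h0⟩
      · refine .inr ⟨a, b, h1, h2, h3, h4, fun h hh x' y' e1' e2' hc' => ?_⟩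
        rcases Nat.lt_succ_iff_lt_or_eq.1 hh with hh | rfl
        · exact h5 h hh x' y' e1' e2' hc'
        · obtain ⟨rfl, rfl⟩ := hcode x' y' e1' e2'
          by_contra hlt
          exact hc ⟨hc', fun h => h.2 (by omega)⟩
  · rintro σ' k hA ⟨hI, hk⟩
    refine ⟨?_, by omega⟩
    rcases hI with ⟨h0, hI⟩ | ⟨a, b, h1, h2, h3, h4, h5⟩
    · refine .inl ⟨h0, fun x y hc => ?_⟩
      obtain ⟨h, hh, e1, e2, -⟩ := H.surj x y hc.1
      exact hI h hh x y e1 e2 hc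
    · refine .inr ⟨a, b, h1, h2, h3, fun x y hc => ?_⟩
      obtain ⟨h, hh, e1, e2, -⟩ := H.surj x y hc.1
      rw [← h4]
      exact h5 h hh x y e1 e2 hc

/-- The pointers that are used by the last phase. -/
structure Pointers {n : ℕ} (G : SimpleGraph (Fin n)) (w : Sym2 (Fin n) → ℕ) (s t : Fin n)
    (inD : Fin n → Prop) (pos : Fin n → ℕ) (r r' : Fin n → Fin n) (σ : State) : Prop where
  pred : ∀ v : Fin n, inD v → v ≠ s → ∃ u : Fin n, σ.arr 17 (v + 1) = u + 1 ∧
    Step G w s inD pos u v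
  succ : ∀ v : Fin n, inD v → v ≠ t → ∃ u : Fin n, σ.arr 18 (v + 1) = u + 1 ∧
    Step G w s inD pos v u
  tree : ∃ rank, TreeSpec G w inD (fun v => wdist G w v s) r (σ.arr 35) (σ.arr 33) rank
  tree' : ∃ rank, TreeSpec G w inD (fun v => wdist G w v t) r' (σ.arr 45) (σ.arr 43) rank

theorem Pointers.treeData {r r' : Fin n → Fin n} (P : Pointers G w s t inD pos r r' σ)
    (hG : G.Connected) (C : Cert G w s t inD pos) : TreeData G w s t inD r r' where
  source := C.source
  target := C.target
  mem u v h := by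
    obtain ⟨p, hp, he⟩ := h
    exact ⟨C.supp p hp u (p.fst_mem_support_of_mem_edges he),
      C.supp p hp v (p.snd_mem_support_of_mem_edges he)⟩
  root := by
    obtain ⟨rank, T⟩ := P.tree
    simp only [wdist_comm hG s]
    exact T.rootSpec
  root' := by
    obtain ⟨rank, T⟩ := P.tree'
    exact T.rootSpec

/-- Stated for general potentials c and c' so that it covers both orientations of a candidate edge.
The portion of a chain inside its tree has length d(a, c) − d(r₁ a, c); the inequality is arranged
to avoid subtraction. -/
theorem runs_finalize_chains {x y f f' : ℕ} {a b : Fin n} {c c' : Fin n} {r₁ r₂ : Fin n → Fin n}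
    {root₁ root₂ : ℕ → ℕ} {rank₁ rank₂ : Fin n → ℕ} (hf : 20 ≤ f) (hf' : 20 ≤ f')
    (hx : x < 18) (hy : y < 18) (hn : n ≤ B) (C : Cert G w s t inD pos)
    (o : Ordered G w s t M S D W inD pos σ) {r r' : Fin n → Fin n}
    (P : Pointers G w s t inD pos r r' σ) (h19 : ∀ i, σ.arr 19 i = 0)
    (T₁ : TreeSpec G w inD (fun v => wdist G w v c) r₁ root₁ (σ.arr f) rank₁)
    (T₂ : TreeSpec G w inD (fun v => wdist G w v c') r₂ root₂ (σ.arr f') rank₂)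
    (hab : G.Adj a b) (habE : s(a, b) ∉ shortestEdges G w s t)
    (hlt : key G w s pos (r₁ a) < key G w s pos (r₂ b))
    (rx : σ.reg x = a + 1) (ry : σ.reg y = b + 1) :
    Runs B (finalize x y f f') σ fun σ' k =>
      (∃ p : G.Walk s t, IsDetour w p ∧
        walkLength w p + wdist G w (r₁ a) c + wdist G w (r₂ b) c' ≤
          wdist G w a c + wdist G w s (r₁ a) + w s(a, b) +
            (wdist G w b c' + wdist G w (r₂ b) t) ∧
        σ'.output = p.support.map Fin.val) ∧ k ≤ 14 * n + 11 := by
  obtain ⟨p, hp, hpd, hps, hpl⟩ := T₁.exists_chain (c := s) (K := key G w s pos) (g := σ.arr 17)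
    (e' := fun v => wdist G w s v) (by
      intro v hv hvs
      obtain ⟨u, h1, h2, h3, h4, h5, h6⟩ := P.pred v hv hvs
      exact ⟨u, h2, h4.symm, h1, by rw [Sym2.eq_swap]; exact h5, h6⟩) a
  obtain ⟨q, hq, hqd, hqt, hql⟩ := T₂.exists_chain (c := t)
    (K := fun v => OrderDual.toDual (key G w s pos v)) (g := σ.arr 18)
    (e' := fun v => wdist G w v t) (by
      intro v hv hvt
      obtain ⟨u, h1, h2, h3, h4, h5, h6⟩ := P.succ v hv hvt
      have h7 := C.tight v hv
      have h8 := C.tight u h3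
      exact ⟨u, h3, h4, h1, by omega, h6⟩) b
  simp only [wdist_self, add_zero] at hpl hql
  have hD : ∀ d : G.Dart, ¬ inD d.fst → d.edge ∉ shortestEdges G w s t := by
    intro d hd he
    obtain ⟨p', hp', he'⟩ := he
    exact hd (C.supp p' hp' d.fst (p'.fst_mem_support_of_mem_edges he'))
  -- Z consists of the vertices of D from r₂ b onwards. It contains the D-part of the way to t and t
  -- itself, and it misses the D-part of the way from s, whose keys are at most that of r₁ a.
  refine (runs_finalize (w := w) (s := s) (t := t) (E := shortestEdges G w s t) (inD := inD)
    (Z := fun z => inD z ∧ key G w s pos (r₂ b) ≤ key G w s pos z) hf hf' hx hy hn hab habE o.mark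
    p hp ?_ ?_ q hq ?_ ?_ ?_ ?_ h19 rx ry o.base.reg4 o.base.reg5 o.base.reg6).mono ?_
  · intro d hd
    obtain ⟨h1, h2⟩ := hpd d hd
    exact ⟨h1, h2.imp (fun h => ⟨h.1, h.2.1⟩) id⟩
  · intro d hd
    rcases (hpd d hd).2 with h | h
    · exact .inr fun h' => absurd (hlt.trans_le (h'.2.trans h.2.2.2)) (lt_irrefl _)
    · exact .inl (hD d h.1)
  · intro d hd
    obtain ⟨h1, h2⟩ := hqd d hd
    exact ⟨h1, h2.imp (fun h => ⟨h.1, h.2.1⟩) id⟩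
  · intro d hd
    rcases (hqd d hd).2 with h | h
    · exact .inl ⟨h.1, h.2.2.2⟩
    · exact .inr (hD d h.1)
  · exact fun h => absurd (hlt.trans_le (h.2.trans (hps C.source))) (lt_irrefl _)
  · exact ⟨C.target, hqt C.target⟩
  · rintro σ' k - ⟨⟨p', h1, h2, h3, h4⟩, hk⟩
    exact ⟨⟨p', ⟨h1, h2⟩, by omega, h4⟩, hk⟩

theorem runs_answer {x y : Fin n} {r r' : Fin n → Fin n} (hn : n ≤ B) (hG : G.Connected)
    (C : Cert G w s t inD pos) (o : Ordered G w s t M S D W inD pos σ)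
    (P : Pointers G w s t inD pos r r' σ) (h19 : ∀ i, σ.arr 19 i = 0)
    (hxy : Cand G w s t r r' x y) (rx : σ.reg 16 = x + 1) (ry : σ.reg 17 = y + 1) :
    Runs B answer σ fun σ' k =>
      (∃ p : G.Walk s t, IsDetour w p ∧
        walkLength w p ≤ wdist G w s x + w s(x, y) + wdist G w y t ∧
        σ'.output = p.support.map Fin.val) ∧ k ≤ 14 * n + 12 := by
  obtain ⟨rank, T⟩ := P.tree
  obtain ⟨rank', T'⟩ := P.tree'
  have hx := T.inD_root x
  have hy := T'.inD_root y
  have hx' := C.tight _ hx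
  have hy' := C.tight _ hy
  have hkey : ¬ (¬ wdist G w s (r x) < wdist G w s (r' y) ∧
      ¬ (wdist G w s (r x) = wdist G w s (r' y) ∧ pos (r x) < pos (r' y))) ↔
      key G w s pos (r x) < key G w s pos (r' y) := by
    rw [key_lt]
    omega
  simp only [answer, runs_ite, Test.Holds, Expr.eval, rx, ry, T.root_eq, T'.root_eq,
    Nat.add_sub_cancel, o.base.arr3, o.place, hkey]
  constructor
  · intro hlt
    refine (runs_finalize_chains (by omega) (by omega) (by omega) (by omega) hn C o P h19 T T'
      hxy.1 hxy.2.1 hlt rx ry).mono ?_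
    rintro σ' k - ⟨⟨p, h1, h2, h3⟩, hk⟩
    rw [wdist_comm hG (r x) s, wdist_comm hG x s] at h2
    exact ⟨⟨p, h1, by omega, h3⟩, by omega⟩
  · intro hlt
    have hlt' : key G w s pos (r' y) < key G w s pos (r x) :=
      lt_of_le_of_ne (not_lt.1 hlt) fun h => hxy.2.2 (C.key_inj hx hy h.symm)
    have hsw : s(y, x) = s(x, y) := Sym2.eq_swap
    refine (runs_finalize_chains (by omega) (by omega) (by omega) (by omega) hn C o P h19 T' T
      hxy.1.symm (by rw [hsw]; exact hxy.2.1) hlt' ry rx).mono ?_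
    rintro σ' k - ⟨⟨p, h1, h2, h3⟩, hk⟩
    -- Now d_s(r' y) ≤ d_s(r x), and tightness in D gives d_t(r x) ≤ d_t(r' y). So crossing the edge
    -- from y to x costs no more than the candidate.
    have h4 := key_lt.1 hlt'
    rw [wdist_comm hG (r x) s, wdist_comm hG x s, hsw] at h2
    exact ⟨⟨p, h1, by omega, h3⟩, by omega⟩

end

end Detour


namespace Detour

/-! ### The program -/

/-- Determine and order the vertices on shortest paths. -/
def order : Prog :=
  .seq setup
    (.seq flags
      (.seq
        (dfs 20 (.eq (.arr 12 (.reg 11)) (.lit 1))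
          (.and (.eq (.arr 8 (.reg 12)) (.lit 0))
            (.eq
              (.add (.arr 3 (.sub (.reg 13) (.lit 1))) (.arr 4 (.sub (.reg 13) (.lit 1))))
              (.reg 8))))
        (.seq lowEdges (.seq lowUp layout))))

/-- Find an edge for a shortest detour. -/
def find : Prog :=
  .seq order (.seq predSucc (.seq (trees 30 3) (.seq (trees 40 4) search)))

/-- Find a shortest detour. -/
def solve : Prog :=
  .seq find (.ite (.eq (.reg 16) (.lit 0)) .skip answer)

theorem Exec.mono {B B' : ℕ} (hB : B ≤ B') {c : Prog} {σ σ' : State} {k : ℕ}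
    (h : Exec B c σ k σ') : Exec B' c σ k σ' := by
  induction h with
  | skip σ => exact .skip σ
  | set σ x e he => exact .set σ x e (he.trans hB)
  | put σ a i e hi he => exact .put σ a i e (hi.trans hB) (he.trans hB)
  | seq _ _ ih₁ ih₂ => exact .seq ih₁ ih₂
  | ite_true hb _ ih => exact .ite_true hb ih
  | ite_false hb _ ih => exact .ite_false hb ih
  | loop_true hb _ _ ih₁ ih₂ => exact .loop_true hb ih₁ ih₂
  | loop_false hb => exact .loop_false hb

section

variable {n m : ℕ} {G : SimpleGraph (Fin n)} {w : Sym2 (Fin n) → ℕ} {s t : Fin n}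
  {src dst : Fin m → Fin n} {B : ℕ}

theorem runs_order (hG : G.Connected) (hE : IsEdgeList G src dst)
    (hB : InputBound G w s t src dst B) :
    Runs (6 * B) order (inputState G w s t src dst) fun σ' k =>
      (∃ S D W inD pos, HalfEdges G w (2 * m) S D W ∧ Cert G w s t inD pos ∧
        Ordered G w s t (2 * m) S D W inD pos σ') ∧
      (∀ a, 17 ≤ a → a < 20 ∨ 27 ≤ a → ∀ i, σ'.arr a i = 0) ∧ k ≤ 62 * m + 43 * n + 36 := by
  have hs := s.2
  have hn := hB.1
  have hm := hB.2.1
  have ht := t.2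
  rw [order, runs_seq]
  refine (runs_setup hE hB).mono ?_
  rintro σ₁ k₁ hA₁ ⟨⟨S, D, W, H, b₁⟩, hk₁⟩
  have hz₁ : ∀ a, 9 ≤ a → ∀ i, σ₁.arr a i = 0 := by
    intro a ha i
    rw [hA₁.1 a (by simp only [arrs_setup, List.mem_cons, List.not_mem_nil, or_false]; omega)]
    obtain ⟨a, rfl⟩ : ∃ a', a = a' + 5 := ⟨a - 5, by omega⟩
    rfl
  have hS : ∀ h < 2 * m, 1 ≤ S h ∧ S h ≤ n := by
    intro h hh
    obtain ⟨x, y, -, e1, -⟩ := H.adj h hh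
    omega
  have hD : ∀ h < 2 * m, 1 ≤ D h ∧ D h ≤ n := by
    intro h hh
    obtain ⟨x, y, -, -, e1, -⟩ := H.adj h hh
    omega
  rw [runs_seq]
  refine (runs_flags (M := 2 * m) (d := wdist G w s t) (a := s + 1) (z := t + 1) (S := S) (D := D)
    (W := W) (ds := σ₁.arr 3) (dt := σ₁.arr 4) (by omega)
    (fun h hh => by have := hS h hh; omega) (fun h hh => by have := hD h hh; omega)
    (by omega) (by omega) (by omega) b₁.reg5 b₁.reg6 b₁.reg7 b₁.reg8 rfl rfl b₁.arr6 b₁.arr7 b₁.arr8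
    (hz₁ 11 (by omega)) (hz₁ 12 (by omega))).mono ?_
  rintro σ₂ k₂ hA₂ ⟨hF, hF', hk₂⟩
  have ha₂ : ∀ a, a ≠ 11 → a ≠ 12 → σ₂.arr a = σ₁.arr a := fun a h h' =>
    hA₂.1 a (by simp only [arrs_flags, List.mem_cons, List.not_mem_nil, or_false]; omega)
  have b₂ : Base G w s t (2 * m) S D W σ₂ := b₁.agree (fun a h h' => ha₂ a (by omega) (by omega))
    (fun x hx => hA₂.2 x (by simp only [regs_flags, List.mem_cons, List.not_mem_nil, or_false]; omega))
  have hz₂ : ∀ a, 13 ≤ a → ∀ i, σ₂.arr a i = 0 := fun a ha i => by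
    rw [ha₂ a (by omega) (by omega)]
    exact hz₁ a (by omega) i
  rw [runs_seq]
  refine (runs_dfs (n := n) (M := 2 * m) (S := S) (D := D)
    (P := ZeroTight (σ₁.arr 3) (σ₁.arr 4) (wdist G w s t) D W)
    (R := Leave (2 * m) (σ₁.arr 3) (σ₁.arr 4) (wdist G w s t) S D W (t + 1))
    (by omega) (by omega) (by omega) b₂.reg0 b₂.reg7 b₂.arr6 b₂.arr7 hS hD
    (fun j _ i => hz₂ _ (by omega) i) ?_ ?_).mono ?_
  · intro σ' ha _
    simp only [Test.Holds, Expr.eval, ha 12 (by omega)]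
    exact hF' _
  · intro σ' ha hr _ _ h13
    simp only [Test.Holds, Expr.eval, ha 8 (by omega), ha 3 (by omega), ha 4 (by omega), h13,
      hr 8 (by omega), b₂.arr8, b₂.reg8, ha₂ 3 (by omega) (by omega), ha₂ 4 (by omega) (by omega)]
    rfl
  rintro σ₃ k₃ hA₃ ⟨O, hk₃⟩
  simp only [Nat.reduceAdd] at O
  have ha₃ : ∀ a, a < 20 ∨ 27 ≤ a → σ₃.arr a = σ₂.arr a := fun a h =>
    hA₃.1 a (by simp only [arrs_dfs, List.mem_cons, List.not_mem_nil, or_false]; omega)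
  have b₃ : Base G w s t (2 * m) S D W σ₃ := b₂.agree (fun a h h' => ha₃ a (by omega))
    (fun x hx => hA₃.2 x (by simp only [regs_dfs, List.mem_cons, List.not_mem_nil, or_false]; omega))
  have hz₃ : ∀ a, 13 ≤ a → a < 20 ∨ 27 ≤ a → ∀ i, σ₃.arr a i = 0 := fun a ha ha' i => by
    rw [ha₃ a ha']
    exact hz₂ a ha i
  have hlt := pre_lt_cnt O
  have hzt := fun h hh hS => zeroTight_iff hG H b₁.arr3 b₁.arr4 O (h := h) hh hS
  have hsym := fun h hh hP hS => zero_symm hG H b₁.arr3 b₁.arr4 O (h := h) hh hP hS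
  have hconn := fun v hv => connected_entry hG H b₁.arr3 b₁.arr4 O (v := v) hv
  rw [runs_seq]
  refine (runs_lowEdges (A := Entry (2 * m) (σ₁.arr 3) (σ₁.arr 4) (wdist G w s t) S D W (s + 1))
    (by omega) (by omega) b₃.reg0 b₃.reg7 rfl b₃.arr6 b₃.arr7 b₃.arr8 rfl O hlt hzt).mono ?_
  rintro σ₄ k₄ hA₄ ⟨L₄, I₄, hk₄⟩
  have ha₄ : ∀ a, a ≠ 13 → a ≠ 14 → σ₄.arr a = σ₃.arr a := fun a h h' =>
    hA₄.1 a (by simp only [arrs_lowEdges, List.mem_cons, List.not_mem_nil, or_false]; omega)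
  have hr₄ : ∀ x, x ≠ 10 → σ₄.reg x = σ₃.reg x := fun x hx =>
    hA₄.2 x (by simp only [regs_lowEdges, List.mem_cons, List.not_mem_nil, or_false]; omega)
  rw [runs_seq]
  refine (runs_lowUp (by omega) (hr₄ 14 (by omega)) (ha₄ 22 (by omega) (by omega))
    (ha₄ 23 (by omega) (by omega)) (ha₄ 24 (by omega) (by omega)) ?_ ?_ O L₄ I₄).mono ?_
  · rw [ha₄ 11 (by omega) (by omega), ha₃ 11 (by omega)]
    exact hF
  · rw [ha₄ 12 (by omega) (by omega), ha₃ 12 (by omega)]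
    exact hF'
  rintro σ₅ k₅ hA₅ ⟨L₅, I₅, hk₅⟩
  have ha₅ : ∀ a, a ≠ 13 → a ≠ 14 → σ₅.arr a = σ₃.arr a := fun a h h' =>
    (hA₅.1 a (by simp only [arrs_lowUp, List.mem_cons, List.not_mem_nil, or_false]; omega)).trans (ha₄ a h h')
  have hr₅ : ∀ x, x < 10 ∨ 14 ≤ x → σ₅.reg x = σ₃.reg x := fun x hx =>
    (hA₅.2 x (by simp only [regs_lowUp, List.mem_cons, List.not_mem_nil, or_false]; omega)).trans
      (hr₄ x (by omega))
  have hroot : ∀ i, 2 ≤ i → i < σ₃.reg 14 → σ₃.arr 22 (σ₃.arr 23 (σ₃.arr 24 i)) = 1 →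
      σ₅.arr 13 i = 0 := fun i hi hic hpp => low_root O hsym L₅ hconn hi hic hpp
  refine (runs_layout (by omega) (hr₅ 14 (by omega)) (ha₅ 22 (by omega) (by omega))
    (ha₅ 23 (by omega) (by omega)) (ha₅ 24 (by omega) (by omega)) rfl
    (fun i => by rw [ha₅ 15 (by omega) (by omega)]; exact hz₃ 15 (by omega) (by omega) i)
    (fun i => by rw [ha₅ 16 (by omega) (by omega)]; exact hz₃ 16 (by omega) (by omega) i)
    O hroot I₅).mono ?_
  rintro σ₆ k₆ hA₆ ⟨⟨sz, I₆⟩, hk₆⟩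
  have ha₆ : ∀ a, a < 13 ∨ 17 ≤ a → σ₆.arr a = σ₃.arr a := fun a h =>
    (hA₆.1 a (by simp only [arrs_layout, List.mem_cons, List.not_mem_nil, or_false]; omega)).trans
      (ha₅ a (by omega) (by omega))
  have hr₆ : ∀ x < 9, σ₆.reg x = σ₃.reg x := fun x hx =>
    (hA₆.2 x (by simp only [regs_layout, List.mem_cons, List.not_mem_nil, or_false]; omega)).trans
      (hr₅ x (by omega))
  have X := stOrder O hsym L₅ hroot I₆
  have b₆ := b₃.agree (fun a h h' => ha₆ a (by omega)) hr₆
  refine ⟨⟨S, D, W, _, _, H, cert_of_stOrder hG H b₁.arr3 b₁.arr4 O X, b₆, ?_, ?_⟩, ?_, by omega⟩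
  · intro v
    rw [ha₆ 22 (by omega)]
    simp
  · intro v
    rw [ha₆ 22 (by omega)]
  · intro a h h' i
    rw [ha₆ a (by omega)]
    exact hz₃ a (by omega) h' i

theorem runs_find (hG : G.Connected) (hE : IsEdgeList G src dst)
    (hB : InputBound G w s t src dst B) :
    Runs (6 * B) find (inputState G w s t src dst) fun σ' k =>
      (∃ S D W inD pos r r', Cert G w s t inD pos ∧
        Ordered G w s t (2 * m) S D W inD pos σ' ∧ Pointers G w s t inD pos r r' σ' ∧
        (∀ i, σ'.arr 19 i = 0) ∧
        ((σ'.reg 16 = 0 ∧ ∀ x y, ¬ Cand G w s t r r' x y) ∨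
        ∃ x y : Fin n, σ'.reg 16 = x + 1 ∧ σ'.reg 17 = y + 1 ∧ Cand G w s t r r' x y ∧
          ∀ x' y', Cand G w s t r r' x' y' → wdist G w s x + w s(x, y) + wdist G w y t ≤
            wdist G w s x' + w s(x', y') + wdist G w y' t)) ∧ k ≤ 156 * m + 79 * n + 53 := by
  have hs := s.2
  have hn := hB.1
  have hm := hB.2.1
  have hw : ∀ x y, G.Adj x y → w s(x, y) ≤ B := by
    intro x y hxy
    have : s(x, y) ∈ Set.range fun i => s(src i, dst i) := by
      rw [hE.2]
      simpa using hxy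
    obtain ⟨i, hi⟩ := this
    rw [← hi]
    exact hB.2.2.1 i
  rw [find, runs_seq]
  refine (runs_order hG hE hB).mono ?_
  rintro σ₁ k₁ - ⟨⟨S, D, W, inD, pos, H, C, o₁⟩, hz, hk₁⟩
  rw [runs_seq]
  refine (runs_predSucc (by omega) (by omega) H C o₁ (hz 17 (by omega) (by omega))
    (hz 18 (by omega) (by omega))).mono ?_
  rintro σ₂ k₂ hA₂ ⟨hp, hs', hk₂⟩
  have ha₂ : ∀ a, a ≠ 17 → a ≠ 18 → σ₂.arr a = σ₁.arr a := fun a h h' =>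
    hA₂.1 a (by simp [predSucc, Prog.arrs_range, Prog.arrs, h, h'])
  have o₂ := o₁.agree (fun a _ _ h h' _ => ha₂ a h h') (fun x hx =>
    hA₂.2 x (by simp [predSucc, Prog.regs_range, Prog.regs]; omega))
  rw [runs_seq]
  refine (runs_trees (c := s) (by omega) (by omega) (by omega) (by omega) hG H o₂ C.source
    (fun v => by rw [o₂.base.arr3, wdist_comm hG]) (fun j hj i => by
      rw [ha₂ _ (by omega) (by omega)]
      exact hz _ (by omega) (by omega) i)).mono ?_
  rintro σ₃ k₃ hA₃ ⟨⟨r, rank, T⟩, hk₃⟩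
  simp only [Nat.reduceAdd] at T
  have ha₃ : ∀ a, a < 30 ∨ 37 ≤ a → σ₃.arr a = σ₂.arr a := fun a h =>
    hA₃.1 a (by simp only [trees, arrs_dfs, List.mem_cons, List.not_mem_nil, or_false]; omega)
  have o₃ := o₂.agree (fun a _ _ _ _ _ => ha₃ a (by omega)) (fun x hx =>
    hA₃.2 x (by simp only [trees, regs_dfs, List.mem_cons, List.not_mem_nil, or_false]; omega))
  rw [runs_seq]
  refine (runs_trees (c := t) (by omega) (by omega) (by omega) (by omega) hG H o₃ C.target
    o₃.base.arr4 (fun j hj i => by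
      rw [ha₃ _ (by omega), ha₂ _ (by omega) (by omega)]
      exact hz _ (by omega) (by omega) i)).mono ?_
  rintro σ₄ k₄ hA₄ ⟨⟨r', rank', T'⟩, hk₄⟩
  simp only [Nat.reduceAdd] at T'
  have ha₄ : ∀ a, a < 40 ∨ 47 ≤ a → σ₄.arr a = σ₃.arr a := fun a h =>
    hA₄.1 a (by simp only [trees, arrs_dfs, List.mem_cons, List.not_mem_nil, or_false]; omega)
  have o₄ := o₃.agree (fun a _ _ _ _ _ => ha₄ a (by omega)) (fun x hx =>
    hA₄.2 x (by simp only [trees, regs_dfs, List.mem_cons, List.not_mem_nil, or_false]; omega))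
  refine (runs_search (r := r) (r' := r') (by omega) (by omega) hG H C o₄ ?_ T'.root_eq ?_).mono ?_
  · rw [ha₄ 35 (by omega)]
    exact T.root_eq
  · intro x y hxy
    have h1 := hw x y hxy
    have h2 := (hB.2.2.2 x).1
    have h3 := (hB.2.2.2 y).2
    omega
  rintro σ₅ k₅ hA₅ ⟨hc, hk₅⟩
  have ha₅ : σ₅.arr = σ₄.arr := by
    funext a
    exact hA₅.1 a (by simp [search, Prog.arrs_range, Prog.arrs])
  refine ⟨⟨S, D, W, inD, pos, r, r', C, o₄.agree (fun a _ _ _ _ _ => by rw [ha₅])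
    (fun x hx => hA₅.2 x (by simp [search, Prog.regs_range, Prog.regs]; omega)),
    ⟨?_, ?_, ?_, ?_⟩, ?_, hc⟩, by omega⟩
  · rw [ha₅, ha₄ 17 (by omega), ha₃ 17 (by omega)]
    exact hp
  · rw [ha₅, ha₄ 18 (by omega), ha₃ 18 (by omega)]
    exact hs'
  · rw [ha₅, ha₄ 33 (by omega), ha₄ 35 (by omega)]
    exact ⟨_, T⟩
  · rw [ha₅]
    exact ⟨_, T'⟩
  · rw [ha₅, ha₄ 19 (by omega), ha₃ 19 (by omega), ha₂ 19 (by omega) (by omega)]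
    exact hz 19 (by omega) (by omega)

theorem runs_solve (hG : G.Connected) (hE : IsEdgeList G src dst)
    (hB : InputBound G w s t src dst B) :
    Runs (6 * B) solve (inputState G w s t src dst) fun σ' k =>
      k ≤ 300 * (m + n) ∧ SolvesDetour G w s t σ'.output := by
  -- The vertex s shows that n ≥ 1, so the additive constants of the phases are absorbed into the
  -- multiple of n.
  have hs := s.2
  have hn := hB.1
  rw [solve, runs_seq]
  refine (runs_find hG hE hB).mono ?_
  rintro σ₁ k₁ - ⟨⟨S, D, W, inD, pos, r, r', C, o, P, hz, hc⟩, hk₁⟩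
  have X := P.treeData hG C
  rw [runs_ite, runs_skip]
  constructor
  · intro h0
    rcases hc with ⟨-, hno⟩ | ⟨x, y, h1, -⟩
    · refine ⟨by omega, .inr ⟨?_, ?_⟩⟩
      · simp [State.output, o.base.reg4]
      · rintro ⟨p, hp⟩
        obtain ⟨x, y, hxy, -⟩ := X.exists_cand_le hG hp
        exact hno x y hxy
    · simp only [Test.Holds, Expr.eval] at h0
      omega
  · intro h0
    rcases hc with ⟨h1, -⟩ | ⟨x, y, h1, h2, hxy, hmin⟩
    · exact absurd h1 h0
    · refine (runs_answer (by omega) hG C o P hz hxy h1 h2).mono ?_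
      rintro σ₂ k₂ - ⟨⟨p, hp, hl, hout⟩, hk₂⟩
      refine ⟨by omega, .inl ⟨p, ⟨hp, fun q hq => ?_⟩, hout⟩⟩
      obtain ⟨x', y', hc', hl'⟩ := X.exists_cand_le hG hq
      exact hl.trans ((hmin x' y' hc').trans hl')

end

theorem exists_edgeList {n : ℕ} (G : SimpleGraph (Fin n)) :
    ∃ (m : ℕ) (src dst : Fin m → Fin n), IsEdgeList G src dst := by
  classical
  let f := (Fintype.equivFin G.edgeSet).symm
  refine ⟨_, fun i => (f i : Sym2 (Fin n)).out.1, fun i => (f i : Sym2 (Fin n)).out.2, ?_, ?_⟩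
  · intro i j hij
    simp only [Prod.mk.eta, Sym2.mk, Quot.out_eq] at hij
    exact f.injective (Subtype.ext hij)
  · ext e
    simp only [Prod.mk.eta, Sym2.mk, Quot.out_eq, Set.mem_range]
    constructor
    · rintro ⟨i, rfl⟩
      exact (f i).2
    · intro he
      exact ⟨f.symm ⟨e, he⟩, by simp⟩

/-- The combinatorial data for the second claim are read off runs of the program: `find`, on some
edge list with a large enough bound, yields D and the two forests, and `answer`, started with an
arbitrary candidate in registers 16 and 17, exhibits a detour through it. -/
theorem exists_treeData {n : ℕ} {G : SimpleGraph (Fin n)} (hG : G.Connected)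
    (w : Sym2 (Fin n) → ℕ) (s t : Fin n) :
    ∃ (inD : Fin n → Prop) (r r' : Fin n → Fin n), TreeData G w s t inD r r' ∧
      (∀ x y, Cand G w s t r r' x y → ∃ p : G.Walk s t, IsDetour w p ∧
        walkLength w p ≤ wdist G w s x + w s(x, y) + wdist G w y t) ∧
      ∀ v, inD v → wdist G w s v + wdist G w v t = wdist G w s t := by
  obtain ⟨m, src, dst, hE⟩ := exists_edgeList G
  have hB : InputBound G w s t src dst (n + m + ∑ i, w s(src i, dst i) +
      ∑ v, (wdist G w s v + wdist G w v t)) := by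
    refine ⟨by omega, by omega, fun i => ?_, fun v => ?_⟩
    · have := Finset.single_le_sum (f := fun i => w s(src i, dst i)) (fun _ _ => Nat.zero_le _)
        (Finset.mem_univ i)
      omega
    · have := Finset.single_le_sum (f := fun v => wdist G w s v + wdist G w v t)
        (fun _ _ => Nat.zero_le _) (Finset.mem_univ v)
      omega
  obtain ⟨k, σ, -, ⟨S, D, W, inD, pos, r, r', C, o, P, hz, -⟩, -⟩ := runs_find hG hE hB
  refine ⟨inD, r, r', P.treeData hG C, fun x y hxy => ?_, C.tight⟩
  have o' : Ordered G w s t (2 * m) S D W inD pos ((σ.set 16 (x + 1)).set 17 (y + 1)) :=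
    o.agree (fun _ _ _ _ _ _ => rfl) fun z hz => by
      rw [State.set_reg, State.set_reg, if_neg (by omega), if_neg (by omega)]
  obtain ⟨k, σ', -, ⟨p, hp, hl, -⟩, -⟩ := runs_answer (x := x) (y := y) le_rfl hG C o'
    (r := r) (r' := r') ⟨P.pred, P.succ, P.tree, P.tree'⟩ hz hxy (by simp) (by simp)
  exact ⟨p, hp, hl⟩

end Detour

theorem mainTheorem3 :
    (∃ (c : Detour.Prog) (C : ℕ),
      ∀ (n m : ℕ) (G : SimpleGraph (Fin n)) (w : Sym2 (Fin n) → ℕ) (s t : Fin n)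
        (src dst : Fin m → Fin n) (B : ℕ),
        G.Connected → Detour.IsEdgeList G src dst → Detour.InputBound G w s t src dst B →
        ∃ (k : ℕ) (σ : Detour.State),
          Detour.Exec (C * B) c (Detour.inputState G w s t src dst) k σ ∧
          k ≤ C * (m + n) ∧
          Detour.SolvesDetour G w s t σ.output) ∧
    (∀ (n : ℕ) (G : SimpleGraph (Fin n)) (w : Sym2 (Fin n) → ℕ) (s t : Fin n)
      (T : SimpleGraph (Fin n)),
      G.Connected → Detour.IsShortestPathTree G w s T →
      (⨅ (p : G.Walk s t) (_ : Detour.IsDetour w p), (Detour.walkLength w p : ℕ∞)) =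
        ⨅ (x : Fin n) (y : Fin n), Detour.crossCost G w s t T x y) := by
  refine ⟨⟨Detour.solve, 300, fun n m G w s t src dst B hG hE hB => ?_⟩,
    fun n G w s t T hG hT => ?_⟩
  · obtain ⟨k, σ, hexec, hk, hsol⟩ := Detour.runs_solve hG hE hB
    exact ⟨k, σ, hexec.mono (by omega), hk, hsol⟩
  · obtain ⟨inD, r, r', X, hdet, hDt⟩ := Detour.exists_treeData hG w s t
    exact Detour.iInf_detour_eq X hT hdet hG hDt
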